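/- Let $n\ge 0$ and let $w=w_1\cdots w_n\in S_n$. Let $\ell(w)$ be the number of pairs $i<j$ with $w_i>w_j$, let $\preceq$ be the strong Bruhat order on $S_n$ (the reflexive transitive closure of the relations $u\prec u\,t_{ij}$ with $t_{ij}$ a transposition and $\ell(u\,t_{ij})=\ell(u)+1$), and let $P_w(t)=\sum_{u\preceq w}t^{\ell(u)}$ be the Poincaré polynomial. Let $O_w=\{(i,w_j): i<j,\ w_i<w_j\}\subseteq[n]\times[n]$ be the south-west diagram of $w$. For a prime power $q$, let $\mathrm{mat}_w(q)$ be the number of invertible $n\times n$ matrices over the field $\mathbf F_q$ with $q$ elements all of whose entries in positions belonging to $O_w$ are zero, and put $M_w(q)=\mathrm{mat}_w(q)/(q-1)^n$. Then $$M_w(q)=q^{\binom n2+\ell(w)}P_w(q^{-1})\qquad\text{for all prime powers } q$$ if and only if $w$ avoids the patterns $4231$, $35142$, $42513$ and $351624$. Moreover, if $w$ contains one of these patterns, then the equation fails for every sufficiently large prime power $q$ (with a bound that may depend on $w$). -/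

import Mathlib

namespace BruhatMatrix

/-- The length `ℓ(w)`: the number of pairs `i < j` with `w i > w j`. -/
def length {n : ℕ} (w : Equiv.Perm (Fin n)) : ℕ :=
  (Finset.univ.filter fun p : Fin n × Fin n => p.1 < p.2 ∧ w p.2 < w p.1).card

/-- The relation `w ≺ w · t_{ij}` where `ℓ(w · t_{ij}) = ℓ(w) + 1`. -/
def BruhatCover {n : ℕ} (u v : Equiv.Perm (Fin n)) : Prop :=
  ∃ i j : Fin n, v = u * Equiv.swap i j ∧ length v = length u + 1

/-- The strong Bruhat order, generated by its cover relations. -/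
def BruhatLE {n : ℕ} (u v : Equiv.Perm (Fin n)) : Prop :=
  Relation.ReflTransGen BruhatCover u v

open Classical in
/-- The Poincaré polynomial `P_w(t) = ∑_{u ≼ w} t ^ ℓ(u)`. -/
noncomputable def poincare {n : ℕ} (w : Equiv.Perm (Fin n)) : Polynomial ℤ :=
  ∑ u ∈ Finset.univ.filter (fun u : Equiv.Perm (Fin n) => BruhatLE u w),
    Polynomial.X ^ length u

/-- The south-west diagram `O_w`: all cells `(i, w j)` with `i < j` and `w i < w j`. -/
def swDiagram {n : ℕ} (w : Equiv.Perm (Fin n)) : Set (Fin n × Fin n) :=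
  {c | ∃ i j : Fin n, i < j ∧ w i < w j ∧ c = (i, w j)}

/-- Invertible matrices over `F` whose nonzero entries all lie outside `O_w`. -/
def matSet (F : Type) [Field F] {n : ℕ} (w : Equiv.Perm (Fin n)) :
    Set (Matrix (Fin n) (Fin n) F) :=
  {A | IsUnit A ∧ ∀ i j, (i, j) ∈ swDiagram w → A i j = 0}

/-- The matrix count `mat_w(q)`, where `q` is the number of elements of `F`. -/
noncomputable def matCount (F : Type) [Field F] {n : ℕ} (w : Equiv.Perm (Fin n)) : ℕ :=
  (matSet F w).ncard

/-- The normalized matrix count `M_w(q) = mat_w(q) / (q - 1) ^ n`. -/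
noncomputable def normMatCount (F : Type) [Field F] {n : ℕ} (w : Equiv.Perm (Fin n)) : ℚ :=
  (matCount F w : ℚ) / ((Nat.card F : ℚ) - 1) ^ n

/-- The equation `M_w(q) = q ^ (C(n,2) + ℓ(w)) P_w(q⁻¹)` at `q = #F`. -/
def CountEqPoincare (F : Type) [Field F] {n : ℕ} (w : Equiv.Perm (Fin n)) : Prop :=
  normMatCount F w =
    (Nat.card F : ℚ) ^ (n.choose 2 + length w) *
      Polynomial.aeval ((Nat.card F : ℚ)⁻¹) (poincare w)

/-- `w` contains the pattern with one-line notation `p`: some subsequence of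
`w` is order-isomorphic to `p`. -/
def ContainsPattern {n k : ℕ} (w : Equiv.Perm (Fin n)) (p : Fin k → ℕ) : Prop :=
  ∃ f : Fin k → Fin n, StrictMono f ∧ ∀ a b, w (f a) < w (f b) ↔ p a < p b

/-- `w` avoids the patterns 4231, 35142, 42513 and 351624. -/
def IsGasharovReiner {n : ℕ} (w : Equiv.Perm (Fin n)) : Prop :=
  ¬ ContainsPattern w ![4, 2, 3, 1] ∧ ¬ ContainsPattern w ![3, 5, 1, 4, 2] ∧
    ¬ ContainsPattern w ![4, 2, 5, 1, 3] ∧ ¬ ContainsPattern w ![3, 5, 1, 6, 2, 4]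

end BruhatMatrix

/-! ### Length under transpositions and the rank criterion for the Bruhat order -/

namespace BruhatMatrix

open Equiv

/-! After clearing denominators the equation reads `matCount F w = (q - 1) ^ n * lowerSum q w`
(`countEqPoincare_iff`).

Avoidance gives equality because both counts obey the same recursion at a light descent: exchange
the two entries, or delete the top of the descent (`LightDescent.lowerSum_eq`,
`LightDescent.matCount_eq`). Both are invariant under inversion and reverse complement, and both
peel off a fixed first point. Light exchanges preserve the avoidance class in both directions, so
the equation can be transferred up or down. If an avoiding `w` does not fix the first point, then
`w` or its inverse has a light first descent, or a rigid heavy prefix (`Avoiding.light_or_heavy`);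
the latter is unwound by light exchanges and their mirror images (`HeavyPrefix.induction`).

Containment gives failure by arithmetic modulo `q - 1`. Free torus actions show that the matrix
count is `rookCount * (q - 1) ^ n` modulo `(q - 1) ^ (n + 1)` (`exists_zeroCount_eq`), while
`lowerSum` is `lowerCard` modulo `q - 1`. The equation would make `q - 1` divide `lowerCard -
rookCount`, which is impossible for large `q` once `rookCount < lowerCard`.

For this strict inequality, rook placements avoiding the diagram become words, each determined by
the order in which it lists the inversion pairs of `w`. A Sauer–Shelah type bound replaces these
sign vectors by at least as many unbroken sets of inversions. Unbroken sets have distinct ordered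
products of transpositions, and every such product leads from `w` to an element below `w`
(`rookCount_lt_lowerCard`). Each of the four patterns yields an element below `w` that is missed
(`subProd_mul_ne`). -/

theorem sum_eq_add_add_sum_erase {n : ℕ} {M : Type*} [AddCommMonoid M] {i j : Fin n} (h : i ≠ j)
    (f : Fin n → M) :
    ∑ k, f k = f i + f j + ∑ k ∈ (Finset.univ.erase i).erase j, f k := by
  rw [← Finset.add_sum_erase _ f (Finset.mem_univ i),
    ← Finset.add_sum_erase (Finset.univ.erase i) f (a := j) (by simp [h.symm]), add_assoc]

theorem length_eq_sum {n : ℕ} (u : Perm (Fin n)) :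
    (length u : ℤ) = ∑ k, ∑ l, if k < l ∧ u l < u k then 1 else 0 := by
  rw [length, Finset.card_filter, ← Finset.univ_product_univ, Finset.sum_product]
  push_cast
  rfl

/-- Only pairs meeting `i` or `j` change. The exchanged pair gives one inversion; a third position
gives two exactly when its dot lies inside the rectangle spanned by the two exchanged dots. -/
theorem length_mul_swap {n : ℕ} (u : Perm (Fin n)) {i j : Fin n} (hij : i < j) (hu : u i < u j) :
    length (u * swap i j) = length u + 1 +
      2 * (Finset.univ.filter fun k => i < k ∧ k < j ∧ u i < u k ∧ u k < u j).card := by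
  have key : (length (u * swap i j) : ℤ) - length u = 1 +
      2 * ∑ k, if (i < k ∧ k < j ∧ u i < u k ∧ u k < u j) then 1 else 0 := by
    -- Reindexing moves the swap into the position comparison, so the value comparisons of the two
    -- lengths agree term by term.
    have h1 : (length (u * swap i j) : ℤ) =
        ∑ k, ∑ l, if swap i j k < swap i j l ∧ u l < u k then 1 else 0 := by
      rw [length_eq_sum, ← Equiv.sum_comp (swap i j)]
      refine Finset.sum_congr rfl fun k _ => ?_
      rw [← Equiv.sum_comp (swap i j)]
      simp
    rw [h1, length_eq_sum, ← Finset.sum_sub_distrib]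
    simp_rw [← Finset.sum_sub_distrib]
    have hne := hij.ne
    rw [sum_eq_add_add_sum_erase hne, sum_eq_add_add_sum_erase hne,
      sum_eq_add_add_sum_erase hne (fun l => (if swap i j j < swap i j l ∧ u l < u j then (1 : ℤ) else 0) -
        if j < l ∧ u l < u j then 1 else 0),
      sum_eq_add_add_sum_erase hne (fun k => if (i < k ∧ k < j ∧ u i < u k ∧ u k < u j) then (1 : ℤ) else 0)]
    have h3 : ∀ k ∈ (Finset.univ.erase i).erase j,
        (∑ l, ((if swap i j k < swap i j l ∧ u l < u k then (1 : ℤ) else 0) -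
          if k < l ∧ u l < u k then 1 else 0)) =
        (if k < j ∧ u i < u k then 1 else 0) - (if k < i ∧ u i < u k then 1 else 0) +
        ((if k < i ∧ u j < u k then 1 else 0) - (if k < j ∧ u j < u k then 1 else 0)) := by
      intro k hk
      simp only [Finset.mem_erase, Finset.mem_univ, and_true] at hk
      rw [sum_eq_add_add_sum_erase hne, Finset.sum_eq_zero, add_zero]
      · simp [swap_apply_of_ne_of_ne hk.2 hk.1]
      · intro l hl
        simp only [Finset.mem_erase, Finset.mem_univ, and_true] at hl
        simp [swap_apply_of_ne_of_ne hk.2 hk.1, swap_apply_of_ne_of_ne hl.2 hl.1]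
    rw [Finset.sum_congr rfl h3]
    have h4 : ∀ k ∈ (Finset.univ.erase i).erase j,
        ((if swap i j i < swap i j k ∧ u k < u i then (1 : ℤ) else 0) -
          if i < k ∧ u k < u i then 1 else 0) +
        ((if swap i j j < swap i j k ∧ u k < u j then (1 : ℤ) else 0) -
          if j < k ∧ u k < u j then 1 else 0) +
        ((if k < j ∧ u i < u k then 1 else 0) - (if k < i ∧ u i < u k then 1 else 0) +
        ((if k < i ∧ u j < u k then 1 else 0) - (if k < j ∧ u j < u k then 1 else 0))) =
        2 * (if (i < k ∧ k < j ∧ u i < u k ∧ u k < u j) then 1 else 0) := by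
      intro k hk
      simp only [Finset.mem_erase, Finset.mem_univ, and_true] at hk
      have e1 : u k ≠ u i := fun h => hk.2 (u.injective h)
      have e2 : u k ≠ u j := fun h => hk.1 (u.injective h)
      simp only [swap_apply_of_ne_of_ne hk.2 hk.1, swap_apply_left, swap_apply_right]
      rcases lt_or_gt_of_ne hk.2 with a | a <;> rcases lt_or_gt_of_ne hk.1 with b | b <;>
        rcases lt_or_gt_of_ne e1 with c | c <;> rcases lt_or_gt_of_ne e2 with d | d <;>
        simp [a, b, c, d, a.not_gt, b.not_gt, c.not_gt, d.not_gt] <;> order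
    have h5 := Finset.sum_congr rfl h4
    rw [Finset.sum_add_distrib, Finset.sum_add_distrib, ← Finset.mul_sum] at h5
    simp only [swap_apply_left, swap_apply_right, lt_irrefl, false_and, and_false, if_false, hij, hu,
      hij.not_gt, hu.not_gt, and_self, if_true, sub_zero] at h5 ⊢
    linarith
  have : (∑ k, if (i < k ∧ k < j ∧ u i < u k ∧ u k < u j) then (1 : ℤ) else 0) =
      ((Finset.univ.filter fun k => i < k ∧ k < j ∧ u i < u k ∧ u k < u j).card : ℤ) := by
    rw [Finset.card_filter]; push_cast; rfl
  rw [this] at key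
  zify
  linarith

/-- The number of dots of `u` in the first `p` rows and in columns at least `q`. -/
def rk {n : ℕ} (u : Perm (Fin n)) (p q : ℕ) : ℕ :=
  ∑ k : Fin n, if k.val < p ∧ q ≤ (u k).val then 1 else 0

theorem rk_mul_swap {n : ℕ} (u : Perm (Fin n)) {i j : Fin n} (hij : i < j) (hu : u i < u j)
    (p q : ℕ) :
    rk (u * swap i j) p q = rk u p q +
      if i.val < p ∧ p ≤ j.val ∧ (u i).val < q ∧ q ≤ (u j).val then 1 else 0 := by
  rw [rk, rk, sum_eq_add_add_sum_erase hij.ne, sum_eq_add_add_sum_erase hij.ne]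
  have : ∀ k ∈ (Finset.univ.erase i).erase j,
      (if k.val < p ∧ q ≤ ((u * swap i j) k).val then 1 else 0) =
      if k.val < p ∧ q ≤ (u k).val then 1 else 0 := by
    intro k hk
    simp only [Finset.mem_erase, Finset.mem_univ, and_true] at hk
    simp [swap_apply_of_ne_of_ne hk.2 hk.1]
  rw [Finset.sum_congr rfl this]
  simp only [Perm.mul_apply, swap_apply_left, swap_apply_right]
  have h1 : i.val < j.val := hij
  have h2 : (u i).val < (u j).val := hu
  split_ifs <;> omega

theorem BruhatCover.exists_lt {n : ℕ} {u v : Perm (Fin n)} (h : BruhatCover u v) :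
    ∃ i j : Fin n, i < j ∧ u i < u j ∧ v = u * swap i j := by
  obtain ⟨i, j, rfl, hl⟩ := h
  wlog hij : i < j generalizing i j
  · rcases eq_or_ne i j with rfl | hne
    · rw [swap_self] at hl
      exact absurd hl (Nat.succ_ne_self _).symm
    · obtain ⟨a, b, h⟩ := this j i (by rwa [swap_comm]) (lt_of_le_of_ne (not_lt.1 hij) hne.symm)
      exact ⟨a, b, by rwa [swap_comm i j]⟩
  rcases lt_or_gt_of_ne (fun h => hij.ne (u.injective h)) with h | h
  · exact ⟨i, j, hij, h, rfl⟩
  · have := length_mul_swap (u * swap i j) hij (by simpa using h)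
    simp only [mul_assoc, swap_mul_self, mul_one] at this
    omega

theorem BruhatLE.rk_le {n : ℕ} {u v : Perm (Fin n)} (h : BruhatLE u v) (p q : ℕ) :
    rk u p q ≤ rk v p q := by
  induction h with
  | refl => rfl
  | tail _ hc ih =>
    obtain ⟨i, j, hij, hu, rfl⟩ := hc.exists_lt
    rw [rk_mul_swap _ hij hu]
    omega

theorem BruhatLE.length_le {n : ℕ} {u v : Perm (Fin n)} (h : BruhatLE u v) :
    length u ≤ length v := by
  induction h with
  | refl => rfl
  | tail _ hc ih =>
    obtain ⟨i, j, -, hl⟩ := hc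
    omega

theorem length_le_sq {n : ℕ} (u : Perm (Fin n)) : length u ≤ n * n := by
  refine (Finset.card_le_univ _).trans ?_
  simp

theorem rk_eq_add {n : ℕ} (u : Perm (Fin n)) (p : ℕ) {q r : ℕ} (h : q ≤ r) :
    rk u p q = rk u p r + ∑ k : Fin n, if k.val < p ∧ q ≤ (u k).val ∧ (u k).val < r then 1 else 0 := by
  rw [rk, rk, ← Finset.sum_add_distrib]
  refine Finset.sum_congr rfl fun k _ => ?_
  split_ifs <;> omega

/-- At the first disagreement `i` the ranks force `u i < v i`. Exchanging `i` with the nearest later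
`j` such that `u i < u j ≤ v i` is a cover, and the rank inequality is strict wherever the exchange
raises the rank of `u`. -/
theorem exists_cover_of_rk_le {n : ℕ} {u v : Perm (Fin n)} (h : ∀ p q, rk u p q ≤ rk v p q)
    (hne : u ≠ v) : ∃ u', BruhatCover u u' ∧ ∀ p q, rk u' p q ≤ rk v p q := by
  classical
  obtain ⟨i, hi, hmin⟩ : ∃ i, u i ≠ v i ∧ ∀ k < i, u k = v k := by
    have hex : (Finset.univ.filter fun i => u i ≠ v i).Nonempty := by
      by_contra hc
      rw [Finset.not_nonempty_iff_eq_empty, Finset.filter_eq_empty_iff] at hc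
      exact hne (Equiv.ext fun x => not_not.1 (hc (Finset.mem_univ x)))
    refine ⟨_, (Finset.mem_filter.1 (Finset.min'_mem _ hex)).2, fun k hk => ?_⟩
    by_contra hc
    exact absurd (Finset.min'_le _ k (by simp [hc])) (not_le.2 hk)
  have hlt : u i < v i := by
    refine lt_of_le_of_ne (not_lt.1 fun hgt => ?_) hi
    have h1 := h (i.val + 1) (u i).val
    rw [rk, rk] at h1
    refine absurd h1 (not_le.2 (Finset.sum_lt_sum (fun k _ => ?_) ⟨i, Finset.mem_univ _, ?_⟩))
    · rcases lt_trichotomy k i with hk | rfl | hk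
      · rw [hmin k hk]
      · have : ¬ (u k).val ≤ (v k).val := not_le.2 hgt
        simp [this]
      · have : ¬ k.val < i.val + 1 := by have : i.val < k.val := hk; omega
        simp [this]
    · have : ¬ (u i).val ≤ (v i).val := not_le.2 hgt
      simp [this]
  obtain ⟨j, hj, hjmin⟩ : ∃ j, (i < j ∧ u i < u j ∧ u j ≤ v i) ∧
      ∀ k, i < k → k < j → ¬ (u i < u k ∧ u k ≤ v i) := by
    have hex : (Finset.univ.filter fun j => i < j ∧ u i < u j ∧ u j ≤ v i).Nonempty := by
      refine ⟨u.symm (v i), ?_⟩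
      have : i < u.symm (v i) := by
        rcases lt_trichotomy i (u.symm (v i)) with hk | hk | hk
        · exact hk
        · exact absurd ((Equiv.eq_symm_apply u).1 hk) hi
        · have := hmin _ hk
          rw [apply_symm_apply] at this
          exact absurd (v.injective this).symm hk.ne
      simp [this, hlt]
    refine ⟨_, (Finset.mem_filter.1 (Finset.min'_mem _ hex)).2, fun k hk1 hk2 hk3 => ?_⟩
    exact absurd (Finset.min'_le _ k (by simp [hk1, hk3])) (not_le.2 hk2)
  refine ⟨u * swap i j, ⟨i, j, rfl, ?_⟩, fun p q => ?_⟩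
  · rw [length_mul_swap u hj.1 hj.2.1, Finset.filter_eq_empty_iff.2, Finset.card_empty]
    rintro k - ⟨h1, h2, h3, h4⟩
    exact hjmin k h1 h2 ⟨h3, h4.le.trans hj.2.2⟩
  · rw [rk_mul_swap u hj.1 hj.2.1]
    split_ifs with hc
    swap
    · exact h p q
    have hvi : (u i).val < (v i).val := hlt
    have hji : (u j).val ≤ (v i).val := hj.2.2
    -- Beyond column `v i` the hypothesis suffices. In columns `q` to `v i` the rows before `i`
    -- agree, `u` has no dot in rows `i` to `p - 1` by minimality of `j`, and `v` has one in row
    -- `i`.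
    rw [rk_eq_add u p (r := (v i).val + 1) (by omega), rk_eq_add v p (r := (v i).val + 1) (by omega)]
    have h2 : (∑ k : Fin n, if k.val < p ∧ q ≤ (u k).val ∧ (u k).val < (v i).val + 1 then 1 else 0) <
        ∑ k : Fin n, if k.val < p ∧ q ≤ (v k).val ∧ (v k).val < (v i).val + 1 then 1 else 0 := by
      have hiu : ¬ q ≤ (u i).val := by omega
      refine Finset.sum_lt_sum (fun k _ => ?_) ⟨i, Finset.mem_univ _, ?_⟩
      · rcases lt_trichotomy k i with hk | rfl | hk
        · rw [hmin k hk]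
        · simp [hiu]
        · have h3 : ¬ (k.val < p ∧ q ≤ (u k).val ∧ (u k).val < (v i).val + 1) := by
            rintro ⟨h4, h5, h6⟩
            refine hjmin k hk (Fin.lt_def.2 (by omega)) ⟨Fin.lt_def.2 (by omega), Fin.le_def.2 (by omega)⟩
          rw [if_neg h3]
          exact Nat.zero_le _
      · rw [if_neg (by omega), if_pos (by omega)]
        exact one_pos
    have h1 := h p ((v i).val + 1)
    omega

theorem bruhatLE_iff_rk {n : ℕ} {u v : Perm (Fin n)} :
    BruhatLE u v ↔ ∀ p q, rk u p q ≤ rk v p q := by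
  refine ⟨fun h => h.rk_le, fun h => ?_⟩
  induction hm : n * n - length u using Nat.strong_induction_on generalizing u with
  | _ m ih =>
    by_cases hne : u = v
    · subst hne; exact Relation.ReflTransGen.refl
    · obtain ⟨u', hc, hu'⟩ := exists_cover_of_rk_le h hne
      have hl : length u' = length u + 1 := by obtain ⟨_, _, _, hl⟩ := hc; exact hl
      have := length_le_sq u'
      exact Relation.ReflTransGen.head hc (ih _ (by omega) hu' rfl)

theorem bruhatLE_mul_swap {n : ℕ} (u : Perm (Fin n)) {i j : Fin n} (hij : i < j) (hu : u j < u i) :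
    BruhatLE (u * swap i j) u := by
  rw [bruhatLE_iff_rk]
  intro p q
  have := rk_mul_swap (u * swap i j) hij (by simpa using hu) p q
  simp only [mul_assoc, swap_mul_self, mul_one] at this
  omega

end BruhatMatrix

/-! ### Deleting a dot, light descents and the recursion for `lowerSum` -/

namespace BruhatMatrix

open Equiv

/-- The permutation matrix of `g` enlarged by a dot in row `p` and column `c`. -/
def insertDot {n : ℕ} (p c : Fin (n + 1)) (g : Perm (Fin n)) : Perm (Fin (n + 1)) :=
  (finSuccEquiv' p).trans ((Equiv.optionCongr g).trans (finSuccEquiv' c).symm)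

@[simp]
theorem insertDot_self {n : ℕ} (p c : Fin (n + 1)) (g : Perm (Fin n)) : insertDot p c g p = c := by
  simp [insertDot]

@[simp]
theorem insertDot_succAbove {n : ℕ} (p c : Fin (n + 1)) (g : Perm (Fin n)) (k : Fin n) :
    insertDot p c g (p.succAbove k) = c.succAbove (g k) := by
  simp [insertDot]

theorem exists_insertDot {n : ℕ} (v : Perm (Fin (n + 1))) (p : Fin (n + 1)) :
    ∃ g : Perm (Fin n), insertDot p (v p) g = v := by
  have hex : ∀ k : Fin n, ∃ l : Fin n, (v p).succAbove l = v (p.succAbove k) := fun k =>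
    Fin.exists_succAbove_eq fun h => Fin.succAbove_ne p k (v.injective h)
  choose g hg using hex
  have hinj : Function.Injective g := fun k l h => by
    have := (hg k).symm.trans ((congrArg _ h).trans (hg l))
    exact Fin.succAbove_right_injective (v.injective this)
  refine ⟨Equiv.ofBijective g (Finite.injective_iff_bijective.1 hinj), Equiv.ext fun x => ?_⟩
  rcases eq_or_ne x p with rfl | hx
  · simp
  · obtain ⟨k, rfl⟩ := Fin.exists_succAbove_eq hx
    simp [hg]

/-- The permutation obtained by deleting row `p` together with the column of its dot. -/
noncomputable def del {n : ℕ} (v : Perm (Fin (n + 1))) (p : Fin (n + 1)) : Perm (Fin n) :=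
  (exists_insertDot v p).choose

theorem insertDot_del {n : ℕ} (v : Perm (Fin (n + 1))) (p : Fin (n + 1)) :
    insertDot p (v p) (del v p) = v :=
  (exists_insertDot v p).choose_spec

theorem succAbove_del {n : ℕ} (v : Perm (Fin (n + 1))) (p : Fin (n + 1)) (k : Fin n) :
    (v p).succAbove (del v p k) = v (p.succAbove k) := by
  conv_rhs => rw [← insertDot_del v p]
  rw [insertDot_succAbove]

theorem insertDot_injective {n : ℕ} (p c : Fin (n + 1)) :
    Function.Injective (insertDot p c : Perm (Fin n) → _) := fun g h hgh => by
  refine Equiv.ext fun k => Fin.succAbove_right_injective (p := c) ?_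
  rw [← insertDot_succAbove p, ← insertDot_succAbove p, hgh]

theorem del_insertDot {n : ℕ} (p c : Fin (n + 1)) (g : Perm (Fin n)) :
    del (insertDot p c g) p = g := by
  apply insertDot_injective p c
  have := insertDot_del (insertDot p c g) p
  rwa [insertDot_self] at this

theorem del_lt_del_iff {n : ℕ} (v : Perm (Fin (n + 1))) (p : Fin (n + 1)) (k l : Fin n) :
    del v p k < del v p l ↔ v (p.succAbove k) < v (p.succAbove l) := by
  rw [← succAbove_del, ← succAbove_del, (Fin.strictMono_succAbove _).lt_iff_lt]

theorem val_succAbove {n : ℕ} (p : Fin (n + 1)) (k : Fin n) :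
    (p.succAbove k).val = if k.val < p.val then k.val else k.val + 1 := by
  rw [Fin.succAbove]
  simp only [Fin.lt_def, Fin.val_castSucc]
  split_ifs <;> simp

theorem rk_insertDot {n : ℕ} (x c : Fin (n + 1)) (g : Perm (Fin n)) (p q : ℕ) :
    rk (insertDot x c g) p q = (if x.val < p ∧ q ≤ c.val then 1 else 0) +
      rk g (if p ≤ x.val then p else p - 1) (if q ≤ c.val then q else q - 1) := by
  rw [rk, Fin.sum_univ_succAbove _ x, insertDot_self, rk]
  congr 1
  refine Finset.sum_congr rfl fun k _ => ?_
  rw [insertDot_succAbove, val_succAbove, val_succAbove]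
  refine if_congr ?_ rfl rfl
  split_ifs <;> omega

/-- The common dot contributes equally to both ranks, and every pair of rank indices for the small
permutations comes from a pair for the large ones. -/
theorem bruhatLE_insertDot_iff {n : ℕ} (x c : Fin (n + 1)) (g h : Perm (Fin n)) :
    BruhatLE (insertDot x c g) (insertDot x c h) ↔ BruhatLE g h := by
  simp only [bruhatLE_iff_rk, rk_insertDot]
  refine ⟨fun H p q => ?_, fun H p q => Nat.add_le_add_left (H _ _) _⟩
  have := H (if p ≤ x.val then p else p + 1) (if q ≤ c.val then q else q + 1)
  have e1 : (if (if p ≤ x.val then p else p + 1) ≤ x.val then (if p ≤ x.val then p else p + 1)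
      else (if p ≤ x.val then p else p + 1) - 1) = p := by split_ifs <;> omega
  have e2 : (if (if q ≤ c.val then q else q + 1) ≤ c.val then (if q ≤ c.val then q else q + 1)
      else (if q ≤ c.val then q else q + 1) - 1) = q := by split_ifs <;> omega
  rw [e1, e2] at this
  omega

theorem bruhatLE_del_iff {n : ℕ} {u v : Perm (Fin (n + 1))} {p : Fin (n + 1)} (h : u p = v p) :
    BruhatLE (del u p) (del v p) ↔ BruhatLE u v := by
  rw [← bruhatLE_insertDot_iff p (v p), insertDot_del, ← h, insertDot_del]

theorem sum_val_lt {n : ℕ} (c : Fin n) : (∑ x : Fin n, if x < c then 1 else 0) = c.val := by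
  rw [← Finset.card_filter, Finset.filter_gt_eq_Iio, Fin.card_Iio]

/-- The inversions lost are the smaller values to the right of `p`: there are `u p` smaller values
in all, and `p` of them stand to the left. -/
theorem length_del_of_forall_lt {n : ℕ} (u : Perm (Fin (n + 1))) (p : Fin (n + 1))
    (h : ∀ k < p, u k < u p) : length u + p.val = length (del u p) + (u p).val := by
  have h1 : (length u : ℤ) = (∑ l, if p < l ∧ u l < u p then 1 else 0) + length (del u p) := by
    rw [length_eq_sum, length_eq_sum, Fin.sum_univ_succAbove _ p]
    congr 1
    refine Finset.sum_congr rfl fun k _ => ?_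
    rw [Fin.sum_univ_succAbove _ p, if_neg, zero_add]
    · refine Finset.sum_congr rfl fun l _ => ?_
      simp only [del_lt_del_iff, (Fin.strictMono_succAbove _).lt_iff_lt]
    · rintro ⟨h1, h2⟩
      exact (h _ h1).not_gt h2
  have h2 : (∑ l, if p < l ∧ u l < u p then (1 : ℤ) else 0) + p.val = (u p).val := by
    rw [← sum_val_lt p, ← sum_val_lt (u p), ← Equiv.sum_comp u (fun x => if x < u p then 1 else 0)]
    push_cast
    rw [← Finset.sum_add_distrib]
    refine Finset.sum_congr rfl fun l _ => ?_
    rcases lt_trichotomy l p with hl | rfl | hl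
    · simp [hl, hl.not_gt, h l hl]
    · simp
    · simp [hl, hl.not_gt]
  zify
  linarith

open Classical in
/-- The value at `q` of the reversed Poincaré polynomial, scaled by `q ^ C(n, 2)`. -/
noncomputable def lowerSum (q : ℕ) {n : ℕ} (v : Perm (Fin n)) : ℕ :=
  ∑ u ∈ Finset.univ.filter (fun u : Perm (Fin n) => BruhatLE u v),
    q ^ (n.choose 2 + length v - length u)

/-- A descent `(b, a)` of `v` at position `i` such that `b` is a left-to-right maximum and no
value strictly between `a` and `b` occurs later. -/
structure LightDescent {n : ℕ} (v : Perm (Fin (n + 1))) (i : Fin n) : Prop where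
  desc : v i.succ < v i.castSucc
  max : ∀ k < i.castSucc, v k < v i.castSucc
  gap : ∀ k, i.succ < k → v i.succ < v k → v i.castSucc < v k

/-- Exchange of the entries in positions `i` and `i + 1`. -/
def adjSwap {n : ℕ} (i : Fin n) : Perm (Fin (n + 1)) := swap i.castSucc i.succ

@[simp]
theorem adjSwap_castSucc {n : ℕ} (i : Fin n) : adjSwap i i.castSucc = i.succ := swap_apply_left _ _

@[simp]
theorem adjSwap_succ {n : ℕ} (i : Fin n) : adjSwap i i.succ = i.castSucc := swap_apply_right _ _

theorem adjSwap_of_ne {n : ℕ} {i : Fin n} {k : Fin (n + 1)} (h₁ : k ≠ i.castSucc)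
    (h₂ : k ≠ i.succ) : adjSwap i k = k := swap_apply_of_ne_of_ne h₁ h₂

@[simp]
theorem adjSwap_mul_self {n : ℕ} (i : Fin n) : adjSwap i * adjSwap i = 1 := swap_mul_self _ _

theorem rk_eq_of_desc {n : ℕ} {v : Perm (Fin (n + 1))} {i : Fin n}
    (hd : v i.succ < v i.castSucc) (p q : ℕ) :
    rk v p q = rk (v * adjSwap i) p q +
      if p = i.val + 1 ∧ (v i.succ).val < q ∧ q ≤ (v i.castSucc).val then 1 else 0 := by
  have := rk_mul_swap (v * adjSwap i) (i := i.castSucc) (j := i.succ)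
    (Fin.castSucc_lt_succ) (by simpa using hd) p q
  rw [← adjSwap, mul_assoc, adjSwap_mul_self, mul_one] at this
  rw [this]
  congr 1
  refine if_congr ?_ rfl rfl
  simp only [Perm.mul_apply, adjSwap_castSucc, adjSwap_succ, Fin.val_castSucc, Fin.val_succ]
  omega

theorem length_mul_adjSwap {n : ℕ} {v : Perm (Fin (n + 1))} {i : Fin n}
    (hd : v i.succ < v i.castSucc) : length v = length (v * adjSwap i) + 1 := by
  have := length_mul_swap (v * adjSwap i) (i := i.castSucc) (j := i.succ)
    (Fin.castSucc_lt_succ) (by simpa using hd)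
  rw [← adjSwap, mul_assoc, adjSwap_mul_self, mul_one, Finset.filter_eq_empty_iff.2] at this
  · simpa using this
  · rintro k - ⟨h1, h2, -⟩
    rw [Fin.lt_def] at h1 h2
    simp only [Fin.val_castSucc, Fin.val_succ] at h1 h2
    omega

theorem bruhatLE_mul_adjSwap {n : ℕ} {v : Perm (Fin (n + 1))} {i : Fin n}
    (hd : v i.succ < v i.castSucc) : BruhatLE (v * adjSwap i) v :=
  bruhatLE_mul_swap v Fin.castSucc_lt_succ hd

theorem rk_eq_zero_iff {n : ℕ} {u : Perm (Fin n)} {p q : ℕ} :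
    rk u p q = 0 ↔ ∀ k : Fin n, k.val < p → (u k).val < q := by
  simp only [rk, Finset.sum_eq_zero_iff, Finset.mem_univ, true_implies, ite_eq_right_iff,
    one_ne_zero, imp_false, not_and, not_le]

theorem BruhatLE.forall_lt {n : ℕ} {u v : Perm (Fin n)} (h : BruhatLE u v) {p q : ℕ}
    (hv : ∀ k : Fin n, k.val < p → (v k).val < q) (k : Fin n) (hk : k.val < p) :
    (u k).val < q :=
  rk_eq_zero_iff.1 (Nat.le_zero.1 ((h.rk_le p q).trans (rk_eq_zero_iff.2 hv).le)) k hk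

theorem LightDescent.forall_lt_of_le {n : ℕ} {u v : Perm (Fin (n + 1))} {i : Fin n}
    (hv : LightDescent v i) (h : BruhatLE u v) (k : Fin (n + 1)) (hk : k < i.castSucc) :
    u k < v i.castSucc :=
  Fin.lt_def.2 (h.forall_lt (p := i.val) (fun k hk => hv.max k hk) k hk)

/-- Passing from `v` to `v * adjSwap i` lowers the rank by one only in row index `i + 1` and columns
`q` with `a < q ≤ b`, for the descent `(b, a)`. There `v` has all `b - q + 1` values of `[q, b]`
among its first entries. If `u` does not have `b` at position `i`, its first entries are all below
`b`, so its rank is at most `b - q`. -/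
theorem LightDescent.le_iff {n : ℕ} {u v : Perm (Fin (n + 1))} {i : Fin n}
    (hv : LightDescent v i) (h : BruhatLE u v) :
    BruhatLE u (v * adjSwap i) ↔ u i.castSucc ≠ v i.castSucc := by
  have hd := hv.desc
  constructor
  · intro hw hu
    have := hw.forall_lt (p := i.val + 1) (q := (v i.castSucc).val) (fun k hk => ?_) i.castSucc
      (by simp)
    · simp [hu] at this
    · rcases eq_or_ne k i.castSucc with rfl | hne
      · simpa using hd
      · have hlt : k < i.castSucc := lt_of_le_of_ne (Fin.le_def.2 (by simp; omega)) hne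
        rw [Perm.mul_apply, adjSwap_of_ne hne (hlt.trans Fin.castSucc_lt_succ).ne]
        exact hv.max k hlt
  · intro hne
    rw [bruhatLE_iff_rk]
    by_contra! hcon
    obtain ⟨p, q, hpq⟩ := hcon
    have h1 := h.rk_le p q
    rw [rk_eq_of_desc hd] at h1
    split_ifs at h1 with hc
    swap
    · omega
    obtain ⟨rfl, hq1, hq2⟩ := hc
    have hb : (u i.castSucc).val < (v i.castSucc).val := by
      have := h.forall_lt (p := i.val + 1) (q := (v i.castSucc).val + 1) (fun k hk => by
        rcases eq_or_ne k i.castSucc with rfl | hne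
        · simp
        · have := Fin.lt_def.1 (hv.max k (lt_of_le_of_ne (Fin.le_def.2 (by simp; omega)) hne))
          omega) i.castSucc (by simp)
      have h2 : (u i.castSucc).val ≠ (v i.castSucc).val := fun h => hne (Fin.ext h)
      omega
    have e1 : rk u (i.val + 1) q ≤
        ∑ k, if q ≤ (u k).val ∧ (u k).val < (v i.castSucc).val then 1 else 0 := by
      refine Finset.sum_le_sum fun k _ => ?_
      split_ifs with h1 h2 <;> try omega
      refine absurd ⟨h1.2, ?_⟩ h2
      rcases eq_or_ne k i.castSucc with rfl | hne
      · exact hb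
      · exact hv.forall_lt_of_le h k (lt_of_le_of_ne (Fin.le_def.2 (by simp; omega)) hne)
    have e2 : (∑ k, if q ≤ (v k).val ∧ (v k).val < (v i.castSucc).val + 1 then 1 else 0) ≤
        rk v (i.val + 1) q := by
      refine Finset.sum_le_sum fun k _ => ?_
      split_ifs with h1 h2 <;> try omega
      refine absurd ⟨?_, h1.1⟩ h2
      by_contra hk
      rcases eq_or_ne k i.succ with rfl | hne
      · omega
      · have h3 : i.succ < k := by
          refine lt_of_le_of_ne (Fin.le_def.2 ?_) hne.symm
          simp only [Fin.val_succ]; omega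
        have := Fin.lt_def.1 (hv.gap k h3 (Fin.lt_def.2 (by omega)))
        omega
    have e3 : (∑ k, if q ≤ (u k).val ∧ (u k).val < (v i.castSucc).val then 1 else 0) <
        ∑ k, if q ≤ (v k).val ∧ (v k).val < (v i.castSucc).val + 1 then 1 else 0 := by
      rw [Equiv.sum_comp u (fun x => if q ≤ x.val ∧ x.val < (v i.castSucc).val then 1 else 0),
        Equiv.sum_comp v (fun x => if q ≤ x.val ∧ x.val < (v i.castSucc).val + 1 then 1 else 0)]
      refine Finset.sum_lt_sum (fun k _ => ?_) ⟨v i.castSucc, Finset.mem_univ _, ?_⟩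
      · split_ifs <;> omega
      · rw [if_neg (by omega), if_pos (by omega)]; exact one_pos
    rw [rk_eq_of_desc hd, if_pos ⟨rfl, hq1, hq2⟩] at e2
    omega

-- Deleting the common dot is a bijection onto the lower interval of `del v p`. Entries before `p`
-- are smaller in both permutations, so both lose the same number of inversions; `q ^ n` accounts
-- for the change of binomial coefficient.
open Classical in
theorem sum_filter_apply_eq (q : ℕ) {n : ℕ} {v : Perm (Fin (n + 1))} {p : Fin (n + 1)}
    (hv : ∀ u, BruhatLE u v → ∀ k < p, u k < v p) :
    (∑ u ∈ Finset.univ.filter (fun u : Perm (Fin (n + 1)) => BruhatLE u v ∧ u p = v p),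
      q ^ ((n + 1).choose 2 + length v - length u)) = q ^ n * lowerSum q (del v p) := by
  rw [lowerSum, Finset.mul_sum]
  refine Finset.sum_bij' (fun u _ => del u p) (fun g _ => insertDot p (v p) g) ?_ ?_ ?_ ?_ ?_
  · intro u hu
    simp only [Finset.mem_filter, Finset.mem_univ, true_and] at hu ⊢
    exact (bruhatLE_del_iff hu.2).2 hu.1
  · intro g hg
    simp only [Finset.mem_filter, Finset.mem_univ, true_and, insertDot_self, and_true] at hg ⊢
    rw [← bruhatLE_del_iff (p := p) (by simp), del_insertDot]
    exact hg
  · intro u hu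
    simp only [Finset.mem_filter, Finset.mem_univ, true_and] at hu
    rw [← hu.2, insertDot_del]
  · intro g _
    exact del_insertDot _ _ _
  · intro u hu
    simp only [Finset.mem_filter, Finset.mem_univ, true_and] at hu
    rw [← pow_add]
    congr 1
    have h1 := length_del_of_forall_lt u p (fun k hk => by rw [hu.2]; exact hv u hu.1 k hk)
    have h2 := length_del_of_forall_lt v p (hv v Relation.ReflTransGen.refl)
    have h3 := ((bruhatLE_del_iff hu.2).2 hu.1).length_le
    have h4 : (n + 1).choose 2 = n + n.choose 2 := by
      rw [Nat.choose_succ_succ' n 1, Nat.choose_one_right]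
    have h5 : (u p).val = (v p).val := congrArg _ hu.2
    omega

/-- The elements below `v` split by whether they agree with `v` at position `i`: those that do not
form the lower interval of `v * adjSwap i`, the others that of the deletion. -/
theorem LightDescent.lowerSum_eq (q : ℕ) {n : ℕ} {v : Perm (Fin (n + 1))} {i : Fin n}
    (hv : LightDescent v i) :
    lowerSum q v = q * lowerSum q (v * adjSwap i) + q ^ n * lowerSum q (del v i.castSucc) := by
  classical
  rw [← sum_filter_apply_eq q fun u hu => hv.forall_lt_of_le hu, lowerSum,
    ← Finset.sum_filter_add_sum_filter_not _ (fun u => u i.castSucc ≠ v i.castSucc),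
    Finset.filter_filter, Finset.filter_filter]
  congr 1
  · rw [lowerSum, Finset.mul_sum]
    refine Finset.sum_congr (Finset.filter_congr fun u _ => ⟨fun h => ?_, fun h => ?_⟩) fun u hu => ?_
    · exact (hv.le_iff h.1).2 h.2
    · have := h.trans (bruhatLE_mul_adjSwap hv.desc)
      exact ⟨this, (hv.le_iff this).1 h⟩
    · simp only [Finset.mem_filter, Finset.mem_univ, true_and] at hu
      rw [← pow_succ', length_mul_adjSwap hv.desc]
      congr 1
      have := hu.length_le
      omega
  · simp only [not_not]

theorem lowerSum_of_apply_zero (q : ℕ) {n : ℕ} {v : Perm (Fin (n + 1))} (hv : v 0 = 0) :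
    lowerSum q v = q ^ n * lowerSum q (del v 0) := by
  classical
  rw [← sum_filter_apply_eq q fun u _ k hk => absurd hk (Fin.not_lt_zero k), lowerSum]
  refine Finset.sum_congr (Finset.filter_congr fun u _ => ⟨fun h => ⟨h, ?_⟩, fun h => h.1⟩)
    fun _ _ => rfl
  have := h.forall_lt (p := 1) (q := 1) (fun k hk => ?_) 0 (by simp)
  · rw [hv]; exact Fin.ext (by simpa using this)
  · have : k = 0 := Fin.ext (by simpa using hk)
    subst this
    simp [hv]

/-! ### Invariance under inversion and reverse complement -/

theorem length_inv {n : ℕ} (u : Perm (Fin n)) : length u⁻¹ = length u := by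
  zify
  rw [length_eq_sum, length_eq_sum, ← Equiv.sum_comp u, Finset.sum_comm,
    ← Equiv.sum_comp u]
  simp [and_comm]

/-- The reverse complement. -/
def revCompl {n : ℕ} (u : Perm (Fin n)) : Perm (Fin n) := Fin.revPerm * u * Fin.revPerm

@[simp]
theorem revCompl_apply {n : ℕ} (u : Perm (Fin n)) (k : Fin n) :
    revCompl u k = (u k.rev).rev := rfl

@[simp]
theorem revCompl_revCompl {n : ℕ} (u : Perm (Fin n)) : revCompl (revCompl u) = u :=
  Equiv.ext fun k => by simp

theorem length_revCompl {n : ℕ} (u : Perm (Fin n)) : length (revCompl u) = length u := by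
  zify
  rw [length_eq_sum, length_eq_sum, ← Equiv.sum_comp Fin.revPerm, Finset.sum_comm,
    ← Equiv.sum_comp Fin.revPerm]
  simp

theorem BruhatLE.inv {n : ℕ} {u v : Perm (Fin n)} (h : BruhatLE u v) : BruhatLE u⁻¹ v⁻¹ := by
  refine Relation.ReflTransGen.lift (fun x : Perm (Fin n) => x⁻¹) ?_ _ _ h
  rintro a b ⟨i, j, rfl, hl⟩
  refine ⟨a i, a j, ?_, by rwa [length_inv, length_inv]⟩
  change (a * swap i j)⁻¹ = a⁻¹ * swap (a i) (a j)
  rw [mul_inv_rev, swap_inv, mul_swap_eq_swap_mul]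
  simp

theorem BruhatLE.revCompl {n : ℕ} {u v : Perm (Fin n)} (h : BruhatLE u v) :
    BruhatLE (revCompl u) (revCompl v) := by
  refine Relation.ReflTransGen.lift BruhatMatrix.revCompl ?_ _ _ h
  rintro a b ⟨i, j, rfl, hl⟩
  refine ⟨i.rev, j.rev, ?_, by rwa [length_revCompl, length_revCompl]⟩
  have : swap i.rev j.rev = Fin.revPerm * swap i j * Fin.revPerm := by
    have := Equiv.mul_swap_eq_swap_mul Fin.revPerm i j
    rw [Fin.revPerm_apply, Fin.revPerm_apply] at this
    rw [this, mul_assoc]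
    exact Equiv.ext fun k => by simp
  rw [this]
  exact Equiv.ext fun k => by simp

theorem lowerSum_inv (q : ℕ) {n : ℕ} (v : Perm (Fin n)) : lowerSum q v⁻¹ = lowerSum q v := by
  classical
  rw [lowerSum, lowerSum]
  refine Finset.sum_bij' (fun u _ => u⁻¹) (fun u _ => u⁻¹) ?_ ?_ ?_ ?_ ?_
  · intro u hu
    simp only [Finset.mem_filter, Finset.mem_univ, true_and] at hu ⊢
    simpa using hu.inv
  · intro u hu
    simp only [Finset.mem_filter, Finset.mem_univ, true_and] at hu ⊢
    exact hu.inv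
  · simp
  · simp
  · simp [length_inv]

theorem lowerSum_revCompl (q : ℕ) {n : ℕ} (v : Perm (Fin n)) :
    lowerSum q (revCompl v) = lowerSum q v := by
  classical
  rw [lowerSum, lowerSum]
  refine Finset.sum_bij' (fun u _ => revCompl u) (fun u _ => revCompl u) ?_ ?_ ?_ ?_ ?_
  · intro u hu
    simp only [Finset.mem_filter, Finset.mem_univ, true_and] at hu ⊢
    simpa using hu.revCompl
  · intro u hu
    simp only [Finset.mem_filter, Finset.mem_univ, true_and] at hu ⊢
    exact hu.revCompl
  · simp
  · simp
  · simp [length_revCompl]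

end BruhatMatrix

/-! ### Invertible matrices with prescribed zeros: the pivot recursion -/

namespace BruhatMatrix

open Equiv Matrix

/-- Vectors vanishing on `S`. -/
def vecZero (F : Type) [Field F] {ι : Type*} (S : Set ι) : Submodule F (ι → F) :=
  Submodule.pi S fun _ => ⊥

theorem mem_vecZero {F : Type} [Field F] {ι : Type*} {S : Set ι} {f : ι → F} :
    f ∈ vecZero F S ↔ ∀ x ∈ S, f x = 0 := by
  simp [vecZero, Submodule.mem_pi]

theorem card_vecZero_mul {F : Type} [Field F] [Fintype F] {ι : Type*} [Fintype ι] (S : Set ι) :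
    Nat.card (vecZero F S) * Nat.card (vecZero F Sᶜ) = Fintype.card F ^ Fintype.card ι := by
  classical
  rw [← Nat.card_prod, ← Fintype.card_fun, ← Nat.card_eq_fintype_card]
  refine Nat.card_congr
    { toFun := fun p => p.1.1 + p.2.1
      invFun := fun f => (⟨fun x => if x ∈ S then 0 else f x, mem_vecZero.2 fun x hx => if_pos hx⟩,
        ⟨fun x => if x ∈ S then f x else 0, mem_vecZero.2 fun x hx => if_neg hx⟩)
      left_inv := ?_
      right_inv := ?_ }
  · rintro ⟨⟨f, hf⟩, ⟨g, hg⟩⟩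
    rw [mem_vecZero] at hf hg
    ext x <;> by_cases hx : x ∈ S <;> simp [hx, hf x, hg x]
  · intro f
    ext x; by_cases hx : x ∈ S <;> simp [hx]

section ZeroCount

variable {F : Type} [Field F] {ι κ : Type*} [Fintype ι] [DecidableEq ι] [Fintype κ] [DecidableEq κ]

variable (F) in
/-- The number of invertible matrices that vanish on `Z`. -/
noncomputable def zeroCount (Z : Set (ι × ι)) : ℕ :=
  {A : Matrix ι ι F | IsUnit A ∧ ∀ i j, (i, j) ∈ Z → A i j = 0}.ncard

theorem zeroCount_reindex (e f : κ ≃ ι) {Z : Set (ι × ι)} {Y : Set (κ × κ)}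
    (h : ∀ i j, (i, j) ∈ Y ↔ (e i, f j) ∈ Z) : zeroCount F Y = zeroCount F Z := by
  rw [zeroCount, zeroCount]
  symm
  refine Set.ncard_congr (fun A _ => A.submatrix e f) ?_ ?_ ?_
  · rintro A ⟨hA, hZ⟩
    exact ⟨(isUnit_submatrix_equiv e f).2 hA, fun i j hij => hZ _ _ ((h i j).1 hij)⟩
  · intro A B _ _ hAB
    ext i j
    simpa using congrFun (congrFun hAB (e.symm i)) (f.symm j)
  · rintro B ⟨hB, hY⟩
    refine ⟨B.submatrix e.symm f.symm, ⟨(isUnit_submatrix_equiv _ _).2 hB, fun i j hij => ?_⟩, ?_⟩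
    · exact hY _ _ ((h _ _).2 (by simpa using hij))
    · ext i j; simp

theorem zeroCount_transpose {Z Y : Set (ι × ι)} (h : ∀ i j, (i, j) ∈ Y ↔ (j, i) ∈ Z) :
    zeroCount F Y = zeroCount F Z := by
  rw [zeroCount, zeroCount]
  symm
  refine Set.ncard_congr (fun A _ => Aᵀ) ?_ ?_ ?_
  · rintro A ⟨hA, hZ⟩
    exact ⟨(isUnit_transpose A).2 hA, fun i j hij => hZ _ _ ((h i j).1 hij)⟩
  · intro A B _ _ hAB
    exact transpose_injective hAB
  · rintro B ⟨hB, hY⟩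
    exact ⟨Bᵀ, ⟨(isUnit_transpose B).2 hB, fun i j hij => hY _ _ ((h _ _).2 hij)⟩, rfl⟩

/-- The matrix `M` bordered by a first row `(d, a)` and a first column `(d, b)`. -/
def bordered (d : F) (a b : ι → F) (M : Matrix ι ι F) : Matrix (Unit ⊕ ι) (Unit ⊕ ι) F :=
  fromBlocks (of fun _ _ => d) (replicateRow Unit a) (replicateCol Unit b) M

theorem det_bordered (d : F) (a b : ι → F) (M : Matrix ι ι F) :
    (bordered d a b M).det = d * M.det + (bordered 0 a b M).det := by
  have h1 := det_updateRow_add (bordered 0 a b M) (Sum.inl ())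
    (Sum.elim (fun _ => d) (fun _ => 0)) (Sum.elim (fun _ => 0) a)
  have e1 : (bordered 0 a b M).updateRow (Sum.inl ()) (Sum.elim (fun _ => d) (fun _ => 0)) =
      fromBlocks (of fun (_ _ : Unit) => d) 0 (replicateCol Unit b) M := by
    ext i j; rcases i with i | i <;> rcases j with j | j <;> simp [updateRow_apply, bordered]
  have e2 : (bordered 0 a b M).updateRow (Sum.inl ()) (Sum.elim (fun _ => 0) a) =
      bordered 0 a b M := by
    ext i j; rcases i with i | i <;> rcases j with j | j <;> simp [updateRow_apply, bordered]
  have e3 : (bordered 0 a b M).updateRow (Sum.inl ())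
      (Sum.elim (fun _ => d) (fun _ => 0) + Sum.elim (fun _ => 0) a) = bordered d a b M := by
    ext i j; rcases i with i | i <;> rcases j with j | j <;> simp [updateRow_apply, bordered]
  rw [e1, e2, e3, det_fromBlocks_zero₁₂] at h1
  rw [h1]; simp

theorem det_bordered_zero_eq_zero_iff (a b : ι → F) {M : Matrix ι ι F} (hM : M.det ≠ 0) :
    (bordered 0 a b M).det = 0 ↔ (a ᵥ* M⁻¹) ⬝ᵥ b = 0 := by
  have hu : IsUnit M.det := isUnit_iff_ne_zero.2 hM
  let := M.invertibleOfIsUnitDet hu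
  rw [bordered, det_fromBlocks₂₂, mul_eq_zero, or_iff_right hM, invOf_eq_nonsing_inv,
    det_unique]
  have : (replicateRow Unit a * M⁻¹ * replicateCol Unit b) default default = (a ᵥ* M⁻¹) ⬝ᵥ b := by
    rw [← replicateRow_vecMul]; rfl
  rw [Matrix.sub_apply, this]
  simp

variable [Fintype F]

-- A nonzero functional vanishes on exactly one `q`-th of the space.
open Classical in
theorem sum_functional_eq_zero {V : Type*} [AddCommGroup V] [Module F V] [Fintype V]
    (φ : V →ₗ[F] F) (hφ : φ ≠ 0) :
    (∑ b : V, ((Fintype.card F : ℤ) * (if φ b = 0 then 1 else 0) - 1)) = 0 := by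
  have hs : Function.Surjective φ := LinearMap.surjective hφ
  have h1 := Submodule.card_eq_card_quotient_mul_card (LinearMap.ker φ)
  rw [Nat.card_congr (φ.quotKerEquivOfSurjective hs).toEquiv] at h1
  have h2 : (∑ b : V, if φ b = 0 then (1 : ℤ) else 0) = Nat.card (LinearMap.ker φ) := by
    rw [Finset.sum_boole, ← Fintype.card_subtype, Nat.card_eq_fintype_card]
    rfl
  rw [Finset.sum_sub_distrib, ← Finset.mul_sum, h2]
  simp only [Finset.sum_const, Finset.card_univ, mul_one, nsmul_eq_mul]
  rw [← Nat.card_eq_fintype_card (α := V), h1, Nat.card_eq_fintype_card (α := F)]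
  push_cast
  ring

-- For fixed `a`, the sum over `b` is zero unless the functional given by `a ᵥ* M⁻¹` vanishes
-- identically on vectors supported off `C`, that is, unless `a ᵥ* M⁻¹` is supported on `C`. Such
-- `a` are the vectors `g ᵥ* M` with `g` supported on `C`; the zero condition on `M` makes all of
-- these vanish on `R`.
open Classical in
theorem sum_bordered {R C : Set ι} {M : Matrix ι ι F} (hM : M.det ≠ 0)
    (h : ∀ x ∈ C, ∀ y ∈ R, M x y = 0) :
    (∑ a : vecZero F R, ∑ b : vecZero F C,
      ((Fintype.card F : ℤ) * (if (bordered 0 a.1 b.1 M).det = 0 then 1 else 0) - 1)) =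
      ((Fintype.card F : ℤ) - 1) * Fintype.card F ^ Fintype.card ι := by
  have hu : IsUnit M.det := isUnit_iff_ne_zero.2 hM
  have h1 : ∀ a : vecZero F R, (∑ b : vecZero F C,
      ((Fintype.card F : ℤ) * (if (bordered 0 a.1 b.1 M).det = 0 then 1 else 0) - 1)) =
      if (a.1 ᵥ* M⁻¹) ∈ vecZero F Cᶜ then ((Fintype.card F : ℤ) - 1) * Nat.card (vecZero F C)
        else 0 := by
    intro a
    simp only [det_bordered_zero_eq_zero_iff _ _ hM]
    split_ifs with hc
    · rw [mem_vecZero] at hc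
      have : ∀ b : vecZero F C, (a.1 ᵥ* M⁻¹) ⬝ᵥ b.1 = 0 := by
        intro b
        refine Finset.sum_eq_zero fun x _ => ?_
        by_cases hx : x ∈ C
        · rw [mem_vecZero.1 b.2 x hx, mul_zero]
        · rw [hc x hx, zero_mul]
      simp only [this, if_true, mul_one, Finset.sum_const, Finset.card_univ, nsmul_eq_mul,
        Nat.card_eq_fintype_card]
      ring
    · let φ : vecZero F C →ₗ[F] F :=
        { toFun := fun b => (a.1 ᵥ* M⁻¹) ⬝ᵥ b.1
          map_add' := fun b c => by simp [dotProduct_add]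
          map_smul' := fun c b => by simp [dotProduct_smul] }
      refine sum_functional_eq_zero φ fun hφ => hc ?_
      rw [mem_vecZero]
      intro x hx
      have := LinearMap.congr_fun hφ ⟨Pi.single x 1, mem_vecZero.2 fun y hy => by
        rw [Pi.single_eq_of_ne]; rintro rfl; exact hx hy⟩
      simpa [φ] using this
  rw [Finset.sum_congr rfl fun a _ => h1 a, ← Finset.sum_filter, Finset.sum_const, nsmul_eq_mul]
  have h2 : (Finset.univ.filter fun a : vecZero F R => (a.1 ᵥ* M⁻¹) ∈ vecZero F Cᶜ).card =
      Nat.card (vecZero F Cᶜ) := by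
    rw [Nat.card_eq_fintype_card, ← Finset.card_univ]
    refine Finset.card_bij' (fun a ha => ⟨a.1 ᵥ* M⁻¹, (Finset.mem_filter.1 ha).2⟩)
      (fun g _ => ⟨g.1 ᵥ* M, mem_vecZero.2 fun y hy => ?_⟩) ?_ ?_ ?_ ?_
    · refine Finset.sum_eq_zero fun x _ => ?_
      by_cases hx : x ∈ C
      · exact mul_eq_zero_of_right _ (h x hx y hy)
      · exact mul_eq_zero_of_left (mem_vecZero.1 g.2 x hx) _
    · simp
    · intro g _
      simp [vecMul_vecMul, mul_nonsing_inv _ hu]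
    · intro a _
      simp [vecMul_vecMul, nonsing_inv_mul _ hu]
    · intro g _
      simp [vecMul_vecMul, mul_nonsing_inv _ hu]
  rw [h2]
  have h3 := card_vecZero_mul (F := F) C
  zify at h3
  rw [← h3]
  ring

open Classical in
theorem zeroCount_eq_sum (Z : Set (ι × ι)) :
    (zeroCount F Z : ℤ) = ∑ A : {A : Matrix ι ι F // ∀ i j, (i, j) ∈ Z → A i j = 0},
      if A.1.det = 0 then 0 else 1 := by
  have : ∀ A : {A : Matrix ι ι F // ∀ i j, (i, j) ∈ Z → A i j = 0},
      (if A.1.det = 0 then (0 : ℤ) else 1) = if IsUnit A.1 then 1 else 0 := fun A => by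
    have : IsUnit A.1 ↔ ¬ A.1.det = 0 := by rw [isUnit_iff_isUnit_det, isUnit_iff_ne_zero]
    simp only [this]
    split_ifs <;> rfl
  simp_rw [this]
  rw [Finset.sum_boole, ← Fintype.card_subtype, ← Nat.card_eq_fintype_card, zeroCount,
    ← Nat.card_coe_set_eq]
  congr 1
  refine Nat.card_congr ⟨fun A => ⟨⟨A.1, A.2.2⟩, A.2.1⟩, fun A => ⟨A.1.1, A.2, A.1.2⟩,
    fun A => rfl, fun A => rfl⟩

open Classical in
theorem zeroCount_eq_sum_bordered {Z : Set ((Unit ⊕ ι) × (Unit ⊕ ι))}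
    (h0 : (Sum.inl (), Sum.inl ()) ∉ Z) :
    (zeroCount F Z : ℤ) =
      ∑ M : {M : Matrix ι ι F // ∀ i j,
        (i, j) ∈ {c : ι × ι | (Sum.inr c.1, Sum.inr c.2) ∈ Z} → M i j = 0},
      ∑ a : vecZero F {y | (Sum.inl (), Sum.inr y) ∈ Z},
      ∑ b : vecZero F {x | (Sum.inr x, Sum.inl ()) ∈ Z}, ∑ d : F,
        if (bordered d a.1 b.1 M.1).det = 0 then 0 else 1 := by
  rw [zeroCount_eq_sum]
  simp_rw [← Fintype.sum_prod_type']
  symm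
  refine Fintype.sum_equiv
    { toFun := fun p => ⟨bordered p.2.2.2 p.2.1.1 p.2.2.1.1 p.1.1, by
        rintro (i | i) (j | j) hij
        · exact absurd hij h0
        · exact mem_vecZero.1 p.2.1.2 j hij
        · exact mem_vecZero.1 p.2.2.1.2 i hij
        · exact p.1.2 i j hij⟩
      invFun := fun A => ⟨⟨A.1.toBlocks₂₂, fun x y hxy => A.2 _ _ hxy⟩,
        ⟨fun y => A.1 (Sum.inl ()) (Sum.inr y), mem_vecZero.2 fun y hy => A.2 _ _ hy⟩,
        ⟨fun x => A.1 (Sum.inr x) (Sum.inl ()), mem_vecZero.2 fun x hx => A.2 _ _ hx⟩,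
        A.1 (Sum.inl ()) (Sum.inl ())⟩
      left_inv := fun p => rfl
      right_inv := fun A => ?_ } _ _ fun p => rfl
  refine Subtype.ext (Matrix.ext ?_)
  rintro (i | i) (j | j) <;> rfl

open Classical in
theorem zeroCount_eq_sum_bordered_zero {Z Y : Set ((Unit ⊕ ι) × (Unit ⊕ ι))}
    (hY : ∀ c, c ∈ Y ↔ c = (Sum.inl (), Sum.inl ()) ∨ c ∈ Z) :
    (zeroCount F Y : ℤ) =
      ∑ M : {M : Matrix ι ι F // ∀ i j,
        (i, j) ∈ {c : ι × ι | (Sum.inr c.1, Sum.inr c.2) ∈ Z} → M i j = 0},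
      ∑ a : vecZero F {y | (Sum.inl (), Sum.inr y) ∈ Z},
      ∑ b : vecZero F {x | (Sum.inr x, Sum.inl ()) ∈ Z},
        if (bordered 0 a.1 b.1 M.1).det = 0 then 0 else 1 := by
  rw [zeroCount_eq_sum]
  simp_rw [← Fintype.sum_prod_type']
  have hmem : ∀ (M : Matrix ι ι F) (a b : ι → F),
      (∀ i j, (Sum.inr i, Sum.inr j) ∈ Z → M i j = 0) →
      (∀ y, (Sum.inl (), Sum.inr y) ∈ Z → a y = 0) →
      (∀ x, (Sum.inr x, Sum.inl ()) ∈ Z → b x = 0) →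
      ∀ i j, (i, j) ∈ Y → bordered 0 a b M i j = 0 := by
    rintro M a b hM ha hb (i | i) (j | j) hij
    · simp [bordered]
    · exact ha j (((hY _).1 hij).resolve_left (by simp))
    · exact hb i (((hY _).1 hij).resolve_left (by simp))
    · exact hM i j (((hY _).1 hij).resolve_left (by simp))
  symm
  refine Fintype.sum_bijective (fun p => ⟨bordered 0 p.2.1.1 p.2.2.1 p.1.1,
    hmem _ _ _ p.1.2 (mem_vecZero.1 p.2.1.2) (mem_vecZero.1 p.2.2.2)⟩) ⟨?_, ?_⟩ _ _ fun _ => rfl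
  · rintro ⟨⟨M, hM⟩, ⟨a, ha⟩, ⟨b, hb⟩⟩ ⟨⟨M', hM'⟩, ⟨a', ha'⟩, ⟨b', hb'⟩⟩ h
    have h := congrArg Subtype.val h
    obtain rfl : M = M' := Matrix.ext fun i j => congrFun (congrFun h (Sum.inr i)) (Sum.inr j)
    obtain rfl : a = a' := funext fun j => congrFun (congrFun h (Sum.inl ())) (Sum.inr j)
    obtain rfl : b = b' := funext fun i => congrFun (congrFun h (Sum.inr i)) (Sum.inl ())
    rfl
  · rintro ⟨A, hA⟩
    have hA' : ∀ i j, (i, j) ∈ Z → A i j = 0 := fun i j h => hA i j ((hY _).2 (Or.inr h))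
    refine ⟨⟨⟨A.toBlocks₂₂, fun x y h => hA' _ _ h⟩,
      ⟨fun y => A (Sum.inl ()) (Sum.inr y), mem_vecZero.2 fun y h => hA' _ _ h⟩,
      ⟨fun x => A (Sum.inr x) (Sum.inl ()), mem_vecZero.2 fun x h => hA' _ _ h⟩⟩,
      Subtype.ext (Matrix.ext ?_)⟩
    rintro (i | i) (j | j)
    · exact (hA (Sum.inl ()) (Sum.inl ()) ((hY _).2 (Or.inl rfl))).symm
    all_goals rfl

/-- For a fixed minor `M` and borders, the determinant is affine in the corner entry with slope
`M.det`. If the slope is zero, all `q` corner values behave like zero. Otherwise exactly one value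
is singular, and the excess over `q` times the zero-corner count is summed over the borders by
`sum_bordered`. -/
theorem zeroCount_corner {Z : Set ((Unit ⊕ ι) × (Unit ⊕ ι))} (h0 : (Sum.inl (), Sum.inl ()) ∉ Z)
    (h : ∀ x y, (Sum.inr x, Sum.inl ()) ∈ Z → (Sum.inl (), Sum.inr y) ∈ Z →
      (Sum.inr x, Sum.inr y) ∈ Z) :
    (zeroCount F Z : ℤ) = Fintype.card F * zeroCount F (insert (Sum.inl (), Sum.inl ()) Z) +
      ((Fintype.card F : ℤ) - 1) * Fintype.card F ^ Fintype.card ι *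
        zeroCount F {c : ι × ι | (Sum.inr c.1, Sum.inr c.2) ∈ Z} := by
  classical
  set R : Set ι := {y | (Sum.inl (), Sum.inr y) ∈ Z} with hR
  set C : Set ι := {x | (Sum.inr x, Sum.inl ()) ∈ Z} with hC
  set Z' : Set (ι × ι) := {c : ι × ι | (Sum.inr c.1, Sum.inr c.2) ∈ Z} with hZ'
  rw [zeroCount_eq_sum_bordered h0, zeroCount_eq_sum_bordered_zero (fun c => Set.mem_insert_iff),
    zeroCount_eq_sum Z', Finset.mul_sum, Finset.mul_sum, ← Finset.sum_add_distrib]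
  refine Finset.sum_congr rfl fun M _ => ?_
  by_cases hM : M.1.det = 0
  · rw [if_pos hM, mul_zero, add_zero, Finset.mul_sum]
    refine Finset.sum_congr rfl fun a _ => ?_
    rw [Finset.mul_sum]
    refine Finset.sum_congr rfl fun b _ => ?_
    have : ∀ d, (bordered d a.1 b.1 M.1).det = (bordered 0 a.1 b.1 M.1).det := fun d => by
      rw [det_bordered, hM, mul_zero, zero_add]
    simp only [this, Finset.sum_const, Finset.card_univ, nsmul_eq_mul]
  · rw [if_neg hM, mul_one, ← sum_bordered (R := R) (C := C) hM
      (fun x hx y hy => M.2 x y (h x y hx hy)), Finset.mul_sum, ← Finset.sum_add_distrib]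
    refine Finset.sum_congr rfl fun a _ => ?_
    rw [Finset.mul_sum, ← Finset.sum_add_distrib]
    refine Finset.sum_congr rfl fun b _ => ?_
    have e3 : (∑ d : F, if (bordered d a.1 b.1 M.1).det = 0 then (0 : ℤ) else 1) =
        Fintype.card F - 1 := by
      have : ∀ d : F, (if (bordered d a.1 b.1 M.1).det = 0 then (0 : ℤ) else 1) =
          1 - if d = -(bordered 0 a.1 b.1 M.1).det / M.1.det then 1 else 0 := fun d => by
        rw [det_bordered, eq_div_iff hM, ← eq_neg_iff_add_eq_zero]
        split_ifs <;> simp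
      simp_rw [this]
      simp
    rw [e3]
    split_ifs <;> ring

end ZeroCount

/-- `Fin (n + 1)` split into `p` and the rest. -/
def splitAt {n : ℕ} (p : Fin (n + 1)) : Unit ⊕ Fin n ≃ Fin (n + 1) :=
  (Equiv.sumComm _ _).trans ((Equiv.optionEquivSumPUnit _).symm.trans (finSuccEquiv' p).symm)

@[simp]
theorem splitAt_inl {n : ℕ} (p : Fin (n + 1)) (x : Unit) : splitAt p (Sum.inl x) = p := by
  simp [splitAt]

@[simp]
theorem splitAt_inr {n : ℕ} (p : Fin (n + 1)) (k : Fin n) :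
    splitAt p (Sum.inr k) = p.succAbove k := by
  simp [splitAt]

theorem zeroCount_pivot {F : Type} [Field F] [Fintype F] {n : ℕ} {r c : Fin (n + 1)}
    {Z : Set (Fin (n + 1) × Fin (n + 1))} (h0 : (r, c) ∉ Z)
    (h : ∀ x y, (x, c) ∈ Z → (r, y) ∈ Z → (x, y) ∈ Z) :
    (zeroCount F Z : ℤ) = Fintype.card F * zeroCount F (insert (r, c) Z) +
      ((Fintype.card F : ℤ) - 1) * Fintype.card F ^ n *
        zeroCount F {p : Fin n × Fin n | (r.succAbove p.1, c.succAbove p.2) ∈ Z} := by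
  have key := zeroCount_corner (F := F) (ι := Fin n)
    (Z := {p | (splitAt r p.1, splitAt c p.2) ∈ Z}) (by simpa using h0)
    (fun x y h1 h2 => by
      simp only [Set.mem_ofPred_eq, splitAt_inl, splitAt_inr] at h1 h2 ⊢
      exact h _ _ h1 h2)
  rw [zeroCount_reindex (splitAt r) (splitAt c) (Z := Z) (fun i j => Iff.rfl),
    zeroCount_reindex (splitAt r) (splitAt c) (Z := insert (r, c) Z)] at key
  · simpa using key
  · intro i j
    have h1 : (i, j) = (Sum.inl (), Sum.inl ()) ↔ (splitAt r i, splitAt c j) = (r, c) := by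
      rw [Prod.mk.injEq, Prod.mk.injEq, ← (splitAt r).injective.eq_iff,
        ← (splitAt c).injective.eq_iff, splitAt_inl, splitAt_inl]
    simp [Set.mem_insert_iff, h1]

/-! ### Matrix counts for south-west diagrams -/

theorem mem_swDiagram {n : ℕ} {v : Perm (Fin n)} {x y : Fin n} :
    (x, y) ∈ swDiagram v ↔ v x < y ∧ x < v⁻¹ y := by
  constructor
  · rintro ⟨i, j, hij, hv, h⟩
    obtain ⟨rfl, rfl⟩ := Prod.mk.inj h
    simpa using ⟨hv, hij⟩
  · rintro ⟨h1, h2⟩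
    exact ⟨x, v⁻¹ y, h2, by simpa using h1, by simp⟩

theorem mem_swDiagram_apply {n : ℕ} {v : Perm (Fin n)} {x j : Fin n} :
    (x, v j) ∈ swDiagram v ↔ v x < v j ∧ x < j := by
  rw [mem_swDiagram]; simp

theorem matCount_eq_zeroCount (F : Type) [Field F] {n : ℕ} (v : Perm (Fin n)) :
    matCount F v = zeroCount F (swDiagram v) := rfl

/-- Relabelling columns by `v` turns the diagram into the noninversion relation on positions, and
`v` carries that relation to the one of `v⁻¹`. -/
theorem matCount_inv (F : Type) [Field F] {n : ℕ} (v : Perm (Fin n)) :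
    matCount F v⁻¹ = matCount F v := by
  have h1 : ∀ u : Perm (Fin n), matCount F u =
      zeroCount F {p : Fin n × Fin n | u p.1 < u p.2 ∧ p.1 < p.2} :=
    fun u => (zeroCount_reindex (Equiv.refl _) u fun i j => mem_swDiagram_apply.symm).symm
  rw [h1, h1]
  symm
  refine zeroCount_reindex v v fun i j => ?_
  simp [and_comm]

theorem matCount_revCompl (F : Type) [Field F] {n : ℕ} (v : Perm (Fin n)) :
    matCount F (revCompl v) = matCount F v := by
  rw [← matCount_inv F v, matCount_eq_zeroCount, matCount_eq_zeroCount]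
  have h1 : zeroCount F (swDiagram (revCompl v)) =
      zeroCount F {p : Fin n × Fin n | (p.2, p.1) ∈ swDiagram (revCompl v)} :=
    zeroCount_transpose fun i j => Iff.rfl
  rw [h1]
  refine zeroCount_reindex Fin.revPerm Fin.revPerm fun i j => ?_
  have h2 : (revCompl v)⁻¹ = revCompl v⁻¹ := by
    rw [revCompl, revCompl, _root_.mul_inv_rev, _root_.mul_inv_rev, mul_assoc]
    rfl
  rw [Set.mem_ofPred_eq, mem_swDiagram, mem_swDiagram, h2]
  simp only [revCompl_apply, Fin.revPerm_apply, inv_inv]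
  rw [and_comm, Fin.rev_lt_iff, Fin.lt_rev_iff]

theorem adjSwap_lt_adjSwap_iff {n : ℕ} {i : Fin n} {x p : Fin (n + 1)} :
    adjSwap i x < adjSwap i p ↔
      x < p ∧ ¬ (x = i.castSucc ∧ p = i.succ) ∨ x = i.succ ∧ p = i.castSucc := by
  rcases eq_or_ne x i.castSucc with rfl | h1 <;> rcases eq_or_ne p i.castSucc with rfl | h2
  · simp [Fin.ext_iff]
  · rcases eq_or_ne p i.succ with rfl | h3
    · simp [Fin.ext_iff, Fin.lt_def]
    · rw [adjSwap_castSucc, adjSwap_of_ne h2 h3]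
      simp only [Fin.ext_iff, Fin.lt_def, Fin.val_castSucc, Fin.val_succ, ne_eq] at *
      omega
  · rcases eq_or_ne x i.succ with rfl | h3
    · simp [Fin.ext_iff, Fin.lt_def]
    · rw [adjSwap_castSucc, adjSwap_of_ne h1 h3]
      simp only [Fin.ext_iff, Fin.lt_def, Fin.val_castSucc, Fin.val_succ, ne_eq] at *
      omega
  · rcases eq_or_ne x i.succ with rfl | h3 <;> rcases eq_or_ne p i.succ with rfl | h4
    · simp [Fin.ext_iff]
    · rw [adjSwap_succ, adjSwap_of_ne h2 h4]
      simp only [Fin.ext_iff, Fin.lt_def, Fin.val_castSucc, Fin.val_succ, ne_eq] at *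
      omega
    · rw [adjSwap_succ, adjSwap_of_ne h1 h3]
      simp only [Fin.ext_iff, Fin.lt_def, Fin.val_castSucc, Fin.val_succ, ne_eq] at *
      omega
    · rw [adjSwap_of_ne h1 h3, adjSwap_of_ne h2 h4]
      simp [h1, h2]

/-- The pivot cell is the free cell in row `i + 1` and in the column of the top of the descent; the
gap condition supplies the closure hypothesis of the pivot recursion. Adding the cell to the zeros
gives the diagram of `v * adjSwap i` with rows `i`, `i + 1` exchanged. -/
theorem LightDescent.matCount_eq (F : Type) [Field F] [Fintype F] {n : ℕ} {v : Perm (Fin (n + 1))}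
    {i : Fin n} (hv : LightDescent v i) :
    (matCount F v : ℤ) = Fintype.card F * matCount F (v * adjSwap i) +
      ((Fintype.card F : ℤ) - 1) * Fintype.card F ^ n * matCount F (del v i.castSucc) := by
  have hd := hv.desc
  have key := zeroCount_pivot (F := F) (Z := swDiagram v) (r := i.succ) (c := v i.castSucc)
    (fun h => by
      rw [mem_swDiagram_apply] at h
      exact absurd h.2 Fin.castSucc_lt_succ.not_gt)
    (fun x y hx hy => by
      obtain ⟨j, rfl⟩ := v.surjective y
      rw [mem_swDiagram_apply] at hx hy ⊢
      exact ⟨hx.1.trans (hv.gap j hy.2 hy.1), (hx.2.trans Fin.castSucc_lt_succ).trans hy.2⟩)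
  rw [matCount_eq_zeroCount, key, matCount_eq_zeroCount, matCount_eq_zeroCount]
  have h1 : zeroCount F (insert (i.succ, v i.castSucc) (swDiagram v)) =
      zeroCount F (swDiagram (v * adjSwap i)) := by
    refine zeroCount_reindex (adjSwap i) (Equiv.refl _) fun x y => ?_
    obtain ⟨j, rfl⟩ := v.surjective y
    have e1 : v j = (v * adjSwap i) (adjSwap i j) := by
      rw [← Perm.mul_apply, mul_assoc, adjSwap_mul_self, mul_one]
    rw [Equiv.refl_apply, Set.mem_insert_iff, mem_swDiagram_apply, e1, mem_swDiagram_apply, ← e1]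
    have e2 : (v * adjSwap i) (adjSwap i x) = v x := by
      rw [← Perm.mul_apply, mul_assoc, adjSwap_mul_self, mul_one]
    rw [e2, adjSwap_lt_adjSwap_iff, Prod.mk.injEq, v.injective.eq_iff]
    constructor
    · rintro (⟨rfl, rfl⟩ | ⟨h1, h2⟩)
      · exact ⟨hd, Or.inr ⟨rfl, rfl⟩⟩
      · refine ⟨h1, Or.inl ⟨h2, ?_⟩⟩
        rintro ⟨rfl, rfl⟩
        exact absurd h1 hd.not_gt
    · rintro ⟨h1, ⟨h2, -⟩ | h2⟩
      · exact Or.inr ⟨h1, h2⟩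
      · exact Or.inl h2
  -- The pivot removes row `i + 1` whereas `del` removes row `i`. This makes no difference, since by
  -- the gap condition these rows have the same zeros outside the pivot column.
  have h2 : zeroCount F {p : Fin n × Fin n |
      (i.succ.succAbove p.1, (v i.castSucc).succAbove p.2) ∈ swDiagram v} =
      zeroCount F (swDiagram (del v i.castSucc)) := by
    refine zeroCount_reindex (Equiv.refl _) (Equiv.refl _) fun k l => ?_
    obtain ⟨m, rfl⟩ := (del v i.castSucc).surjective l
    rw [Equiv.refl_apply, Equiv.refl_apply, mem_swDiagram_apply, del_lt_del_iff, Set.mem_ofPred_eq,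
      succAbove_del, mem_swDiagram_apply]
    rcases eq_or_ne k i with rfl | hk
    · have e1 : k.castSucc.succAbove k = k.succ := by simp
      have e2 : k.succ.succAbove k = k.castSucc := by simp
      rw [e1, e2]
      have hm : k < m ↔ k.succ < k.castSucc.succAbove m := by
        rw [Fin.lt_def, Fin.lt_def, val_succAbove]
        simp only [Fin.val_castSucc, Fin.val_succ]
        split_ifs <;> omega
      rw [hm]
      constructor
      · rintro ⟨h1, h2⟩
        refine ⟨hd.trans h1, lt_of_le_of_ne ?_ ?_⟩
        · rw [Fin.lt_def, Fin.val_castSucc] at h2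
          rw [Fin.le_def, Fin.val_succ]
          omega
        · intro h3
          rw [← h3] at h1
          exact absurd h1 hd.not_gt
      · rintro ⟨h1, h2⟩
        exact ⟨hv.gap _ h2 h1, Fin.castSucc_lt_succ.trans h2⟩
    · have e1 : i.succ.succAbove k = i.castSucc.succAbove k := by
        ext
        rw [val_succAbove, val_succAbove, Fin.val_succ, Fin.val_castSucc]
        have : k.val ≠ i.val := fun h => hk (Fin.ext h)
        split_ifs <;> omega
      rw [e1, (Fin.strictMono_succAbove _).lt_iff_lt]
  rw [h1, h2]

/-- The first row is zero off the corner, so forcing the corner to vanish leaves no invertible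
matrix and only the minor term survives. -/
theorem matCount_of_apply_zero (F : Type) [Field F] [Fintype F] {n : ℕ} {v : Perm (Fin (n + 1))}
    (hv : v 0 = 0) : (matCount F v : ℤ) =
      ((Fintype.card F : ℤ) - 1) * Fintype.card F ^ n * matCount F (del v 0) := by
  have key := zeroCount_pivot (F := F) (Z := swDiagram v) (r := 0) (c := 0)
    (fun h => by simp [mem_swDiagram] at h)
    (fun x y hx hy => by simp [mem_swDiagram] at hx)
  have h0 : zeroCount F (insert (0, 0) (swDiagram v)) = 0 := by
    rw [zeroCount, Set.ncard_eq_zero]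
    refine Set.eq_empty_iff_forall_notMem.2 ?_
    rintro A ⟨hA, hz⟩
    rw [isUnit_iff_isUnit_det, isUnit_iff_ne_zero] at hA
    refine hA (det_eq_zero_of_row_eq_zero 0 fun j => hz 0 j ?_)
    rcases eq_or_ne j 0 with rfl | hj
    · exact Set.mem_insert _ _
    · refine Set.mem_insert_of_mem _ (mem_swDiagram.2 ⟨?_, ?_⟩)
      · rw [hv]; exact Fin.pos_iff_ne_zero.2 hj
      · refine Fin.pos_iff_ne_zero.2 fun h => hj ?_
        rw [Perm.inv_eq_iff_eq] at h
        rw [h, hv]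
  rw [matCount_eq_zeroCount, key, h0, matCount_eq_zeroCount]
  simp only [Nat.cast_zero, mul_zero, zero_add]
  congr 2
  refine zeroCount_reindex (Equiv.refl _) (Equiv.refl _) fun k l => ?_
  obtain ⟨m, rfl⟩ := (del v 0).surjective l
  have := succAbove_del v 0 m
  rw [hv] at this
  rw [Equiv.refl_apply, Equiv.refl_apply, mem_swDiagram_apply, del_lt_del_iff, Set.mem_ofPred_eq,
      this, mem_swDiagram_apply, (Fin.strictMono_succAbove _).lt_iff_lt]

end BruhatMatrix

/-! ### Pattern avoidance and its stability under light exchanges -/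

namespace BruhatMatrix

open Equiv

/-- Avoidance of 4231, 35142, 42513 and 351624, spelled out on positions. -/
structure Avoiding {n : ℕ} (v : Perm (Fin n)) : Prop where
  a4231 : ∀ p₁ p₂ p₃ p₄, p₁ < p₂ → p₂ < p₃ → p₃ < p₄ →
    v p₄ < v p₂ → v p₂ < v p₃ → v p₃ < v p₁ → False
  a35142 : ∀ p₁ p₂ p₃ p₄ p₅, p₁ < p₂ → p₂ < p₃ → p₃ < p₄ → p₄ < p₅ →
    v p₃ < v p₅ → v p₅ < v p₁ → v p₁ < v p₄ → v p₄ < v p₂ → False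
  a42513 : ∀ p₁ p₂ p₃ p₄ p₅, p₁ < p₂ → p₂ < p₃ → p₃ < p₄ → p₄ < p₅ →
    v p₄ < v p₂ → v p₂ < v p₅ → v p₅ < v p₁ → v p₁ < v p₃ → False
  a351624 : ∀ p₁ p₂ p₃ p₄ p₅ p₆, p₁ < p₂ → p₂ < p₃ → p₃ < p₄ → p₄ < p₅ → p₅ < p₆ →
    v p₃ < v p₅ → v p₅ < v p₁ → v p₁ < v p₆ → v p₆ < v p₂ → v p₂ < v p₄ → False

theorem containsPattern_of_lt {n k : ℕ} {w : Perm (Fin n)} {p : Fin k → ℕ} (f : Fin k → Fin n)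
    (hf : StrictMono f) (hp : ∀ a b, p a < p b → w (f a) < w (f b))
    (hpi : Function.Injective p) : ContainsPattern w p := by
  refine ⟨f, hf, fun a b => ⟨fun h => ?_, hp a b⟩⟩
  rcases lt_trichotomy (p a) (p b) with h1 | h1 | h1
  · exact h1
  · rw [hpi h1] at h
    exact absurd h (lt_irrefl _)
  · exact absurd h (hp b a h1).not_gt

theorem avoiding_iff {n : ℕ} {v : Perm (Fin n)} : Avoiding v ↔ IsGasharovReiner v := by
  constructor
  · intro h
    refine ⟨?_, ?_, ?_, ?_⟩
    · rintro ⟨f, hf, hp⟩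
      refine h.a4231 (f 0) (f 1) (f 2) (f 3) (hf (by decide)) (hf (by decide)) (hf (by decide))
        ?_ ?_ ?_ <;> rw [hp] <;> decide
    · rintro ⟨f, hf, hp⟩
      refine h.a35142 (f 0) (f 1) (f 2) (f 3) (f 4) (hf (by decide)) (hf (by decide))
        (hf (by decide)) (hf (by decide)) ?_ ?_ ?_ ?_ <;> rw [hp] <;> decide
    · rintro ⟨f, hf, hp⟩
      refine h.a42513 (f 0) (f 1) (f 2) (f 3) (f 4) (hf (by decide)) (hf (by decide))
        (hf (by decide)) (hf (by decide)) ?_ ?_ ?_ ?_ <;> rw [hp] <;> decide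
    · rintro ⟨f, hf, hp⟩
      refine h.a351624 (f 0) (f 1) (f 2) (f 3) (f 4) (f 5) (hf (by decide)) (hf (by decide))
        (hf (by decide)) (hf (by decide)) (hf (by decide)) ?_ ?_ ?_ ?_ ?_ <;> rw [hp] <;> decide
  · rintro ⟨h1, h2, h3, h4⟩
    refine ⟨?_, ?_, ?_, ?_⟩
    · intro p₁ p₂ p₃ p₄ hp1 hp2 hp3 hv1 hv2 hv3
      refine h1 (containsPattern_of_lt ![p₁, p₂, p₃, p₄] ?_ ?_ (by decide))
      · refine Fin.strictMono_iff_lt_succ.2 fun i => ?_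
        fin_cases i <;> simpa
      · intro a b
        fin_cases a <;> fin_cases b <;> simp <;> order
    · intro p₁ p₂ p₃ p₄ p₅ hp1 hp2 hp3 hp4 hv1 hv2 hv3 hv4
      refine h2 (containsPattern_of_lt ![p₁, p₂, p₃, p₄, p₅] ?_ ?_ (by decide))
      · refine Fin.strictMono_iff_lt_succ.2 fun i => ?_
        fin_cases i <;> simpa
      · intro a b
        fin_cases a <;> fin_cases b <;> simp <;> order
    · intro p₁ p₂ p₃ p₄ p₅ hp1 hp2 hp3 hp4 hv1 hv2 hv3 hv4
      refine h3 (containsPattern_of_lt ![p₁, p₂, p₃, p₄, p₅] ?_ ?_ (by decide))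
      · refine Fin.strictMono_iff_lt_succ.2 fun i => ?_
        fin_cases i <;> simpa
      · intro a b
        fin_cases a <;> fin_cases b <;> simp <;> order
    · intro p₁ p₂ p₃ p₄ p₅ p₆ hp1 hp2 hp3 hp4 hp5 hv1 hv2 hv3 hv4 hv5
      refine h4 (containsPattern_of_lt ![p₁, p₂, p₃, p₄, p₅, p₆] ?_ ?_ (by decide))
      · refine Fin.strictMono_iff_lt_succ.2 fun i => ?_
        fin_cases i <;> simpa
      · intro a b
        fin_cases a <;> fin_cases b <;> simp <;> order

theorem Avoiding.inv {n : ℕ} {v : Perm (Fin n)} (h : Avoiding v) : Avoiding v⁻¹ := by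
  have e : ∀ x y : Fin n, x < y → v (v⁻¹ x) < v (v⁻¹ y) := fun x y hxy => by simpa using hxy
  constructor
  · intro p₁ p₂ p₃ p₄ hp1 hp2 hp3 hv1 hv2 hv3
    exact h.a4231 _ _ _ _ hv1 hv2 hv3 (e _ _ hp1) (e _ _ hp2) (e _ _ hp3)
  · intro p₁ p₂ p₃ p₄ p₅ hp1 hp2 hp3 hp4 hv1 hv2 hv3 hv4
    exact h.a35142 _ _ _ _ _ hv1 hv2 hv3 hv4 (e _ _ hp1) (e _ _ hp2) (e _ _ hp3) (e _ _ hp4)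
  · intro p₁ p₂ p₃ p₄ p₅ hp1 hp2 hp3 hp4 hv1 hv2 hv3 hv4
    exact h.a42513 _ _ _ _ _ hv1 hv2 hv3 hv4 (e _ _ hp1) (e _ _ hp2) (e _ _ hp3) (e _ _ hp4)
  · intro p₁ p₂ p₃ p₄ p₅ p₆ hp1 hp2 hp3 hp4 hp5 hv1 hv2 hv3 hv4 hv5
    exact h.a351624 _ _ _ _ _ _ hv1 hv2 hv3 hv4 hv5 (e _ _ hp1) (e _ _ hp2) (e _ _ hp3)
      (e _ _ hp4) (e _ _ hp5)

theorem Avoiding.revCompl {n : ℕ} {v : Perm (Fin n)} (h : Avoiding v) :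
    Avoiding (revCompl v) := by
  have e : ∀ x y : Fin n, x < y → y.rev < x.rev := fun x y => Fin.rev_lt_rev.2
  constructor <;> simp only [revCompl_apply, Fin.rev_lt_rev]
  · intro p₁ p₂ p₃ p₄ hp1 hp2 hp3 hv1 hv2 hv3
    exact h.a4231 _ _ _ _ (e _ _ hp3) (e _ _ hp2) (e _ _ hp1) hv3 hv2 hv1
  · intro p₁ p₂ p₃ p₄ p₅ hp1 hp2 hp3 hp4 hv1 hv2 hv3 hv4
    exact h.a42513 _ _ _ _ _ (e _ _ hp4) (e _ _ hp3) (e _ _ hp2) (e _ _ hp1) hv4 hv3 hv2 hv1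
  · intro p₁ p₂ p₃ p₄ p₅ hp1 hp2 hp3 hp4 hv1 hv2 hv3 hv4
    exact h.a35142 _ _ _ _ _ (e _ _ hp4) (e _ _ hp3) (e _ _ hp2) (e _ _ hp1) hv4 hv3 hv2 hv1
  · intro p₁ p₂ p₃ p₄ p₅ p₆ hp1 hp2 hp3 hp4 hp5 hv1 hv2 hv3 hv4 hv5
    exact h.a351624 _ _ _ _ _ _ (e _ _ hp5) (e _ _ hp4) (e _ _ hp3) (e _ _ hp2) (e _ _ hp1)
      hv5 hv4 hv3 hv2 hv1

theorem Avoiding.del {n : ℕ} {v : Perm (Fin (n + 1))} (h : Avoiding v) (p : Fin (n + 1)) :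
    Avoiding (del v p) := by
  have e : ∀ x y : Fin n, x < y → p.succAbove x < p.succAbove y :=
    fun x y hxy => Fin.strictMono_succAbove p hxy
  constructor <;> simp only [del_lt_del_iff]
  · intro p₁ p₂ p₃ p₄ hp1 hp2 hp3
    exact h.a4231 _ _ _ _ (e _ _ hp1) (e _ _ hp2) (e _ _ hp3)
  · intro p₁ p₂ p₃ p₄ p₅ hp1 hp2 hp3 hp4
    exact h.a35142 _ _ _ _ _ (e _ _ hp1) (e _ _ hp2) (e _ _ hp3) (e _ _ hp4)
  · intro p₁ p₂ p₃ p₄ p₅ hp1 hp2 hp3 hp4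
    exact h.a42513 _ _ _ _ _ (e _ _ hp1) (e _ _ hp2) (e _ _ hp3) (e _ _ hp4)
  · intro p₁ p₂ p₃ p₄ p₅ p₆ hp1 hp2 hp3 hp4 hp5
    exact h.a351624 _ _ _ _ _ _ (e _ _ hp1) (e _ _ hp2) (e _ _ hp3) (e _ _ hp4) (e _ _ hp5)

theorem adjSwap_lt_adjSwap_of_lt {n : ℕ} {i : Fin n} {x p : Fin (n + 1)} (h : x < p) :
    adjSwap i x < adjSwap i p ∨ x = i.castSucc ∧ p = i.succ := by
  rw [adjSwap_lt_adjSwap_iff]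
  tauto

theorem mul_adjSwap_apply {n : ℕ} (v : Perm (Fin (n + 1))) (i : Fin n) (x : Fin (n + 1)) :
    (v * adjSwap i) (adjSwap i x) = v x := by
  rw [← Perm.mul_apply, mul_assoc, adjSwap_mul_self, mul_one]

/-- A pattern occurrence transports through the exchange unless two consecutive entries of it sit at
`i` and `i + 1`. These would form an ascent whose top exceeds everything before and such that no
later value lies between; in each pattern every consecutive pair violates one of these conditions.
-/
theorem LightDescent.avoiding_mul {n : ℕ} {v : Perm (Fin (n + 1))} {i : Fin n}
    (hv : LightDescent v i) (h : Avoiding v) : Avoiding (v * adjSwap i) := by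
  have hs : ∀ {x p}, x < p → adjSwap i x < adjSwap i p ∨
      ((v * adjSwap i) x < (v * adjSwap i) p ∧ (∀ k < x, (v * adjSwap i) k < (v * adjSwap i) p) ∧
        ∀ k, p < k → (v * adjSwap i) x < (v * adjSwap i) k →
          (v * adjSwap i) p < (v * adjSwap i) k) := fun {x p} hxp => by
    refine (adjSwap_lt_adjSwap_of_lt hxp).imp id ?_
    rintro ⟨rfl, rfl⟩
    simp only [Perm.mul_apply, adjSwap_castSucc, adjSwap_succ]
    refine ⟨hv.desc, fun k hk => ?_, fun k hk => ?_⟩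
    · rw [adjSwap_of_ne hk.ne (hk.trans hxp).ne]
      exact hv.max k hk
    · rw [adjSwap_of_ne (hxp.trans hk).ne' hk.ne']
      exact hv.gap k hk
  have e : ∀ x, v (adjSwap i x) = (v * adjSwap i) x := fun x => rfl
  generalize v * adjSwap i = w at *
  constructor
  · intro p₁ p₂ p₃ p₄ hp1 hp2 hp3 hv1 hv2 hv3
    refine h.a4231 (adjSwap i p₁) (adjSwap i p₂) (adjSwap i p₃) (adjSwap i p₄)
      ((hs hp1).resolve_right ?_)
      ((hs hp2).resolve_right ?_)
      ((hs hp3).resolve_right ?_)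
      (by simpa only [e] using hv1) (by simpa only [e] using hv2)
      (by simpa only [e] using hv3)
    · rintro ⟨lt, -, -⟩; order
    · rintro ⟨-, m, -⟩; have := m p₁ (by order); order
    · rintro ⟨lt, -, -⟩; order
  · intro p₁ p₂ p₃ p₄ p₅ hp1 hp2 hp3 hp4 hv1 hv2 hv3 hv4
    refine h.a35142 (adjSwap i p₁) (adjSwap i p₂) (adjSwap i p₃) (adjSwap i p₄) (adjSwap i p₅)
      ((hs hp1).resolve_right ?_)
      ((hs hp2).resolve_right ?_)
      ((hs hp3).resolve_right ?_)
      ((hs hp4).resolve_right ?_)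
      (by simpa only [e] using hv1) (by simpa only [e] using hv2)
      (by simpa only [e] using hv3) (by simpa only [e] using hv4)
    · rintro ⟨-, -, g⟩; have := g p₄ (by order) (by order); order
    · rintro ⟨lt, -, -⟩; order
    · rintro ⟨-, m, -⟩; have := m p₂ (by order); order
    · rintro ⟨lt, -, -⟩; order
  · intro p₁ p₂ p₃ p₄ p₅ hp1 hp2 hp3 hp4 hv1 hv2 hv3 hv4
    refine h.a42513 (adjSwap i p₁) (adjSwap i p₂) (adjSwap i p₃) (adjSwap i p₄) (adjSwap i p₅)
      ((hs hp1).resolve_right ?_)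
      ((hs hp2).resolve_right ?_)
      ((hs hp3).resolve_right ?_)
      ((hs hp4).resolve_right ?_)
      (by simpa only [e] using hv1) (by simpa only [e] using hv2)
      (by simpa only [e] using hv3) (by simpa only [e] using hv4)
    · rintro ⟨lt, -, -⟩; order
    · rintro ⟨-, -, g⟩; have := g p₅ (by order) (by order); order
    · rintro ⟨lt, -, -⟩; order
    · rintro ⟨-, m, -⟩; have := m p₁ (by order); order
  · intro p₁ p₂ p₃ p₄ p₅ p₆ hp1 hp2 hp3 hp4 hp5 hv1 hv2 hv3 hv4 hv5
    refine h.a351624 (adjSwap i p₁) (adjSwap i p₂) (adjSwap i p₃) (adjSwap i p₄) (adjSwap i p₅)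
      (adjSwap i p₆)
      ((hs hp1).resolve_right ?_)
      ((hs hp2).resolve_right ?_)
      ((hs hp3).resolve_right ?_)
      ((hs hp4).resolve_right ?_)
      ((hs hp5).resolve_right ?_)
      (by simpa only [e] using hv1) (by simpa only [e] using hv2)
      (by simpa only [e] using hv3) (by simpa only [e] using hv4)
      (by simpa only [e] using hv5)
    · rintro ⟨-, -, g⟩; have := g p₆ (by order) (by order); order
    · rintro ⟨lt, -, -⟩; order
    · rintro ⟨-, -, g⟩; have := g p₅ (by order) (by order); order
    · rintro ⟨lt, -, -⟩; order
    · rintro ⟨-, m, -⟩; have := m p₂ (by order); order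

/-- Here the critical consecutive pair would be a descent with top larger than everything before and
no later value in between; again none of the patterns has such a pair. -/
theorem LightDescent.avoiding_of_mul {n : ℕ} {v : Perm (Fin (n + 1))} {i : Fin n}
    (hv : LightDescent v i) (h : Avoiding (v * adjSwap i)) : Avoiding v := by
  have hs : ∀ {x p}, x < p → adjSwap i x < adjSwap i p ∨
      (v p < v x ∧ (∀ k < x, v k < v x) ∧ ∀ k, p < k → v p < v k → v x < v k) :=
    fun {x p} hxp => by
      refine (adjSwap_lt_adjSwap_of_lt hxp).imp id ?_
      rintro ⟨rfl, rfl⟩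
      exact ⟨hv.desc, hv.max, hv.gap⟩
  have e := mul_adjSwap_apply v i
  constructor
  · intro p₁ p₂ p₃ p₄ hp1 hp2 hp3 hv1 hv2 hv3
    refine h.a4231 (adjSwap i p₁) (adjSwap i p₂) (adjSwap i p₃) (adjSwap i p₄)
      ((hs hp1).resolve_right ?_)
      ((hs hp2).resolve_right ?_)
      ((hs hp3).resolve_right ?_)
      (by simpa only [e] using hv1) (by simpa only [e] using hv2)
      (by simpa only [e] using hv3)
    · rintro ⟨-, -, g⟩; have := g p₃ (by order) (by order); order
    · rintro ⟨lt, -, -⟩; order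
    · rintro ⟨-, m, -⟩; have := m p₁ (by order); order
  · intro p₁ p₂ p₃ p₄ p₅ hp1 hp2 hp3 hp4 hv1 hv2 hv3 hv4
    refine h.a35142 (adjSwap i p₁) (adjSwap i p₂) (adjSwap i p₃) (adjSwap i p₄) (adjSwap i p₅)
      ((hs hp1).resolve_right ?_)
      ((hs hp2).resolve_right ?_)
      ((hs hp3).resolve_right ?_)
      ((hs hp4).resolve_right ?_)
      (by simpa only [e] using hv1) (by simpa only [e] using hv2)
      (by simpa only [e] using hv3) (by simpa only [e] using hv4)
    · rintro ⟨lt, -, -⟩; order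
    · rintro ⟨-, -, g⟩; have := g p₄ (by order) (by order); order
    · rintro ⟨lt, -, -⟩; order
    · rintro ⟨-, m, -⟩; have := m p₂ (by order); order
  · intro p₁ p₂ p₃ p₄ p₅ hp1 hp2 hp3 hp4 hv1 hv2 hv3 hv4
    refine h.a42513 (adjSwap i p₁) (adjSwap i p₂) (adjSwap i p₃) (adjSwap i p₄) (adjSwap i p₅)
      ((hs hp1).resolve_right ?_)
      ((hs hp2).resolve_right ?_)
      ((hs hp3).resolve_right ?_)
      ((hs hp4).resolve_right ?_)
      (by simpa only [e] using hv1) (by simpa only [e] using hv2)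
      (by simpa only [e] using hv3) (by simpa only [e] using hv4)
    · rintro ⟨-, -, g⟩; have := g p₅ (by order) (by order); order
    · rintro ⟨lt, -, -⟩; order
    · rintro ⟨-, -, g⟩; have := g p₅ (by order) (by order); order
    · rintro ⟨lt, -, -⟩; order
  · intro p₁ p₂ p₃ p₄ p₅ p₆ hp1 hp2 hp3 hp4 hp5 hv1 hv2 hv3 hv4 hv5
    refine h.a351624 (adjSwap i p₁) (adjSwap i p₂) (adjSwap i p₃) (adjSwap i p₄) (adjSwap i p₅)
      (adjSwap i p₆)
      ((hs hp1).resolve_right ?_)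
      ((hs hp2).resolve_right ?_)
      ((hs hp3).resolve_right ?_)
      ((hs hp4).resolve_right ?_)
      ((hs hp5).resolve_right ?_)
      (by simpa only [e] using hv1) (by simpa only [e] using hv2)
      (by simpa only [e] using hv3) (by simpa only [e] using hv4)
      (by simpa only [e] using hv5)
    · rintro ⟨lt, -, -⟩; order
    · rintro ⟨-, -, g⟩; have := g p₅ (by order) (by order); order
    · rintro ⟨lt, -, -⟩; order
    · rintro ⟨-, -, g⟩; have := g p₆ (by order) (by order); order
    · rintro ⟨lt, -, -⟩; order

end BruhatMatrix

/-! ### The first descents of an avoiding permutation and of its inverse -/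

namespace BruhatMatrix

open Equiv

theorem perm_apply_inv {α : Type*} (v : Perm α) (x : α) : v (v⁻¹ x) = x := v.apply_symm_apply x

theorem perm_inv_apply {α : Type*} (v : Perm α) (x : α) : v⁻¹ (v x) = x := v.symm_apply_apply x

/-- `i` is the position of the first descent of `v`. -/
structure FirstDescent {n : ℕ} (v : Perm (Fin (n + 1))) (i : Fin n) : Prop where
  desc : v i.succ < v i.castSucc
  mono : ∀ x y, x < y → y ≤ i.castSucc → v x < v y

/-- The first descent of `v` ends at the least value, and no later value lies between the first
entry and the top of the descent. -/
structure HeavyDescent {n : ℕ} (v : Perm (Fin (n + 1))) (i : Fin n) : Prop extends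
    FirstDescent v i where
  bot : v i.succ = 0
  gap : ∀ k, i.succ < k → v 0 < v k → v i.castSucc < v k

theorem exists_firstDescent {n : ℕ} {v : Perm (Fin (n + 1))} (h : v 0 ≠ 0) :
    ∃ i, FirstDescent v i := by
  have hne : {i : Fin n | v i.succ < v i.castSucc}.Nonempty := by
    by_contra hcon
    rw [Set.not_nonempty_iff_eq_empty, Set.eq_empty_iff_forall_notMem] at hcon
    have hm : StrictMono v := Fin.strictMono_iff_lt_succ.2 fun i =>
      lt_of_le_of_ne (not_lt.1 (hcon i)) fun h => Fin.castSucc_lt_succ.ne (v.injective h)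
    have h1 := hm.monotone (Fin.zero_le (v⁻¹ 0))
    rw [perm_apply_inv] at h1
    exact h (le_antisymm h1 (Fin.zero_le _))
  obtain ⟨i, hi, hmin⟩ := WellFounded.has_min (wellFounded_lt (α := Fin n)) _ hne
  refine ⟨i, hi, fun x y => ?_⟩
  induction y using Fin.induction with
  | zero => exact fun hx => absurd hx (Fin.not_lt_zero x)
  | succ k ih =>
    intro hx hy
    have hk : k < i := by
      rw [Fin.le_def, Fin.val_succ, Fin.val_castSucc] at hy
      exact Fin.lt_def.2 (by omega)
    have h1 : v k.castSucc < v k.succ :=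
      lt_of_le_of_ne (not_lt.1 fun h => hmin k h hk) fun h => Fin.castSucc_lt_succ.ne (v.injective h)
    rcases (Fin.le_castSucc_iff.2 hx).lt_or_eq with h2 | rfl
    · exact (ih h2 (Fin.castSucc_lt_succ.le.trans hy)).trans h1
    · exact h1

theorem FirstDescent.light {n : ℕ} {v : Perm (Fin (n + 1))} {i : Fin n} (h : FirstDescent v i)
    (hg : ∀ k, i.succ < k → v i.succ < v k → v i.castSucc < v k) : LightDescent v i :=
  ⟨h.desc, fun k hk => h.mono k _ hk le_rfl, hg⟩

/-- Failure of the four alternatives supplies obstructing entries: `Y` to the right of the first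
descent, with value strictly between its ends, and `D` with value above `j + 1`, standing between
the values `j + 1` and `j`. When `v (i + 1) = 0` or `v 0 = j + 1`, failure of heaviness gives
sharper versions (`c2`, `c4`). Together with the first entry and the two descents they form one of
the patterns. -/
theorem Avoiding.light_or_heavy {n : ℕ} {v : Perm (Fin (n + 1))} (h : Avoiding v) (h0 : v 0 ≠ 0)
    {i j : Fin n} (hi : FirstDescent v i) (hj : FirstDescent v⁻¹ j) :
    LightDescent v i ∨ HeavyDescent v i ∨ LightDescent v⁻¹ j ∨ HeavyDescent v⁻¹ j := by
  by_contra! hcon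
  obtain ⟨n1, n2, n3, n4⟩ := hcon
  have c1 : ∃ Y, i.succ < Y ∧ v i.succ < v Y ∧ v Y < v i.castSucc := by
    by_contra! hc
    exact n1 (hi.light fun k h1 h2 => lt_of_le_of_ne (hc k h1 h2) fun h3 =>
      (Fin.castSucc_lt_succ.trans h1).ne (v.injective h3))
  have c2 : v i.succ = 0 → ∃ Y, i.succ < Y ∧ v 0 < v Y ∧ v Y < v i.castSucc := by
    intro hb
    by_contra! hc
    exact n2 ⟨hi, hb, fun k h1 h2 => lt_of_le_of_ne (hc k h1 h2) fun h3 =>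
      (Fin.castSucc_lt_succ.trans h1).ne (v.injective h3)⟩
  have c3 : ∃ D, j.succ < v D ∧ v⁻¹ j.succ < D ∧ D < v⁻¹ j.castSucc := by
    by_contra! hc
    refine n3 (hj.light fun k h1 h2 => lt_of_le_of_ne
      (by simpa using hc (v⁻¹ k) (by simpa) h2) fun h3 =>
        (Fin.castSucc_lt_succ.trans h1).ne (v⁻¹.injective h3))
  have c4 : v 0 = j.succ → ∃ D, j.succ < v D ∧ v⁻¹ 0 < D ∧ D < v⁻¹ j.castSucc := by
    intro hb
    by_contra! hc
    refine n4 ⟨hj, by rw [← hb, perm_inv_apply], fun k h1 h2 =>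
      lt_of_le_of_ne (by simpa using hc (v⁻¹ k) (by simpa) h2) fun h3 =>
      (Fin.castSucc_lt_succ.trans h1).ne (v⁻¹.injective h3)⟩
  have hpre : ∀ p ≤ i.castSucc, v 0 ≤ v p := fun p hp => by
    rcases eq_or_ne p 0 with rfl | hne
    · exact le_rfl
    · exact (hi.mono 0 p (Fin.pos_iff_ne_zero.2 hne) hp).le
  have hI : ∀ p, i.castSucc < p → i.succ ≤ p := fun p => Fin.castSucc_lt_iff_succ_le.1
  have hII : i.castSucc < i.succ := Fin.castSucc_lt_succ
  have hJ : ∀ p, p < j.succ → p ≤ j.castSucc := fun p => Fin.le_castSucc_iff.2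
  have hJJ : j.castSucc < j.succ := Fin.castSucc_lt_succ
  have hab := hi.desc
  have hzJ : v⁻¹ 0 ≤ v⁻¹ j.castSucc := by
    rcases eq_or_ne j.castSucc 0 with h1 | h1
    · rw [h1]
    · exact (hj.mono 0 _ (Fin.pos_iff_ne_zero.2 h1) le_rfl).le
  have hcJ : j.castSucc < v 0 := by
    by_contra hc
    have := hj.mono 0 (v 0) (Fin.pos_iff_ne_zero.2 h0) (not_lt.1 hc)
    rw [perm_inv_apply] at this
    exact absurd this (Fin.not_lt_zero _)
  have hsm : ∀ p, v p < v 0 → i.succ ≤ p := fun p hp => hI p (not_le.1 fun hc =>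
    (hpre p hc).not_gt hp)
  have hsJ := hj.desc
  -- `pZ`, `pJ`, `pS` are the positions of the values `0`, `j`, `j + 1`; from here on everything is
  -- phrased in positions.
  obtain ⟨pZ, hpZ⟩ : ∃ p, p = v⁻¹ 0 := ⟨_, rfl⟩
  obtain ⟨pJ, hpJ⟩ : ∃ p, p = v⁻¹ j.castSucc := ⟨_, rfl⟩
  obtain ⟨pS, hpS⟩ : ∃ p, p = v⁻¹ j.succ := ⟨_, rfl⟩
  -- Among the values up to `j` the value `0` stands leftmost, and values below `v 0` occur only
  -- from position `i + 1` on.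
  have ha0 : v i.succ ≤ j.castSucc → i.succ = pZ := by
    intro hle
    have h1 : pZ ≤ i.succ := by
      rcases eq_or_ne (v i.succ) 0 with h2 | h2
      · rw [hpZ, Perm.eq_inv_iff_eq.2 h2]
      · have := hj.mono 0 (v i.succ) (Fin.pos_iff_ne_zero.2 h2) hle
        rw [perm_inv_apply] at this
        rw [hpZ]
        exact this.le
    refine le_antisymm (hsm pZ ?_) h1
    rw [hpZ, perm_apply_inv]
    exact Fin.pos_iff_ne_zero.2 h0
  rw [← hpZ] at c4 hzJ
  rw [← hpJ] at c4 hzJ c3 hsJ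
  rw [← hpS] at c3 hsJ
  replace hpZ : v pZ = 0 := by simp [hpZ]
  replace hpJ : v pJ = j.castSucc := by simp [hpJ]
  replace hpS : v pS = j.succ := by simp [hpS]
  have hz : ∀ p, v pZ ≤ v p := fun p => by rw [hpZ]; exact Fin.zero_le _
  have hz0 : v pZ < v 0 := by rw [hpZ]; exact Fin.pos_iff_ne_zero.2 h0
  rw [← hpJ] at hcJ ha0 hJ hJJ
  rw [← hpS] at c4 c3 hJJ hJ
  have hinj : ∀ p p', v p = v p' → p = p' := fun p p' => v.injective.eq_iff.1
  have hsZ := hsm pZ hz0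
  have hsj := hsm pJ hcJ
  obtain ⟨Y, hY1, hY2, hY3⟩ := c1
  obtain ⟨D, hD1, hD2, hD3⟩ := c3
  -- the two configurations that end with the value `j` after a value `v D > v 0`
  have key0 : ∀ E, i.succ = pZ → pZ < E → E < pJ → v 0 < v E → False := by
    intro E e1 e2 e3 e4
    obtain ⟨Y, hY1, hY2, hY3⟩ := c2 (by rw [e1, hpZ])
    have hlt : (0 : Fin (n + 1)) < i.castSucc := Fin.pos_iff_ne_zero.2 fun hc => by
      rw [hc] at hY3; order
    have hZJ : v pZ < v pJ := lt_of_le_of_ne (hz _) fun hc => by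
      have := hinj _ _ hc; order
    rcases lt_trichotomy Y pJ with h1 | h1 | h1
    · exact h.a35142 0 i.castSucc pZ Y pJ hlt (by order) (by order) h1 hZJ hcJ hY2 hY3
    · rw [h1] at hY2; order
    · rcases lt_trichotomy (v E) (v i.castSucc) with h2 | h2 | h2
      · exact h.a35142 0 i.castSucc pZ E pJ hlt (by order) (by order) e3 hZJ hcJ e4 h2
      · have := hinj _ _ h2; order
      · exact h.a351624 0 i.castSucc pZ E pJ Y hlt (by order) (by order) e3 h1 hZJ hcJ hY2 hY3 h2
  have key1 : v pJ < v i.succ → pJ < Y := by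
    intro h1
    rcases lt_trichotomy Y pJ with h2 | h2 | h2
    · exact (h.a4231 i.castSucc i.succ Y pJ hII hY1 h2 h1 hY2 hY3).elim
    · rw [h2] at hY2; order
    · exact h2
  have key2 : ∀ E, v pJ < v i.succ → i.succ < E → E < pJ → v i.succ < v E → False := by
    intro E e1 e2 e3 e4
    rcases lt_trichotomy (v E) (v i.castSucc) with h2 | h2 | h2
    · exact h.a4231 i.castSucc i.succ E pJ hII e2 e3 e1 e4 h2
    · have := hinj _ _ h2; order
    · exact h.a42513 i.castSucc i.succ E pJ Y hII e2 e3 (key1 e1) e1 hY2 hY3 h2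
  rcases eq_or_ne (v 0) (v pS) with hc | hc
  · obtain ⟨E, hE1, hE2, hE3⟩ := c4 hc
    rcases lt_trichotomy (v i.succ) (v 0) with h1 | h1 | h1
    · exact key0 E (ha0 (hJ _ (by order))) hE2 hE3 (by order)
    · have := hinj _ _ h1
      exact absurd this (Fin.succ_ne_zero i)
    · rcases lt_trichotomy (v E) (v i.succ) with h2 | h2 | h2
      · have hlt : (0 : Fin (n + 1)) < i.castSucc := Fin.pos_iff_ne_zero.2 fun hc => by
          rw [hc] at hab; order
        have hZJ : v pZ < v pJ := lt_of_le_of_ne (hz _) fun hc => by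
          have := hinj _ _ hc; order
        exact h.a35142 0 i.castSucc pZ E pJ hlt (by order) hE2 hE3 hZJ hcJ (by order) (by order)
      · have := hinj _ _ h2; order
      · exact key2 E (by order) (by order) hE3 h2
  · have hSc : v pS < v 0 := by
      refine lt_of_le_of_ne (not_lt.1 fun h1 => ?_) hc.symm
      have := hJ _ h1; order
    have hSi := hsm pS hSc
    have hDc : v 0 < v D := by
      rcases lt_trichotomy (v D) (v 0) with h1 | h1 | h1
      · refine (h.a4231 0 pS D pJ ?_ hD2 hD3 (by order) hD1 h1).elim
        exact lt_of_le_of_ne (Fin.zero_le _) fun h => by rw [← h] at hSc; order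
      · have := hinj _ _ h1
        rw [this] at hD2
        exact absurd hD2 (Fin.not_lt_zero _)
      · exact h1
    by_cases ha : v i.succ ≤ v pJ
    · have e := ha0 ha
      exact key0 D e (by order) hD3 hDc
    · rw [not_le] at ha
      rcases lt_trichotomy (v D) (v i.succ) with h2 | h2 | h2
      · exact h.a4231 i.castSucc pS D pJ (by order) hD2 hD3 (by order) hD1 (by order)
      · have := hinj _ _ h2; order
      · exact key2 D ha (by order) hD3 h2

end BruhatMatrix

/-! ### Induction over light exchanges, and the equation for avoiding permutations -/

namespace BruhatMatrix

open Equiv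

theorem revCompl_mul_adjSwap {n : ℕ} (v : Perm (Fin (n + 1))) (i : Fin n) :
    revCompl v * adjSwap i.rev = revCompl (v * adjSwap i) := by
  have h : adjSwap i.rev = Fin.revPerm * adjSwap i * Fin.revPerm⁻¹ := by
    rw [adjSwap, adjSwap, ← swap_apply_apply, Fin.revPerm_apply, Fin.revPerm_apply,
      Fin.rev_castSucc, Fin.rev_succ, swap_comm]
  rw [h, revCompl, revCompl]
  refine Equiv.ext fun x => ?_
  simp [Perm.mul_apply]

section Induction

variable {n : ℕ} {P : Perm (Fin (n + 1)) → Prop}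

/-- The mirror image of a light exchange: the bottom of the descent is a right-to-left minimum, and
no earlier value lies between the two ends. -/
theorem iff_mul_adjSwap_of_revCompl
    (hL : ∀ v i, LightDescent v i → (P v ↔ P (v * adjSwap i)))
    (hrc : ∀ v, P (revCompl v) ↔ P v) {v : Perm (Fin (n + 1))} {i : Fin n}
    (hd : v i.succ < v i.castSucc) (hmin : ∀ k, i.succ < k → v i.succ < v k)
    (hgap : ∀ k, k < i.castSucc → v k < v i.castSucc → v k < v i.succ) :
    P v ↔ P (v * adjSwap i) := by
  rw [← hrc v, ← hrc (v * adjSwap i), ← revCompl_mul_adjSwap]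
  refine hL _ _ ⟨?_, fun k hk => ?_, fun k hk => ?_⟩
  · rw [revCompl_apply, revCompl_apply, ← Fin.rev_castSucc, ← Fin.rev_succ, Fin.rev_rev,
      Fin.rev_rev, Fin.rev_lt_rev]
    exact hd
  · rw [revCompl_apply, revCompl_apply, ← Fin.rev_succ, Fin.rev_rev, Fin.rev_lt_rev]
    refine hmin _ ?_
    rw [← Fin.rev_succ, ← Fin.rev_rev k, Fin.rev_lt_rev] at hk
    exact hk
  · rw [revCompl_apply, revCompl_apply, revCompl_apply, ← Fin.rev_succ, ← Fin.rev_castSucc,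
      Fin.rev_rev, Fin.rev_rev, Fin.rev_lt_rev, Fin.rev_lt_rev]
    refine hgap _ ?_
    rw [← Fin.rev_castSucc, ← Fin.rev_rev k, Fin.rev_lt_rev] at hk
    exact hk

/-- The values `c + 1, …, c + m, c, c + m + 1, …, c + k, 0` come first. -/
structure HeavyPrefix (v : Perm (Fin (n + 1))) (c k m : ℕ) : Prop where
  before : ∀ t, t.val < m → (v t).val = c + 1 + t
  here : ∀ t, t.val = m → (v t).val = c
  after : ∀ t, m < t.val → t.val ≤ k → (v t).val = c + t
  bot : ∀ t, t.val = k + 1 → (v t).val = 0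

/-- The entry `c` is pushed right through `c + 1, …, c + k` by light exchanges read backwards, until
it stands before `0`. The pair `c, 0` is then exchanged by a mirrored light move, leaving a heavy
prefix shorter by one and starting at `c + 1`. The last round brings `0` to the front. The pushes
increase length, so the induction runs on `k` and on the number `s` of pushes left. -/
theorem HeavyPrefix.induction (h0 : ∀ v : Perm (Fin (n + 1)), v 0 = 0 → P v)
    (hL : ∀ v i, LightDescent v i → (P v ↔ P (v * adjSwap i)))
    (hrc : ∀ v, P (revCompl v) ↔ P v) (k : ℕ) (hk : k < n) :
    ∀ (s m c : ℕ) (v : Perm (Fin (n + 1))), m + s = k → 0 < c → HeavyPrefix v c k m → P v := by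
  induction k with
  | zero =>
    intro s m c v hm hc hv
    obtain ⟨rfl, rfl⟩ : m = 0 ∧ s = 0 := by omega
    have e1 : (v (⟨0, hk⟩ : Fin n).castSucc).val = c := hv.here _ rfl
    have e2 : (v (⟨0, hk⟩ : Fin n).succ).val = 0 := hv.bot _ rfl
    refine (iff_mul_adjSwap_of_revCompl hL hrc (i := ⟨0, hk⟩) (Fin.lt_def.2 (by omega))
      (fun k hk => ?_) (fun k hk => absurd hk (Nat.not_lt_zero _))).2 (h0 _ ?_)
    · rw [Fin.lt_def, e2]
      refine Nat.pos_of_ne_zero fun h => hk.ne (v.injective (Fin.ext (by rw [e2, h])))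
    · have : (0 : Fin (n + 1)) = (⟨0, hk⟩ : Fin n).castSucc := rfl
      rw [this, Perm.mul_apply, adjSwap_castSucc]
      exact Fin.ext e2
  | succ k ihk =>
    intro s
    induction s with
    | zero =>
      rintro m c v hm hc hv
      obtain rfl : m = k + 1 := by omega
      have e1 : (v (⟨k + 1, hk⟩ : Fin n).castSucc).val = c := hv.here _ rfl
      have e2 : (v (⟨k + 1, hk⟩ : Fin n).succ).val = 0 := hv.bot _ rfl
      refine (iff_mul_adjSwap_of_revCompl hL hrc (i := ⟨k + 1, hk⟩) (Fin.lt_def.2 (by omega))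
        (fun k hk => ?_) (fun t ht hlt => ?_)).2
        (ihk (by omega) k 0 (c + 1) _ (by omega) (by omega) ⟨?_, ?_, ?_, ?_⟩)
      · rw [Fin.lt_def, e2]
        refine Nat.pos_of_ne_zero fun h => hk.ne (v.injective (Fin.ext (by rw [e2, h])))
      · have := hv.before t ht
        rw [Fin.lt_def] at hlt
        omega
      · intro t ht; omega
      · intro t ht
        rw [Perm.mul_apply, adjSwap_of_ne, hv.before t (by omega)]
        · omega
        all_goals
          rintro rfl
          simp at ht
      · intro t ht1 ht2
        rw [Perm.mul_apply, adjSwap_of_ne, hv.before t (by omega)]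
        all_goals
          rintro rfl
          simp at ht2
      · intro t ht
        obtain rfl : t = (⟨k + 1, hk⟩ : Fin n).castSucc := Fin.ext ht
        rw [Perm.mul_apply, adjSwap_castSucc, e2]
    | succ s ihs =>
      rintro m c v hm hc hv
      have hmn : m < n := by omega
      have e1 : (v (⟨m, hmn⟩ : Fin n).castSucc).val = c := hv.here _ rfl
      have e2 : (v (⟨m, hmn⟩ : Fin n).succ).val = c + (m + 1) :=
        hv.after _ (Nat.lt_succ_self m) (by simp; omega)
      have hv' : HeavyPrefix (v * adjSwap ⟨m, hmn⟩) c (k + 1) (m + 1) := by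
        refine ⟨fun t ht => ?_, fun t ht => ?_, fun t ht1 ht2 => ?_, fun t ht => ?_⟩
        · by_cases htm : t.val = m
          · obtain rfl : t = (⟨m, hmn⟩ : Fin n).castSucc := Fin.ext htm
            rw [Perm.mul_apply, adjSwap_castSucc, e2]
            simp; omega
          · rw [Perm.mul_apply, adjSwap_of_ne, hv.before t (by omega)]
            all_goals
              rintro rfl
              simp at ht htm
        · obtain rfl : t = (⟨m, hmn⟩ : Fin n).succ := Fin.ext ht
          rw [Perm.mul_apply, adjSwap_succ, e1]
        · rw [Perm.mul_apply, adjSwap_of_ne, hv.after t (by omega) ht2]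
          all_goals
            rintro rfl
            simp at ht1
            try omega
        · rw [Perm.mul_apply, adjSwap_of_ne, hv.bot t ht]
          all_goals
            rintro rfl
            simp at ht
            omega
      have hP := ihs (m + 1) c _ (by omega) hc hv'
      -- All values strictly between `c` and `c + m + 1` already stand in front, which gives the gap
      -- condition.
      have hl : LightDescent (v * adjSwap ⟨m, hmn⟩) ⟨m, hmn⟩ := by
        have f1 : ((v * adjSwap ⟨m, hmn⟩) (⟨m, hmn⟩ : Fin n).castSucc).val = c + (m + 1) := by
          rw [Perm.mul_apply, adjSwap_castSucc, e2]
        have f2 : ((v * adjSwap ⟨m, hmn⟩) (⟨m, hmn⟩ : Fin n).succ).val = c := by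
          rw [Perm.mul_apply, adjSwap_succ, e1]
        refine ⟨Fin.lt_def.2 (by omega), fun t ht => ?_, fun t ht1 ht2 => ?_⟩
        · have htm : t.val < m := ht
          rw [Fin.lt_def, f1, hv'.before t (by omega)]
          omega
        · rw [Fin.lt_def] at ht1 ht2 ⊢
          rw [f2] at ht2
          rw [f1]
          by_contra hcon
          have ht3 : m + 1 < t.val := ht1
          have := hv'.before ⟨((v * adjSwap ⟨m, hmn⟩) t).val - (c + 1), by omega⟩
            (by simp only; omega)
          have h4 : ((v * adjSwap ⟨m, hmn⟩) t).val =
              c + 1 + (((v * adjSwap ⟨m, hmn⟩) t).val - (c + 1)) := by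
            omega
          have h5 := (v * adjSwap ⟨m, hmn⟩).injective (Fin.ext (h4.trans this.symm))
          have h6 := congrArg Fin.val h5
          simp only at h6
          omega
      have := (hL _ _ hl).1 hP
      rwa [mul_assoc, adjSwap_mul_self, mul_one] at this

/-- The entries up to the descent are consecutive: a skipped value could stand neither in the
increasing prefix, nor at `i + 1` where the value is `0`, nor later by the gap condition. -/
theorem HeavyDescent.heavyPrefix {v : Perm (Fin (n + 1))} {i : Fin n} (h : HeavyDescent v i) :
    HeavyPrefix v (v 0).val i.val 0 := by
  have key : ∀ t : Fin (n + 1), t ≤ i.castSucc → (v t).val = (v 0).val + t.val := by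
    intro t
    induction t using Fin.induction with
    | zero => simp
    | succ k ih =>
      intro hk
      have hk' : k.castSucc < i.castSucc := Fin.castSucc_lt_iff_succ_le.2 hk
      have h1 := ih hk'.le
      have h2 : (v k.castSucc).val < (v k.succ).val := h.mono _ _ Fin.castSucc_lt_succ hk
      have h3 : (v k.succ).val ≤ (v i.castSucc).val := by
        rcases hk.lt_or_eq with h3 | h3
        · exact (h.mono _ _ h3 le_rfl).le
        · rw [h3]
      by_contra hcon
      rw [Fin.val_succ] at hcon
      rw [Fin.val_castSucc] at h1
      obtain ⟨y, hy⟩ := v.surjective ⟨(v 0).val + (k.val + 1), by omega⟩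
      have hyv : (v y).val = (v 0).val + (k.val + 1) := congrArg Fin.val hy
      rcases lt_trichotomy y i.succ with h4 | h4 | h4
      · have h5 : y ≤ i.castSucc := Fin.le_castSucc_iff.2 h4
        rcases lt_trichotomy y k.succ with h6 | h6 | h6
        · rcases (Fin.le_castSucc_iff.2 h6).lt_or_eq with h7 | h7
          · have : (v y).val < (v k.castSucc).val := h.mono _ _ h7 hk'.le
            omega
          · rw [h7] at hyv; omega
        · rw [h6] at hyv; omega
        · have : (v k.succ).val < (v y).val := h.mono _ _ h6 h5
          omega
      · rw [h4, h.bot] at hyv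
        simp at hyv
      · have : (v i.castSucc).val < (v y).val := h.gap y h4 (Fin.lt_def.2 (by omega))
        omega
  refine ⟨fun t ht => absurd ht (Nat.not_lt_zero _), fun t ht => ?_, fun t _ ht => key t ht,
    fun t ht => ?_⟩
  · obtain rfl : t = 0 := Fin.ext ht
    rfl
  · obtain rfl : t = i.succ := Fin.ext ht
    rw [h.bot]; rfl

/-- Induction principle behind the theorem: every avoiding permutation is reached from those
fixing the first point by light moves, inversion and reverse complement. -/
theorem light_induction (h0 : ∀ v : Perm (Fin (n + 1)), v 0 = 0 → P v)
    (hL : ∀ v i, LightDescent v i → (P v ↔ P (v * adjSwap i)))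
    (hinv : ∀ v, P v⁻¹ ↔ P v) (hrc : ∀ v, P (revCompl v) ↔ P v) (hna : ∀ v, ¬ Avoiding v → P v)
    (v : Perm (Fin (n + 1))) : P v := by
  have hH : ∀ (v : Perm (Fin (n + 1))) i, v 0 ≠ 0 → HeavyDescent v i → P v := fun v i hv h =>
    HeavyPrefix.induction h0 hL hrc i.val i.isLt i.val 0 _ v (by omega)
      (Nat.pos_of_ne_zero fun h => hv (Fin.ext h)) h.heavyPrefix
  induction hl : length v using Nat.strong_induction_on generalizing v with
  | _ l ih =>
    subst hl
    by_cases ha : Avoiding v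
    swap
    · exact hna v ha
    by_cases hv : v 0 = 0
    · exact h0 v hv
    have hv' : v⁻¹ 0 ≠ 0 := fun h => hv (by rw [Perm.inv_eq_iff_eq] at h; exact h.symm)
    obtain ⟨i, hi⟩ := exists_firstDescent hv
    obtain ⟨j, hj⟩ := exists_firstDescent hv'
    rcases ha.light_or_heavy hv hi hj with h | h | h | h
    · refine (hL v i h).2 (ih _ ?_ _ rfl)
      rw [length_mul_adjSwap h.desc]
      exact Nat.lt_succ_self _
    · exact hH v i hv h
    · refine (hinv v).1 ((hL _ j h).2 (ih _ ?_ _ rfl))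
      rw [← length_inv v, length_mul_adjSwap h.desc]
      exact Nat.lt_succ_self _
    · exact (hinv v).1 (hH _ j hv' h)

end Induction

theorem Avoiding.matCount_eq (F : Type) [Field F] [Fintype F] {n : ℕ} {v : Perm (Fin n)}
    (hv : Avoiding v) :
    (matCount F v : ℤ) = ((Fintype.card F : ℤ) - 1) ^ n * lowerSum (Fintype.card F) v := by
  induction n with
  | zero =>
    have h1 : lowerSum (Fintype.card F) v = 1 := by
      classical
      have hs : ∀ u : Perm (Fin 0), u = v := fun u => Subsingleton.elim _ _
      rw [lowerSum, Finset.filter_true_of_mem fun u _ => by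
        rw [hs u]; exact Relation.ReflTransGen.refl]
      simp [length]
    have h2 : matCount F v = 1 := by
      rw [matCount, Set.ncard_eq_one]
      refine ⟨1, Set.eq_singleton_iff_unique_mem.2 ⟨⟨isUnit_one, fun i => i.elim0⟩,
        fun A _ => Subsingleton.elim _ _⟩⟩
    rw [h1, h2]; simp
  | succ n ih =>
    revert hv
    refine light_induction (P := fun v => Avoiding v → (matCount F v : ℤ) =
      ((Fintype.card F : ℤ) - 1) ^ (n + 1) * lowerSum (Fintype.card F) v) ?_ ?_ ?_ ?_ ?_ v
    · intro v h0 hv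
      rw [matCount_of_apply_zero F h0, lowerSum_of_apply_zero _ h0, ih (hv.del 0)]
      push_cast
      ring
    · intro v i hl
      have hav : Avoiding (v * adjSwap i) ↔ Avoiding v := ⟨hl.avoiding_of_mul, hl.avoiding_mul⟩
      rw [hav]
      refine forall_congr' fun hv => ?_
      rw [hl.matCount_eq F, hl.lowerSum_eq, ih (hv.del _)]
      -- Since `q ≠ 0` the common recursion can be solved for the exchanged permutation too, giving
      -- the equivalence needed for backward moves.
      have hq : (Fintype.card F : ℤ) ≠ 0 := by
        exact_mod_cast Fintype.card_ne_zero
      rw [← mul_right_inj' (b := (matCount F (v * adjSwap i) : ℤ)) hq]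
      push_cast
      constructor <;> intro h <;> linear_combination h
    · intro v
      rw [matCount_inv, lowerSum_inv]
      refine ⟨fun h hv => h hv.inv, fun h hv => h ?_⟩
      have := hv.inv
      rwa [inv_inv] at this
    · intro v
      rw [matCount_revCompl, lowerSum_revCompl]
      refine ⟨fun h hv => h hv.revCompl, fun h hv => h ?_⟩
      have := hv.revCompl
      rwa [revCompl_revCompl] at this
    · intro v hv hv'
      exact absurd hv' hv

theorem natCard_pow_mul_poincare (F : Type) [Field F] [Finite F] {n : ℕ} (v : Perm (Fin n)) :
    (Nat.card F : ℚ) ^ (n.choose 2 + length v) *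
      Polynomial.aeval ((Nat.card F : ℚ)⁻¹) (poincare v) = lowerSum (Nat.card F) v := by
  classical
  have hq : (Nat.card F : ℚ) ≠ 0 := by exact_mod_cast Nat.card_pos.ne'
  rw [poincare, map_sum, Finset.mul_sum, lowerSum, Nat.cast_sum]
  refine Finset.sum_congr (by congr!) fun u hu => ?_
  have hu : BruhatLE u v := by simpa using hu
  have := hu.length_le
  rw [map_pow, Polynomial.aeval_X, inv_pow, ← div_eq_mul_inv, div_eq_iff (pow_ne_zero _ hq),
    Nat.cast_pow, ← pow_add]
  congr 1
  omega

theorem countEqPoincare_iff (F : Type) [Field F] [Fintype F] {n : ℕ} (v : Perm (Fin n)) :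
    CountEqPoincare F v ↔
      (matCount F v : ℤ) = ((Fintype.card F : ℤ) - 1) ^ n * lowerSum (Fintype.card F) v := by
  have hq : ((Fintype.card F : ℚ) - 1) ^ n ≠ 0 := by
    refine pow_ne_zero _ (sub_ne_zero.2 ?_)
    exact_mod_cast (Fintype.one_lt_card (α := F)).ne'
  rw [CountEqPoincare, natCard_pow_mul_poincare, normMatCount, Nat.card_eq_fintype_card,
    div_eq_iff hq]
  rw [← @Int.cast_inj ℚ]
  push_cast
  rw [mul_comm]

end BruhatMatrix

/-! ### Both sides modulo powers of `q - 1` -/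

namespace BruhatMatrix

open Equiv

theorem natCard_dvd_of_free {G X : Type*} [Group G] [MulAction G X]
    (h : ∀ (g : G) (x : X), g • x = x → g = 1) : Nat.card G ∣ Nat.card X := by
  have e := MulAction.selfEquivOrbitsQuotientProd (G := G) (X := X) fun b => by
    rw [eq_bot_iff]
    intro g hg
    exact h g b hg
  rw [Nat.card_congr e, Nat.card_prod]
  exact Dvd.intro_left _ rfl

section Torus

variable {F : Type} [Field F] {n : ℕ}

/-- Scale row `i` by `g.1 i`, and column `j` by `g.2`. -/
def torusScale (j : Fin n) (g : (Fin n → Fˣ) × Fˣ) (A : Matrix (Fin n) (Fin n) F) :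
    Matrix (Fin n) (Fin n) F :=
  fun i k => g.1 i * A i k * (if k = j then g.2 else 1 : Fˣ)

theorem torusScale_eq_zero_iff {j : Fin n} {g : (Fin n → Fˣ) × Fˣ}
    {A : Matrix (Fin n) (Fin n) F} {i k : Fin n} : torusScale j g A i k = 0 ↔ A i k = 0 := by
  simp [torusScale]

theorem isUnit_torusScale {j : Fin n} {g : (Fin n → Fˣ) × Fˣ}
    {A : Matrix (Fin n) (Fin n) F} (hA : IsUnit A) : IsUnit (torusScale j g A) := by
  have e : torusScale j g A = Matrix.diagonal (fun i => (g.1 i : F)) * A *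
      Matrix.diagonal (fun k => ((if k = j then g.2 else 1 : Fˣ) : F)) := by
    ext i k
    rw [Matrix.mul_diagonal, Matrix.diagonal_mul]
    rfl
  have hd : ∀ d : Fin n → Fˣ, IsUnit (Matrix.diagonal (fun i => (d i : F))) := fun d => by
    rw [Matrix.isUnit_iff_isUnit_det, Matrix.det_diagonal, isUnit_iff_ne_zero]
    exact Finset.prod_ne_zero_iff.2 fun i _ => (d i).ne_zero
  rw [e]
  exact ((hd _).mul hA).mul (hd fun k => if k = j then g.2 else 1)

/-- Some row has a nonzero entry in column `j` and another one elsewhere. -/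
def SharedColumn (A : Matrix (Fin n) (Fin n) F) (j : Fin n) : Prop :=
  ∃ r k, k ≠ j ∧ A r j ≠ 0 ∧ A r k ≠ 0

theorem sharedColumn_torusScale {j j' : Fin n} {g : (Fin n → Fˣ) × Fˣ}
    {A : Matrix (Fin n) (Fin n) F} : SharedColumn (torusScale j g A) j' ↔ SharedColumn A j' := by
  simp only [SharedColumn, ne_eq, torusScale_eq_zero_iff]

/-- Invertible matrices vanishing on `Z` whose least shared column is `j`. -/
def leastShared (Z : Set (Fin n × Fin n)) (j : Fin n) : Set (Matrix (Fin n) (Fin n) F) :=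
  {A | (IsUnit A ∧ ∀ i k, (i, k) ∈ Z → A i k = 0) ∧ SharedColumn A j ∧
    ∀ j' < j, ¬ SharedColumn A j'}

/-- The torus of row scalings and of scalings of column `j` acts on `leastShared Z j`. -/
@[reducible]
def torusAction (Z : Set (Fin n × Fin n)) (j : Fin n) :
    MulAction ((Fin n → Fˣ) × Fˣ) (leastShared (F := F) Z j) where
  smul g A := ⟨torusScale j g A.1, ⟨isUnit_torusScale A.2.1.1, fun i k h =>
    torusScale_eq_zero_iff.2 (A.2.1.2 i k h)⟩, sharedColumn_torusScale.2 A.2.2.1,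
    fun j' h => fun h' => A.2.2.2 j' h (sharedColumn_torusScale.1 h')⟩
  one_smul A := Subtype.ext <| by
    change torusScale j 1 A.1 = A.1
    ext i k
    simp [torusScale]
  mul_smul g h A := Subtype.ext <| by
    change torusScale j (g * h) A.1 = torusScale j g (torusScale j h A.1)
    ext i k
    simp only [torusScale, Prod.fst_mul, Prod.snd_mul, Pi.mul_apply]
    split_ifs
    · push_cast; ring
    · push_cast; ring

theorem exists_ne_zero_of_isUnit {A : Matrix (Fin n) (Fin n) F} (hA : IsUnit A) (i : Fin n) :
    ∃ k, A i k ≠ 0 := by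
  by_contra! h
  rw [Matrix.isUnit_iff_isUnit_det, isUnit_iff_ne_zero] at hA
  exact hA (Matrix.det_eq_zero_of_row_eq_zero i h)

/-- The torus acts freely. A row meeting column `j` and another column forces first its own scale
and then the column scale to be one; every other row has a nonzero entry, which then fixes its
scale. -/
theorem dvd_card_leastShared [Fintype F] (Z : Set (Fin n × Fin n)) (j : Fin n) :
    (Fintype.card F - 1) ^ (n + 1) ∣ (leastShared (F := F) Z j).ncard := by
  classical
  let := torusAction (F := F) Z j
  have h := natCard_dvd_of_free (G := (Fin n → Fˣ) × Fˣ) (X := leastShared (F := F) Z j) ?_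
  · rw [Nat.card_prod, Nat.card_fun, Nat.card_eq_fintype_card (α := Fin n), Fintype.card_fin,
      Nat.card_eq_fintype_card, Fintype.card_units, ← pow_succ, Nat.card_coe_set_eq] at h
    exact h
  · intro g A hg
    have hg' : torusScale j g A.1 = A.1 := congrArg Subtype.val hg
    have e : ∀ i k, (g.1 i : F) * A.1 i k * (if k = j then g.2 else 1 : Fˣ) = A.1 i k :=
      fun i k => congrFun (congrFun hg' i) k
    obtain ⟨r, k, hk, h1, h2⟩ := A.2.2.1
    have e1 : g.1 r = 1 := by
      have := e r k
      rw [if_neg hk, Units.val_one, mul_one] at this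
      exact Units.ext (mul_right_cancel₀ h2 (by simpa using this))
    have e2 : g.2 = 1 := by
      have := e r j
      rw [if_pos rfl, e1, Units.val_one, one_mul] at this
      exact Units.ext (mul_left_cancel₀ h1 (by simpa using this))
    refine Prod.ext (funext fun i => ?_) e2
    obtain ⟨k, hk⟩ := exists_ne_zero_of_isUnit A.2.1.1 i
    have := e i k
    rw [e2, ite_self, Units.val_one, mul_one] at this
    exact Units.ext (mul_right_cancel₀ hk (by simpa using this))

/-- The monomial matrix with entry `d i` in position `(i, σ i)`. -/
def monomial (p : Perm (Fin n) × (Fin n → Fˣ)) : Matrix (Fin n) (Fin n) F :=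
  fun i k => if p.1 i = k then p.2 i else 0

theorem monomial_apply_ne_zero {p : Perm (Fin n) × (Fin n → Fˣ)} {i k : Fin n} :
    monomial p i k ≠ 0 ↔ p.1 i = k := by
  simp [monomial]

theorem isUnit_monomial (p : Perm (Fin n) × (Fin n → Fˣ)) : IsUnit (monomial p) := by
  have e : monomial p = Matrix.diagonal (fun i => (p.2 i : F)) * (p.1).toPEquiv.toMatrix := by
    ext i k
    rw [Matrix.diagonal_mul, PEquiv.toMatrix_apply]
    simp [monomial, toPEquiv_apply, eq_comm]
  have h1 : IsUnit ((p.1).toPEquiv.toMatrix : Matrix (Fin n) (Fin n) F) := by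
    rw [Matrix.isUnit_iff_isUnit_det, Matrix.det_permutation]
    exact ((Equiv.Perm.sign p.1).isUnit).map (Int.castRingHom F)
  rw [e]
  refine IsUnit.mul ?_ h1
  rw [Matrix.isUnit_iff_isUnit_det, Matrix.det_diagonal, isUnit_iff_ne_zero]
  exact Finset.prod_ne_zero_iff.2 fun i _ => (p.2 i).ne_zero

theorem exists_monomial_eq {A : Matrix (Fin n) (Fin n) F} (hA : IsUnit A)
    (h : ∀ j, ¬ SharedColumn A j) : ∃ p, monomial p = A := by
  have huniq : ∀ i k k', A i k ≠ 0 → A i k' ≠ 0 → k = k' := fun i k k' h1 h2 => by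
    by_contra hne
    exact h k ⟨i, k', Ne.symm hne, h1, h2⟩
  choose s hs using exists_ne_zero_of_isUnit hA
  have hsurj : Function.Surjective s := by
    intro k
    by_contra! hk
    rw [Matrix.isUnit_iff_isUnit_det, isUnit_iff_ne_zero] at hA
    refine hA (Matrix.det_eq_zero_of_column_eq_zero k fun i => ?_)
    by_contra hik
    exact hk i (huniq i _ _ (hs i) hik)
  refine ⟨(Equiv.ofBijective s (Finite.surjective_iff_bijective.1 hsurj),
    fun i => Units.mk0 _ (hs i)), ?_⟩
  ext i k
  simp only [monomial, Equiv.ofBijective_apply, Units.val_mk0]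
  split_ifs with hk
  · rw [← hk]
  · by_contra hik
    exact hk (huniq i _ _ (hs i) (Ne.symm hik))

theorem monomial_injective : Function.Injective (monomial : Perm (Fin n) × (Fin n → Fˣ) → _) := by
  rintro ⟨σ, d⟩ ⟨τ, e⟩ h
  have h1 : σ = τ := Equiv.ext fun i => by
    have : monomial (τ, e) i (σ i) ≠ 0 := by rw [← h]; exact monomial_apply_ne_zero.2 rfl
    exact (monomial_apply_ne_zero.1 this).symm
  subst h1
  refine Prod.ext rfl (funext fun i => Units.ext ?_)
  have := congrFun (congrFun h i) (σ i)
  simpa [monomial] using this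

open Classical in
/-- The number of permutation matrices vanishing on `Z`. -/
noncomputable def rookCount (Z : Set (Fin n × Fin n)) : ℕ :=
  (Finset.univ.filter fun σ : Perm (Fin n) => ∀ i, (i, σ i) ∉ Z).card

/-- Invertible matrices without a shared column are monomial, giving `(q - 1) ^ n` matrices for each
placement. The others are sorted by their least shared column into sets with a free torus action of
rank `n + 1`. -/
theorem exists_zeroCount_eq [Fintype F] (Z : Set (Fin n × Fin n)) :
    ∃ m, zeroCount F Z = rookCount Z * (Fintype.card F - 1) ^ n +
      (Fintype.card F - 1) ^ (n + 1) * m := by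
  classical
  set S : Finset (Matrix (Fin n) (Fin n) F) :=
    Finset.univ.filter fun A => IsUnit A ∧ ∀ i j, (i, j) ∈ Z → A i j = 0 with hS
  have h0 : zeroCount F Z = S.card := by
    rw [zeroCount, ← Set.ncard_coe_finset]
    congr 1
    ext A
    simp [hS]
  have h1 : (S.filter fun A => ∀ j, ¬ SharedColumn A j).card =
      rookCount Z * (Fintype.card F - 1) ^ n := by
    have hc : (Fintype.card F - 1) ^ n = Fintype.card (Fin n → Fˣ) := by
      rw [Fintype.card_fun, Fintype.card_units, Fintype.card_fin]
    rw [rookCount, hc, ← Finset.card_univ, ← Finset.card_product]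
    symm
    refine Finset.card_bij (fun p _ => monomial p) ?_ ?_ ?_
    · intro p hp
      simp only [Finset.mem_product, Finset.mem_filter, Finset.mem_univ, true_and, and_true] at hp
      simp only [hS, Finset.mem_filter, Finset.mem_univ, true_and]
      refine ⟨⟨isUnit_monomial p, fun i j hij => ?_⟩, ?_⟩
      · by_contra hne
        rw [← monomial_apply_ne_zero.1 hne] at hij
        exact hp i hij
      · rintro j ⟨r, k, hk, h1, h2⟩
        exact hk ((monomial_apply_ne_zero.1 h2).symm.trans (monomial_apply_ne_zero.1 h1))
    · intro p _ p' _ h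
      exact monomial_injective h
    · intro A hA
      simp only [hS, Finset.mem_filter, Finset.mem_univ, true_and] at hA
      obtain ⟨p, rfl⟩ := exists_monomial_eq hA.1.1 hA.2
      refine ⟨p, ?_, rfl⟩
      simp only [Finset.mem_product, Finset.mem_filter, Finset.mem_univ, true_and, and_true]
      intro i hi
      exact (monomial_apply_ne_zero (p := p)).2 rfl (hA.1.2 i _ hi)
  have h2 : (S.filter fun A => ¬ ∀ j, ¬ SharedColumn A j) =
      Finset.univ.biUnion fun j => S.filter fun A => SharedColumn A j ∧
        ∀ j' < j, ¬ SharedColumn A j' := by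
    ext A
    simp only [Finset.mem_filter, Finset.mem_biUnion, Finset.mem_univ, true_and, not_forall,
      not_not]
    constructor
    · rintro ⟨hA, j, hj⟩
      obtain ⟨i, hi, hmin⟩ := WellFounded.has_min (wellFounded_lt (α := Fin n))
        {j | SharedColumn A j} ⟨j, hj⟩
      exact ⟨i, hA, hi, fun j' hj' h => hmin j' h hj'⟩
    · rintro ⟨j, hA, hj, -⟩
      exact ⟨hA, j, hj⟩
  have h3 : (Fintype.card F - 1) ^ (n + 1) ∣
      (S.filter fun A => ¬ ∀ j, ¬ SharedColumn A j).card := by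
    rw [h2, Finset.card_biUnion]
    · refine Finset.dvd_sum fun j _ => ?_
      have := dvd_card_leastShared (F := F) Z j
      have e : leastShared (F := F) Z j = ((S.filter fun A => SharedColumn A j ∧
          ∀ j' < j, ¬ SharedColumn A j' : Finset _) : Set (Matrix (Fin n) (Fin n) F)) := by
        ext A
        simp [hS, leastShared]
      rwa [e, Set.ncard_coe_finset] at this
    · intro i _ j _ hij
      refine Finset.disjoint_left.2 ?_
      intro A hA hA'
      simp only [Finset.mem_filter] at hA hA'
      rcases lt_or_gt_of_ne hij with h | h
      · exact hA'.2.2 i h hA.2.1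
      · exact hA.2.2 j h hA'.2.1
  obtain ⟨m, hm⟩ := h3
  refine ⟨m, ?_⟩
  rw [h0, ← h1, ← hm, Finset.card_filter_add_card_filter_not]

end Torus

open Classical in
/-- The number of elements of the lower interval of `w`. -/
noncomputable def lowerCard {n : ℕ} (w : Perm (Fin n)) : ℕ :=
  (Finset.univ.filter fun u : Perm (Fin n) => BruhatLE u w).card

theorem lowerSum_modEq (q : ℕ) {n : ℕ} (w : Perm (Fin n)) :
    ((q : ℤ) - 1) ∣ lowerSum q w - lowerCard w := by
  classical
  rw [lowerSum, lowerCard, Finset.card_eq_sum_ones, Nat.cast_sum, Nat.cast_sum,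
    ← Finset.sum_sub_distrib]
  refine Finset.dvd_sum fun u _ => ?_
  have := sub_dvd_pow_sub_pow (q : ℤ) 1 (n.choose 2 + length w - length u)
  simpa using this

/-- Dividing the equation by `(q - 1) ^ n` and reducing modulo `q - 1` shows that `q - 1` divides a
positive number at most `lowerCard w`, against the size of `F`. -/
theorem not_countEqPoincare {n : ℕ} {w : Perm (Fin n)}
    (h : rookCount (swDiagram w) < lowerCard w) (F : Type) [Field F] [Finite F]
    (hF : lowerCard w + 2 ≤ Nat.card F) : ¬ CountEqPoincare F w := by
  let := Fintype.ofFinite F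
  rw [Nat.card_eq_fintype_card] at hF
  rw [countEqPoincare_iff]
  intro heq
  obtain ⟨m, hm⟩ := exists_zeroCount_eq (F := F) (swDiagram w)
  obtain ⟨k, hk⟩ := lowerSum_modEq (Fintype.card F) w
  rw [matCount_eq_zeroCount, hm] at heq
  -- From here `q` is one less than the number of elements of the field.
  obtain ⟨q, hq⟩ : ∃ q, Fintype.card F = q + 1 := ⟨Fintype.card F - 1, by omega⟩
  rw [hq] at heq hk hF
  push_cast at heq hk
  simp only [add_tsub_cancel_right] at heq hk
  have hq0 : (q : ℤ) ^ n ≠ 0 := pow_ne_zero _ (by omega)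
  have h1 : (rookCount (swDiagram w) : ℤ) + q * m = lowerSum (q + 1) w := by
    apply mul_left_cancel₀ hq0
    linear_combination heq
  have h2 : (q : ℤ) ∣ lowerCard w - rookCount (swDiagram w) := ⟨m - k, by linear_combination -h1 - hk⟩
  have h3 := Int.le_of_dvd (by omega) h2
  omega

end BruhatMatrix

/-! ### Order-shattered sets, and merging cycles by a transposition -/

namespace BruhatMatrix

open Equiv

/-- `V` takes all values on the part of `S` beyond `i`, without changing the `i`-th bit. -/
def OrderShatters (r : ℕ) (V : Finset (Finset ℕ)) (S : Finset ℕ) : Prop :=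
  V.Nonempty ∧ ∀ i < r, ∃ b : Prop, ∀ s : Set ℕ, ∃ v ∈ V, (i ∈ v ↔ b) ∧
    ∀ j ∈ S, i < j → (j ∈ v ↔ j ∈ s)

-- Split `V` by the top element `r` into `V₀` and `V₁`; then `V.card` is the sum of the sizes of `V₀
-- ∪ V₁` and `V₀ ∩ V₁`. Sets shattered by the union are shattered by `V`, and sets shattered by the
-- intersection stay so after adding `r`. These two kinds are told apart by `r`.
open Classical in
theorem card_le_card_orderShatters (r : ℕ) (V : Finset (Finset ℕ))
    (hV : ∀ v ∈ V, v ⊆ Finset.range r) :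
    V.card ≤ ((Finset.range r).powerset.filter (OrderShatters r V)).card := by
  induction r generalizing V with
  | zero =>
    rcases V.eq_empty_or_nonempty with rfl | hne
    · simp
    · have h1 : V ⊆ {∅} := fun v hv => by
        simpa using hV v hv
      have h2 : ∅ ∈ (Finset.range 0).powerset.filter (OrderShatters 0 V) := by
        simp [OrderShatters, hne]
      exact (Finset.card_le_card h1).trans (Finset.card_pos.2 ⟨_, h2⟩)
  | succ r ih =>
    set V₀ := V.nonMemberSubfamily r
    set V₁ := V.memberSubfamily r
    have hsub : ∀ v ∈ V₀ ∪ V₁, v ⊆ Finset.range r := by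
      intro v hv
      have hv' : v ⊆ Finset.range (r + 1) ∧ r ∉ v := by
        rcases Finset.mem_union.1 hv with h | h
        · rw [Finset.mem_nonMemberSubfamily] at h
          exact ⟨hV _ h.1, h.2⟩
        · rw [Finset.mem_memberSubfamily] at h
          exact ⟨(Finset.subset_insert _ _).trans (hV _ h.1), h.2⟩
      intro j hj
      have h1 := Finset.mem_range.1 (hv'.1 hj)
      have h2 : j ≠ r := fun h => hv'.2 (h ▸ hj)
      exact Finset.mem_range.2 (by omega)
    have h1 := ih (V₀ ∪ V₁) hsub
    have h2 := ih (V₀ ∩ V₁) fun v hv => hsub v (Finset.mem_union_left _ (Finset.mem_inter.1 hv).1)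
    set A := (Finset.range r).powerset.filter (OrderShatters r (V₀ ∪ V₁))
    set B := (Finset.range r).powerset.filter (OrderShatters r (V₀ ∩ V₁))
    have hr : ∀ S ⊆ Finset.range r, r ∉ S := fun S hS h => by simpa using hS h
    have hB : ∀ S ∈ B, r ∉ S := fun S hS =>
      hr S (Finset.mem_powerset.1 (Finset.mem_filter.1 hS).1)
    have hA : ∀ S ∈ A, r ∉ S := fun S hS =>
      hr S (Finset.mem_powerset.1 (Finset.mem_filter.1 hS).1)
    have h3 : (B.image (insert r)).card = B.card := by
      refine Finset.card_image_of_injOn fun S hS S' hS' h => ?_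
      rw [← Finset.erase_insert (hB S hS), ← Finset.erase_insert (hB S' hS')]
      exact congrArg (fun T => T.erase r) h
    have h4 : Disjoint A (B.image (insert r)) := by
      rw [Finset.disjoint_left]
      intro S hS hS'
      obtain ⟨T, -, rfl⟩ := Finset.mem_image.1 hS'
      exact hA _ hS (Finset.mem_insert_self _ _)
    rw [← Finset.card_memberSubfamily_add_card_nonMemberSubfamily r V, add_comm,
      ← Finset.card_union_add_card_inter]
    refine (add_le_add h1 h2).trans ?_
    rw [← h3, ← Finset.card_union_of_disjoint h4]
    have hlast : ∀ S ⊆ Finset.range (r + 1), V.Nonempty → ∃ b : Prop, ∀ s : Set ℕ, ∃ v ∈ V,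
        (r ∈ v ↔ b) ∧ ∀ j ∈ S, r < j → (j ∈ v ↔ j ∈ s) := by
      rintro S hS ⟨v, hv⟩
      refine ⟨r ∈ v, fun s => ⟨v, hv, Iff.rfl, fun j hj hlt => ?_⟩⟩
      have := Finset.mem_range.1 (hS hj)
      omega
    have hlift₀ : ∀ v ∈ V₀, v ∈ V := fun v hv => (Finset.mem_nonMemberSubfamily.1 hv).1
    have hlift₁ : ∀ v ∈ V₁, insert r v ∈ V := fun v hv => (Finset.mem_memberSubfamily.1 hv).1
    refine Finset.card_le_card fun S hS => ?_
    rcases Finset.mem_union.1 hS with hS | hS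
    · obtain ⟨hSr, ⟨u, hu⟩, hS⟩ := Finset.mem_filter.1 hS
      rw [Finset.mem_powerset] at hSr
      have hne : V.Nonempty := by
        rcases Finset.mem_union.1 hu with h | h
        · exact ⟨_, hlift₀ _ h⟩
        · exact ⟨_, hlift₁ _ h⟩
      have hSr' : S ⊆ Finset.range (r + 1) :=
        hSr.trans (Finset.range_subset_range.2 (Nat.le_succ r))
      refine Finset.mem_filter.2 ⟨Finset.mem_powerset.2 hSr', hne, fun i hi => ?_⟩
      rcases (Nat.lt_succ_iff.1 hi).lt_or_eq with hi | rfl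
      · obtain ⟨b, hb⟩ := hS i hi
        refine ⟨b, fun s => ?_⟩
        obtain ⟨v, hv, hvi, hvj⟩ := hb s
        rcases Finset.mem_union.1 hv with h | h
        · exact ⟨v, hlift₀ v h, hvi, hvj⟩
        · refine ⟨_, hlift₁ v h, ?_, fun j hj hij => ?_⟩
          · rw [Finset.mem_insert, or_iff_right hi.ne, hvi]
          · have : j ≠ r := fun h => hr S hSr (h ▸ hj)
            rw [Finset.mem_insert, or_iff_right this, hvj j hj hij]
      · exact hlast S hSr' hne
    · obtain ⟨T, hT, rfl⟩ := Finset.mem_image.1 hS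
      obtain ⟨hTr, ⟨u, hu⟩, hT⟩ := Finset.mem_filter.1 hT
      rw [Finset.mem_powerset] at hTr
      have hne : V.Nonempty := ⟨_, hlift₀ _ (Finset.mem_inter.1 hu).1⟩
      have hSr' : insert r T ⊆ Finset.range (r + 1) := by
        rw [Finset.range_add_one]
        exact Finset.insert_subset_insert _ hTr
      refine Finset.mem_filter.2 ⟨Finset.mem_powerset.2 hSr', hne, fun i hi => ?_⟩
      rcases (Nat.lt_succ_iff.1 hi).lt_or_eq with hi | rfl
      · obtain ⟨b, hb⟩ := hT i hi
        refine ⟨b, fun s => ?_⟩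
        obtain ⟨v, hv, hvi, hvj⟩ := hb s
        obtain ⟨hv0, hv1⟩ := Finset.mem_inter.1 hv
        have hrv := (Finset.mem_nonMemberSubfamily.1 hv0).2
        have hjr : ∀ j ∈ T, j ≠ r := fun j hj h => hr T hTr (h ▸ hj)
        by_cases hrs : r ∈ s
        · refine ⟨_, hlift₁ v hv1, ?_, fun j hj hij => ?_⟩
          · rw [Finset.mem_insert, or_iff_right hi.ne, hvi]
          · rcases Finset.mem_insert.1 hj with rfl | hj
            · simp [hrs]
            · rw [Finset.mem_insert, or_iff_right (hjr j hj), hvj j hj hij]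
        · refine ⟨v, hlift₀ v hv0, hvi, fun j hj hij => ?_⟩
          rcases Finset.mem_insert.1 hj with rfl | hj
          · simp [hrs, hrv]
          · exact hvj j hj hij
      · exact hlast _ hSr' hne

section Swap

variable {α : Type*} [Finite α]

/-- Starting from `y`, the product follows the `g`-cycle of `y` undisturbed until `g` would return
to `y`; at that moment the swap sends it to `x`. -/
theorem sameCycle_swap_mul [DecidableEq α] {g : Perm α} {x y : α} (h : ¬ g.SameCycle x y) :
    (swap x y * g).SameCycle x y := by
  classical
  have hex : ∃ m, 0 < m ∧ (g ^ m) y = y :=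
    ⟨orderOf g, orderOf_pos g, by rw [pow_orderOf_eq_one]; rfl⟩
  set m := Nat.find hex
  obtain ⟨hm0, hm⟩ := Nat.find_spec hex
  have key : ∀ k < m, ((swap x y * g) ^ k) y = (g ^ k) y := by
    intro k
    induction k with
    | zero => simp
    | succ k ih =>
      intro hk
      rw [pow_succ', Perm.mul_apply, ih (by omega), Perm.mul_apply, pow_succ', Perm.mul_apply]
      refine swap_apply_of_ne_of_ne (fun hx => ?_) fun hy => ?_
      · refine h (Perm.SameCycle.symm ⟨(k + 1 : ℕ), ?_⟩)
        rw [zpow_natCast, pow_succ', Perm.mul_apply, hx]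
      · exact Nat.find_min hex hk ⟨Nat.succ_pos _, by rw [pow_succ', Perm.mul_apply, hy]⟩
  refine Perm.SameCycle.symm ⟨(m : ℕ), ?_⟩
  obtain ⟨k, hk⟩ : ∃ k, m = k + 1 := ⟨m - 1, by omega⟩
  rw [zpow_natCast, hk, pow_succ', Perm.mul_apply, key k (by omega), Perm.mul_apply,
    ← Perm.mul_apply g, ← pow_succ', ← hk]
  change swap x y ((g ^ m) y) = x
  rw [hm, swap_apply_right]

theorem sameCycle_of_forall {R : α → α → Prop} (hr : ∀ a, R a a)
    (ht : ∀ a b c, R a b → R b c → R a c) {g : Perm α} (h : ∀ a, R a (g a)) {a b : α}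
    (hab : g.SameCycle a b) : R a b := by
  obtain ⟨k, -, -, rfl⟩ := hab.exists_pow_eq''
  induction k with
  | zero => exact hr a
  | succ k ih =>
    rw [pow_succ', Perm.mul_apply]
    exact ht _ _ _ (ih ⟨(k : ℕ), by rw [zpow_natCast]⟩) (h _)

theorem sameCycle_swap_mul_of_sameCycle [DecidableEq α] {g : Perm α} {x y a b : α}
    (h : ¬ g.SameCycle x y)
    (hab : g.SameCycle a b) : (swap x y * g).SameCycle a b := by
  have hxy := sameCycle_swap_mul h
  refine sameCycle_of_forall (R := (swap x y * g).SameCycle) (fun a => Perm.SameCycle.refl _ a)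
    (fun a b c h1 h2 => h1.trans h2) (fun a => ?_) hab
  have h1 : (swap x y * g).SameCycle a (swap x y (g a)) := ⟨1, by simp⟩
  rcases eq_or_ne (g a) x with hx | hx
  · rw [hx, swap_apply_left] at h1
    rw [hx]
    exact h1.trans hxy.symm
  · rcases eq_or_ne (g a) y with hy | hy
    · rw [hy, swap_apply_right] at h1
      rw [hy]
      exact h1.trans hxy
    · rwa [swap_apply_of_ne_of_ne hx hy] at h1

end Swap

end BruhatMatrix

/-! ### Words attached to permutations -/

namespace BruhatMatrix

open Equiv

theorem head?_ne_some {α : Type*} {z : α} {l : List α} (hz : z ∉ l) : l.head? ≠ some z :=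
  fun h => hz (List.mem_of_mem_head? h)

section InsertAfter

variable {α : Type*} [DecidableEq α]

/-- Insert `z` after the first occurrence of `p`. -/
def insertAfter (p z : α) : List α → List α
  | [] => [z]
  | a :: t => if a = p then a :: z :: t else a :: insertAfter p z t

theorem insertAfter_perm (p z : α) (l : List α) : (insertAfter p z l).Perm (z :: l) := by
  induction l with
  | nil => exact List.Perm.refl _
  | cons a t ih =>
    rw [insertAfter]
    split_ifs
    · exact List.Perm.swap _ _ _
    · exact (List.Perm.cons a ih).trans (List.Perm.swap _ _ _)

theorem erase_insertAfter {p z : α} {l : List α} (hz : z ∉ l) : (insertAfter p z l).erase z = l := by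
  induction l with
  | nil => simp [insertAfter]
  | cons a t ih =>
    rw [List.mem_cons, not_or] at hz
    rw [insertAfter]
    split_ifs
    · rw [List.erase_cons_tail (by simpa using Ne.symm hz.1), List.erase_cons_head]
    · rw [List.erase_cons_tail (by simpa using Ne.symm hz.1), ih hz.2]

theorem head?_insertAfter {p z : α} {l : List α} (hp : p ∈ l) :
    (insertAfter p z l).head? = l.head? := by
  cases l with
  | nil => simp at hp
  | cons a t =>
    rw [insertAfter]
    split_ifs <;> rfl

theorem insertAfter_left_inj {p p' z : α} {l : List α} (hz : z ∉ l) (hp : p ∈ l) (hp' : p' ∈ l)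
    (h : insertAfter p z l = insertAfter p' z l) : p = p' := by
  induction l with
  | nil => simp at hp
  | cons a t ih =>
    rw [List.mem_cons, not_or] at hz
    rw [insertAfter, insertAfter] at h
    by_cases h1 : a = p <;> by_cases h2 : a = p'
    · exact h1.symm.trans h2
    · rw [if_pos h1, if_neg h2, List.cons_inj_right] at h
      have h3 := head?_insertAfter (z := z) ((List.mem_cons.1 hp').resolve_left (Ne.symm h2))
      rw [← h] at h3
      exact absurd h3.symm (head?_ne_some hz.2)
    · rw [if_neg h1, if_pos h2, List.cons_inj_right] at h
      have h3 := head?_insertAfter (z := z) ((List.mem_cons.1 hp).resolve_left (Ne.symm h1))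
      rw [h] at h3
      exact absurd h3.symm (head?_ne_some hz.2)
    · rw [if_neg h1, if_neg h2, List.cons_inj_right] at h
      exact ih hz.2 ((List.mem_cons.1 hp).resolve_left (Ne.symm h1))
        ((List.mem_cons.1 hp').resolve_left (Ne.symm h2)) h

/-- The insertion separates `p` from its successor, so the only old pair whose relation need not
survive is the one starting at `p`. -/
theorem isChain_insertAfter {R R' : α → α → Prop} {p z : α} {l : List α} (hl : l.IsChain R)
    (hnd : l.Nodup) (hp : p ∈ l) (hR : ∀ y x, R y x → y ≠ p → R' y x) (h1 : R' p z)
    (h2 : ∀ x ∈ l, R' z x) : (insertAfter p z l).IsChain R' := by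
  induction l with
  | nil => simp at hp
  | cons a t ih =>
    rw [List.isChain_cons] at hl
    rw [List.nodup_cons] at hnd
    rw [insertAfter]
    split_ifs with ha
    · have ht : t.IsChain R' := by
        refine hl.2.imp_of_mem_imp fun x y hx _ hxy => hR _ _ hxy ?_
        rintro rfl
        exact hnd.1 (ha ▸ hx)
      rw [List.isChain_cons_cons, List.isChain_cons]
      refine ⟨ha ▸ h1, fun y hy => h2 y ?_, ht⟩
      exact List.mem_cons_of_mem _ (List.mem_of_mem_head? hy)
    · have hpt := (List.mem_cons.1 hp).resolve_left (Ne.symm ha)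
      rw [List.isChain_cons, head?_insertAfter hpt]
      exact ⟨fun y hy => hR _ _ (hl.1 y hy) ha,
        ih hl.2 hnd.2 hpt fun x hx => h2 x (List.mem_cons_of_mem _ hx)⟩

end InsertAfter

/-- A word listing the points so that consecutive descents `y > x` satisfy `τ x = y`. -/
def word : ∀ {n : ℕ}, Perm (Fin n) → List (Fin n)
  | 0, _ => []
  | _ + 1, τ =>
    if τ 0 = 0 then 0 :: (word (Perm.decomposeFin τ).2).map Fin.succ
    else insertAfter (τ 0) 0 ((word (Perm.decomposeFin τ).2).map Fin.succ)

theorem word_perm {n : ℕ} (τ : Perm (Fin (n + 1))) :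
    (word τ).Perm (0 :: (word (Perm.decomposeFin τ).2).map Fin.succ) := by
  rw [word]
  split_ifs
  · exact List.Perm.refl _
  · exact insertAfter_perm _ _ _

theorem mem_word {n : ℕ} (τ : Perm (Fin n)) (x : Fin n) : x ∈ word τ := by
  induction n with
  | zero => exact x.elim0
  | succ n ih =>
    rw [(word_perm τ).mem_iff, List.mem_cons]
    refine Fin.cases (Or.inl rfl) (fun k => Or.inr ?_) x
    exact List.mem_map_of_mem (ih _ _)

theorem zero_notMem_map_succ {n : ℕ} (l : List (Fin n)) : (0 : Fin (n + 1)) ∉ l.map Fin.succ := by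
  simp [Fin.succ_ne_zero]

theorem nodup_word {n : ℕ} (τ : Perm (Fin n)) : (word τ).Nodup := by
  induction n with
  | zero => exact List.nodup_nil
  | succ n ih =>
    rw [(word_perm τ).nodup_iff, List.nodup_cons]
    exact ⟨zero_notMem_map_succ _, (ih _).map (Fin.succ_injective n)⟩

theorem apply_succ_eq {n : ℕ} (τ : Perm (Fin (n + 1))) (x : Fin n) :
    τ x.succ = swap 0 (τ 0) ((Perm.decomposeFin τ).2 x).succ := by
  obtain ⟨⟨p, e⟩, rfl⟩ := Perm.decomposeFin.symm.surjective τ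
  simp

theorem mem_map_succ_word {n : ℕ} (e : Perm (Fin n)) {p : Fin (n + 1)} (hp : p ≠ 0) :
    p ∈ (word e).map Fin.succ := by
  obtain ⟨k, rfl⟩ := Fin.exists_succ_eq.2 hp
  exact List.mem_map_of_mem (mem_word e k)

/-- Removing the point `0` changes the image only of the point that `τ` sends to `0`, which is
redirected to `τ 0`. The corresponding consecutive pair starts with `τ 0`, exactly where `0` is
inserted. -/
theorem isChain_word {n : ℕ} (τ : Perm (Fin n)) :
    (word τ).IsChain fun y x => x < y → τ x = y := by
  induction n with
  | zero => exact List.isChain_nil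
  | succ n ih =>
    have h1 : ((word (Perm.decomposeFin τ).2).map Fin.succ).IsChain
        fun y x => x < y → swap 0 (τ 0) (τ x) = y := by
      rw [List.isChain_map]
      refine (ih _).imp fun y x h hxy => ?_
      rw [apply_succ_eq, swap_apply_self, h (Fin.succ_lt_succ_iff.1 hxy)]
    rw [word]
    split_ifs with h0
    · rw [List.isChain_cons]
      refine ⟨fun y _ hy => absurd hy (Fin.not_lt_zero _), h1.imp fun y x h hxy => ?_⟩
      have := h hxy
      rwa [h0, swap_self] at this
    · refine isChain_insertAfter h1 ((nodup_word _).map (Fin.succ_injective n))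
        (mem_map_succ_word _ h0) (fun y x h hy hxy => ?_) (fun _ => rfl)
        (fun x _ hx => absurd hx (Fin.not_lt_zero _))
      have h2 := h hxy
      rw [swap_apply_eq_iff] at h2
      rw [h2, swap_apply_of_ne_of_ne _ hy]
      rintro rfl
      exact absurd hxy (Fin.not_lt_zero _)

/-- Erasing `0` recovers the word of the smaller permutation, and the letter before `0`, if any,
recovers `τ 0`. -/
theorem word_injective {n : ℕ} : Function.Injective (word : Perm (Fin n) → List (Fin n)) := by
  induction n with
  | zero => exact fun _ _ _ => Subsingleton.elim _ _
  | succ n ih =>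
    intro τ τ' h
    have herase : ∀ σ : Perm (Fin (n + 1)),
        (word σ).erase 0 = (word (Perm.decomposeFin σ).2).map Fin.succ := fun σ => by
      rw [word]
      split_ifs
      · exact List.erase_cons_head _ _
      · exact erase_insertAfter (zero_notMem_map_succ _)
    have hzero : ∀ σ : Perm (Fin (n + 1)), (word σ).head? = some 0 ↔ σ 0 = 0 := fun σ => by
      rw [word]
      split_ifs with h0
      · simp [h0]
      · rw [head?_insertAfter (mem_map_succ_word _ h0)]
        exact iff_of_false (head?_ne_some (zero_notMem_map_succ _)) h0
    have h1 : (Perm.decomposeFin τ).2 = (Perm.decomposeFin τ').2 := by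
      apply ih
      apply List.map_injective_iff.2 (Fin.succ_injective n)
      rw [← herase, ← herase, h]
    have h2 : τ 0 = τ' 0 := by
      by_cases h0 : τ 0 = 0
      · rw [h0, ((hzero τ').1 (h ▸ (hzero τ).2 h0))]
      · have h0' : τ' 0 ≠ 0 := fun h' => h0 ((hzero τ).1 (h ▸ (hzero τ').2 h'))
        rw [word, word, if_neg h0, if_neg h0', h1] at h
        exact insertAfter_left_inj (zero_notMem_map_succ _) (mem_map_succ_word _ h0)
          (mem_map_succ_word _ h0') h
    refine Equiv.ext fun x => ?_
    refine Fin.cases h2 (fun k => ?_) x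
    rw [apply_succ_eq τ, apply_succ_eq τ', h1, h2]

/-! ### Words determined by the order of incomparable letters -/

section Separation

variable {α : Type*} {B : α → α → Prop}

/-- The letter just before `b` cannot lie above `b`, so it lies below. This spreads leftwards: if
`c` is below `b` and the letter before `c` were above `b`, transitivity would put `c` below that
letter. -/
theorem forall_below_of_isChain (htr : ∀ x y z, B x y → B y z → B x z) {b : α} {t l : List α}
    (hl : (l ++ b :: t).IsChain fun y x => ¬ B x y) (hc : ∀ z ∈ l, B z b ∨ B b z) :
    ∀ z ∈ l, B z b := by
  induction l with
  | nil => simp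
  | cons a l ih =>
    rw [List.cons_append, List.isChain_cons] at hl
    have ih' := ih hl.2 fun z hz => hc z (List.mem_cons_of_mem _ hz)
    intro z hz
    rcases List.mem_cons.1 hz with rfl | hz
    · refine (hc z List.mem_cons_self).resolve_right fun hbz => ?_
      cases l with
      | nil => exact hl.1 b (by simp) hbz
      | cons c l => exact hl.1 c (by simp) (htr _ _ _ (ih' c List.mem_cons_self) hbz)
    · exact ih' z hz

theorem idxOf_lt_of_mem_append [DecidableEq α] {l t : List α} {b z : α}
    (hnd : (l ++ b :: t).Nodup) (hz : z ∈ l) :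
    (l ++ b :: t).idxOf z < (l ++ b :: t).idxOf b := by
  have hb : b ∉ l := fun h => (List.nodup_append.1 hnd).2.2 b h b List.mem_cons_self rfl
  rw [List.idxOf_append_of_mem hz, List.idxOf_append_of_notMem hb]
  exact (List.idxOf_lt_length_of_mem hz).trans_le (Nat.le_add_right _ _)

/-- Two words without consecutive pairs `y, x` with `x` below `y` agree when they order
incomparable elements in the same way. -/
theorem eq_of_isChain [DecidableEq α] (htr : ∀ x y z, B x y → B y z → B x z)
    (hirr : ∀ x, ¬ B x x) {l l' : List α} (hnd : l.Nodup) (hp : l.Perm l')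
    (hl : l.IsChain fun y x => ¬ B x y) (hl' : l'.IsChain fun y x => ¬ B x y)
    (h : ∀ x ∈ l, ∀ y ∈ l, ¬ B x y → ¬ B y x → (l.idxOf x < l.idxOf y ↔ l'.idxOf x < l'.idxOf y)) :
    l = l' := by
  have key : ∀ (a b : α) (t t' : List α), (a :: t).Nodup → (a :: t).Perm (b :: t') →
      (a :: t).IsChain (fun y x => ¬ B x y) → (∀ x ∈ a :: t, ¬ B x b → ¬ B b x →
        (a :: t).idxOf x < (a :: t).idxOf b → (b :: t').idxOf x < (b :: t').idxOf b) →
      a = b ∨ B a b := by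
    intro a b t t' hnd hp hl h
    obtain ⟨s, u, hsu⟩ := List.append_of_mem (hp.mem_iff.2 (List.mem_cons_self (a := b)))
    cases s with
    | nil =>
      rw [List.nil_append, List.cons.injEq] at hsu
      exact Or.inl hsu.1
    | cons c s =>
      rw [hsu] at h hl hnd
      have hca : a = c := by
        rw [List.cons_append, List.cons.injEq] at hsu
        exact hsu.1
      rw [hca]
      refine Or.inr (forall_below_of_isChain htr hl (fun z hz => ?_) c List.mem_cons_self)
      by_contra! hcon
      have h1 := h z (List.mem_append_left _ hz) hcon.1 hcon.2 (idxOf_lt_of_mem_append hnd hz)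
      rw [List.idxOf_cons_self] at h1
      exact absurd h1 (Nat.not_lt_zero _)
  induction l generalizing l' with
  | nil => exact hp.nil_eq
  | cons a t ih =>
    cases l' with
    | nil => exact absurd hp.symm.nil_eq (List.cons_ne_nil _ _).symm
    | cons b t' =>
      have hab : a = b := by
        have hb : b ∈ a :: t := hp.mem_iff.2 List.mem_cons_self
        rcases key a b t t' hnd hp hl fun x hx h1 h2 => (h x hx b hb h1 h2).1 with h1 | h1
        · exact h1
        rcases key b a t' t (hp.nodup_iff.1 hnd) hp.symm hl' fun x hx h1 h2 =>
          (h x (hp.mem_iff.2 hx) a List.mem_cons_self h1 h2).2 with h2 | h2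
        · exact h2.symm
        · exact absurd (htr _ _ _ h1 h2) (hirr _)
      subst hab
      rw [List.nodup_cons] at hnd
      have hpt := (List.perm_cons a).1 hp
      rw [List.isChain_cons] at hl hl'
      congr 1
      refine ih hnd.2 hpt hl.2 hl'.2 fun x hx y hy hxy hyx => ?_
      have hax : a ≠ x := fun h => hnd.1 (h ▸ hx)
      have hay : a ≠ y := fun h => hnd.1 (h ▸ hy)
      have := h x (List.mem_cons_of_mem _ hx) y (List.mem_cons_of_mem _ hy) hxy hyx
      simpa [List.idxOf_cons_ne _ hax, List.idxOf_cons_ne _ hay] using this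

end Separation

end BruhatMatrix

/-! ### Inversion sequences and their ordered subproducts -/

namespace BruhatMatrix

open Equiv

theorem rk_succ {n : ℕ} (u : Perm (Fin n)) (k : Fin n) (q : ℕ) :
    rk u (k.val + 1) q = rk u k.val q + if q ≤ (u k).val then 1 else 0 := by
  have h : (if q ≤ (u k).val then 1 else 0) =
      ∑ l, if l = k then (if q ≤ (u k).val then 1 else 0) else 0 := by simp
  rw [h, rk, rk, ← Finset.sum_add_distrib]
  refine Finset.sum_congr rfl fun l _ => ?_
  rcases lt_trichotomy l.val k.val with h1 | h1 | h1
  · have : l ≠ k := fun h => by rw [h] at h1; omega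
    rw [if_neg this]
    split_ifs <;> omega
  · obtain rfl : l = k := Fin.ext h1
    simp
  · have : l ≠ k := fun h => by rw [h] at h1; omega
    rw [if_neg this]
    split_ifs <;> omega

theorem rk_mul_adjSwap_of_ne {n : ℕ} (u : Perm (Fin (n + 1))) (i : Fin n) {p : ℕ}
    (hp : p ≠ i.val + 1) (q : ℕ) : rk (u * adjSwap i) p q = rk u p q := by
  rcases lt_or_gt_of_ne (fun h => (Fin.castSucc_lt_succ (i := i)).ne (u.injective h) :
    u i.castSucc ≠ u i.succ) with h | h
  · rw [rk_eq_of_desc (v := u * adjSwap i) (i := i) (by simpa using h), mul_assoc,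
      adjSwap_mul_self, mul_one, if_neg (fun h => hp h.1), add_zero]
  · rw [rk_eq_of_desc h, if_neg (fun h => hp h.1), add_zero]

/-- Lifting property of the Bruhat order. -/
theorem BruhatLE.mul_adjSwap {n : ℕ} {u w : Perm (Fin (n + 1))} {i : Fin n}
    (hd : w i.succ < w i.castSucc) (h : BruhatLE u (w * adjSwap i)) :
    BruhatLE (u * adjSwap i) w := by
  rw [bruhatLE_iff_rk] at h ⊢
  have hne : ∀ p q, p ≠ i.val + 1 → rk (u * adjSwap i) p q ≤ rk w p q := fun p q hp => by
    rw [rk_mul_adjSwap_of_ne u i hp, ← rk_mul_adjSwap_of_ne w i hp]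
    exact h p q
  intro p q
  by_cases hp : p = i.val + 1
  · subst hp
    have a1 := rk_succ (u * adjSwap i) i.castSucc q
    have a2 := rk_succ (u * adjSwap i) i.succ q
    have b1 := rk_succ w i.castSucc q
    have b2 := rk_succ w i.succ q
    rw [Fin.val_castSucc] at a1 b1
    rw [Fin.val_succ] at a2 b2
    have c1 := hne i.val q (by omega)
    have c2 := hne (i.val + 1 + 1) q (by omega)
    rw [Fin.lt_def] at hd
    -- Ranks grow by zero or one per row. As `w` descends, its increment at `i` is at least that at
    -- `i + 1`; so the middle rank is bounded from row index `i` if the first is one, and from row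
    -- index `i + 2` if both are zero.
    split_ifs at a1 a2 b1 b2 <;> omega
  · exact hne p q hp

section SubProd

variable {α : Type*} [DecidableEq α]

/-- The ordered product of the transpositions `e j`, for `j ∈ S` with `i ≤ j < i + d`. -/
def subProd (e : ℕ → α × α) (S : Finset ℕ) : ℕ → ℕ → Perm α
  | 0, _ => 1
  | d + 1, i => (if i ∈ S then swap (e i).1 (e i).2 else 1) * subProd e S d (i + 1)

theorem subProd_succ_right (e : ℕ → α × α) (S : Finset ℕ) (d i : ℕ) :
    subProd e S (d + 1) i =
      subProd e S d i * (if i + d ∈ S then swap (e (i + d)).1 (e (i + d)).2 else 1) := by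
  induction d generalizing i with
  | zero => simp [subProd]
  | succ d ih =>
    rw [subProd, ih, subProd, mul_assoc, add_right_comm i 1 d, add_assoc i d 1]

theorem subProd_congr {e e' : ℕ → α × α} (S : Finset ℕ) {d i : ℕ}
    (h : ∀ j, i ≤ j → j < i + d → e j = e' j) : subProd e S d i = subProd e' S d i := by
  induction d generalizing i with
  | zero => rfl
  | succ d ih =>
    rw [subProd, subProd, h i le_rfl (by omega), ih fun j h1 h2 => h j (by omega) (by omega)]

end SubProd

/-- The value pairs `x < y` with `y` to the left of `x`. -/
def IsInversion {n : ℕ} (w : Perm (Fin n)) (x y : Fin n) : Prop := x < y ∧ w⁻¹ y < w⁻¹ x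

/-- An enumeration of the inversions of `w` such that all ordered subproducts of the
corresponding transpositions lead from `w` to elements below `w`. -/
structure InversionSeq {n : ℕ} (w : Perm (Fin n)) (r : ℕ) (e : ℕ → Fin n × Fin n) : Prop where
  exists_iff : ∀ x y, (∃ j < r, e j = (x, y)) ↔ IsInversion w x y
  le : ∀ S, BruhatLE (subProd e S r 0 * w) w

theorem isInversion_mul_adjSwap {n : ℕ} {w : Perm (Fin (n + 1))} {i : Fin n}
    (hd : w i.succ < w i.castSucc) {x y : Fin (n + 1)} :
    IsInversion w x y ↔
      IsInversion (w * adjSwap i) x y ∨ (w i.succ, w i.castSucc) = (x, y) := by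
  have e : ∀ z, (w * adjSwap i)⁻¹ z = adjSwap i (w⁻¹ z) := fun z => by
    rw [mul_inv_rev, Perm.mul_apply, adjSwap, swap_inv]
  have hx : w i.succ = x ↔ w⁻¹ x = i.succ := by
    rw [Perm.inv_eq_iff_eq, eq_comm]
  have hy : w i.castSucc = y ↔ w⁻¹ y = i.castSucc := by
    rw [Perm.inv_eq_iff_eq, eq_comm]
  rw [IsInversion, IsInversion, e, e, adjSwap_lt_adjSwap_iff, Prod.mk.injEq, hx, hy]
  constructor
  · rintro ⟨h1, h2⟩
    by_cases hc : w⁻¹ y = i.castSucc ∧ w⁻¹ x = i.succ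
    · exact Or.inr hc.symm
    · exact Or.inl ⟨h1, Or.inl ⟨h2, hc⟩⟩
  · rintro (⟨h1, ⟨h2, -⟩ | ⟨h2, h3⟩⟩ | ⟨h1, h2⟩)
    · exact ⟨h1, h2⟩
    · rw [← perm_apply_inv w x, ← perm_apply_inv w y, h2, h3] at h1
      exact absurd h1 hd.not_gt
    · rw [h1, h2]
      refine ⟨?_, Fin.castSucc_lt_succ⟩
      rw [← hx.2 h1, ← hy.2 h2]
      exact hd

/-- Append the inversion of a descent of `w` to a sequence for `w * adjSwap i`. If the new
transposition is selected, it turns `w` into `w * adjSwap i` and induction applies directly; if not,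
the lifting property applies. -/
theorem exists_inversionSeq {n : ℕ} (w : Perm (Fin (n + 1))) : ∃ r e, InversionSeq w r e := by
  induction hl : length w using Nat.strong_induction_on generalizing w with
  | _ l ih =>
    subst hl
    by_cases hex : ∃ i : Fin n, w i.succ < w i.castSucc
    · obtain ⟨i, hd⟩ := hex
      obtain ⟨r, e, h1, h2⟩ := ih (length (w * adjSwap i))
        (by rw [length_mul_adjSwap hd]; exact Nat.lt_succ_self _) (w * adjSwap i) rfl
      set e' : ℕ → Fin (n + 1) × Fin (n + 1) :=
        Function.update e r (w i.succ, w i.castSucc) with he'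
      have hr : e' r = (w i.succ, w i.castSucc) := Function.update_self _ _ _
      have hj : ∀ j < r, e' j = e j := fun j hj => Function.update_of_ne hj.ne _ _
      refine ⟨r + 1, e', fun x y => ?_, fun S => ?_⟩
      · rw [isInversion_mul_adjSwap hd, ← h1, ← hr]
        constructor
        · rintro ⟨j, hj1, hj2⟩
          rcases (Nat.lt_succ_iff.1 hj1).lt_or_eq with hj3 | rfl
          · exact Or.inl ⟨j, hj3, by rw [← hj j hj3, hj2]⟩
          · exact Or.inr hj2
        · rintro (⟨j, hj1, hj2⟩ | hj2)
          · exact ⟨j, by omega, by rw [hj j hj1, hj2]⟩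
          · exact ⟨r, by omega, hj2⟩
      · rw [subProd_succ_right, zero_add,
          subProd_congr S (e' := e) fun j _ h => hj j (by omega), hr]
        split_ifs
        · have : swap (w i.succ) (w i.castSucc) * w = w * adjSwap i := by
            rw [adjSwap, mul_swap_eq_swap_mul, swap_comm]
          rw [mul_assoc, this]
          exact (h2 S).trans (bruhatLE_mul_adjSwap hd)
        · have := (h2 S).mul_adjSwap hd
          rwa [mul_assoc, mul_assoc w, adjSwap_mul_self, mul_one] at this
    · have hm : StrictMono w := Fin.strictMono_iff_lt_succ.2 fun i =>
        lt_of_le_of_ne (not_lt.1 fun h => hex ⟨i, h⟩) fun h =>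
          Fin.castSucc_lt_succ.ne (w.injective h)
      refine ⟨0, fun _ => (0, 0), fun x y => ?_, fun S => ?_⟩
      · refine iff_of_false (fun ⟨j, hj, _⟩ => absurd hj (Nat.not_lt_zero j)) ?_
        rintro ⟨h1, h2⟩
        have := hm h2
        rw [perm_apply_inv, perm_apply_inv] at this
        exact absurd this h1.not_gt
      · rw [subProd, one_mul]
        exact Relation.ReflTransGen.refl

end BruhatMatrix

/-! ### Unbroken sets and the inequality between `rookCount` and `lowerCard` -/

namespace BruhatMatrix

open Equiv

section Unbroken

variable {α : Type*} [DecidableEq α]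

/-- For each `i`, the ends of `e i` lie in different cycles of the product of the later
transpositions selected by `S`. -/
def Unbroken (e : ℕ → α × α) (r : ℕ) (S : Finset ℕ) : Prop :=
  ∀ i d, i + 1 + d = r → ¬ (subProd e S d (i + 1)).SameCycle (e i).1 (e i).2

/-- The product reveals its first bit: the ends of `e i` share a cycle of the product from `i` on
exactly when `i` is selected. Cancelling that factor and repeating recovers the whole set. -/
theorem Unbroken.mem_iff_of_subProd_eq [Finite α] {e : ℕ → α × α} {r : ℕ} {S S' : Finset ℕ}
    (hS : Unbroken e r S) (hS' : Unbroken e r S') {d i : ℕ} (hi : i + d = r)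
    (h : subProd e S d i = subProd e S' d i) : ∀ j, i ≤ j → j < r → (j ∈ S ↔ j ∈ S') := by
  induction d generalizing i with
  | zero => intro j h1 h2; omega
  | succ d ih =>
    rw [subProd, subProd] at h
    have hmem : i ∈ S ↔ i ∈ S' := by
      by_cases h1 : i ∈ S <;> by_cases h2 : i ∈ S' <;> simp only [h1, h2]
      · rw [if_pos h1, if_neg h2, one_mul] at h
        refine absurd ?_ (hS' i d (by omega))
        rw [← h]
        exact sameCycle_swap_mul (hS i d (by omega))
      · rw [if_neg h1, if_pos h2, one_mul] at h
        refine absurd ?_ (hS i d (by omega))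
        rw [h]
        exact sameCycle_swap_mul (hS' i d (by omega))
    have h' : subProd e S d (i + 1) = subProd e S' d (i + 1) := by
      simp only [hmem] at h
      exact mul_left_cancel h
    intro j h1 h2
    rcases h1.eq_or_lt with rfl | h1
    · exact hmem
    · exact ih (by omega) h' j h1 h2

/-- Every selected factor joins two different cycles, so cycles only grow as factors are added on
the left. -/
theorem Unbroken.sameCycle [Finite α] {e : ℕ → α × α} {r : ℕ} {S : Finset ℕ}
    (hS : Unbroken e r S) {d i : ℕ} (hi : i + d = r) :
    ∀ j ∈ S, i ≤ j → j < r → (subProd e S d i).SameCycle (e j).1 (e j).2 := by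
  induction d generalizing i with
  | zero => intro j _ h1 h2; omega
  | succ d ih =>
    intro j hj h1 h2
    rw [subProd]
    rcases h1.eq_or_lt with rfl | h1
    · rw [if_pos hj]
      exact sameCycle_swap_mul (hS i d (by omega))
    · have := ih (by omega) j hj h1 h2
      split_ifs
      · exact sameCycle_swap_mul_of_sameCycle (hS i d (by omega)) this
      · rwa [one_mul]

/-- The graph with edges `e j`, for `j ∈ S` with `lo ≤ j < r`. -/
def edgeGraph (e : ℕ → α × α) (S : Finset ℕ) (lo r : ℕ) : SimpleGraph α :=
  SimpleGraph.fromRel fun a b => ∃ j ∈ S, lo ≤ j ∧ j < r ∧ e j = (a, b)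

theorem reachable_subProd (e : ℕ → α × α) (S : Finset ℕ) {lo r d i : ℕ} (hi : i + d = r)
    (hlo : lo ≤ i) (a : α) : (edgeGraph e S lo r).Reachable a (subProd e S d i a) := by
  induction d generalizing i with
  | zero => exact SimpleGraph.Reachable.refl _
  | succ d ih =>
    refine (ih (i := i + 1) (by omega) (by omega)).trans ?_
    rw [subProd, Perm.mul_apply]
    split_ifs with hiS
    · generalize subProd e S d (i + 1) a = z
      rcases eq_or_ne (e i).1 (e i).2 with h | h
      · rw [h, swap_self]
        exact SimpleGraph.Reachable.refl _
      · have hadj : (edgeGraph e S lo r).Adj (e i).1 (e i).2 :=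
          (SimpleGraph.fromRel_adj _ _ _).2 ⟨h, Or.inl ⟨i, hiS, hlo, by omega, rfl⟩⟩
        rcases eq_or_ne z (e i).1 with rfl | h1
        · rw [swap_apply_left]
          exact hadj.reachable
        · rcases eq_or_ne z (e i).2 with rfl | h2
          · rw [swap_apply_right]
            exact hadj.symm.reachable
          · rw [swap_apply_of_ne_of_ne h1 h2]
    · exact SimpleGraph.Reachable.refl _

/-- A choice of signs on the edges of a graph that forces a root to come first. -/
theorem lt_of_reachable {α : Type*} {e : ℕ → α × α} {S : Finset ℕ} {lo r : ℕ} {x : α} {o : α → ℕ}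
    (ho : Function.Injective o)
    (hs : ∀ j ∈ S, lo ≤ j → j < r → (o (e j).1 < o (e j).2 ↔
      (edgeGraph e S lo r).dist (e j).1 x < (edgeGraph e S lo r).dist (e j).2 x)) {z : α}
    (hz : (edgeGraph e S lo r).Reachable z x) (hne : z ≠ x) : o x < o z := by
  induction hk : (edgeGraph e S lo r).dist z x using Nat.strong_induction_on generalizing z with
  | _ k ih =>
    subst hk
    obtain ⟨p, hp⟩ := hz.exists_walk_length_eq_dist
    cases p with
    | nil => exact absurd rfl hne
    | @cons _ y _ hadj q =>
      rw [SimpleGraph.Walk.length_cons] at hp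
      have hlt : (edgeGraph e S lo r).dist y x < (edgeGraph e S lo r).dist z x := by
        have := SimpleGraph.dist_le q
        omega
      have hyz : o y < o z := by
        obtain ⟨hne', ⟨j, hj, h1, h2, h3⟩ | ⟨j, hj, h1, h2, h3⟩⟩ :=
          (SimpleGraph.fromRel_adj _ _ _).1 hadj
        · have := hs j hj h1 h2
          rw [h3] at this
          refine lt_of_le_of_ne (not_lt.1 fun hc => ?_) fun hc => hne' (ho hc).symm
          exact absurd (this.1 hc) hlt.not_gt
        · have := hs j hj h1 h2
          rw [h3] at this
          exact this.2 hlt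
      rcases eq_or_ne y x with rfl | hyx
      · exact hyz
      · exact (ih _ hlt q.reachable hyx rfl).trans hyz

/-- If the ends of `e i` shared a cycle, selected later edges would connect them. Shattering
realises both the signs rooting this component at one end and those rooting it at the other, with
the same bit at `i`; yet these order the two ends oppositely. -/
theorem OrderShatters.unbroken [Finite α] {e : ℕ → α × α} {r : ℕ} {S : Finset ℕ}
    {V : Finset (Finset ℕ)} (hne : ∀ j < r, (e j).1 ≠ (e j).2)
    (hV : ∀ v ∈ V, ∃ o : α → ℕ, Function.Injective o ∧
      ∀ j < r, (j ∈ v ↔ o (e j).1 < o (e j).2))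
    (hS : OrderShatters r V S) : Unbroken e r S := by
  intro i d hid hcyc
  have hi : i < r := by omega
  have hreach : (edgeGraph e S (i + 1) r).Reachable (e i).1 (e i).2 :=
    sameCycle_of_forall (R := (edgeGraph e S (i + 1) r).Reachable)
      (fun a => SimpleGraph.Reachable.refl a) (fun a b c h1 h2 => h1.trans h2)
      (fun a => reachable_subProd e S hid le_rfl a) hcyc
  obtain ⟨b, hb⟩ := hS.2 i hi
  have force : ∀ x z, (edgeGraph e S (i + 1) r).Reachable z x → z ≠ x →
      ∃ o : α → ℕ, (o (e i).1 < o (e i).2 ↔ b) ∧ o x < o z := by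
    intro x z hzx hne
    obtain ⟨v, hv, hvi, hvj⟩ := hb {j | (edgeGraph e S (i + 1) r).dist (e j).1 x <
      (edgeGraph e S (i + 1) r).dist (e j).2 x}
    obtain ⟨o, ho, hov⟩ := hV v hv
    refine ⟨o, by rw [← hov i hi, hvi], lt_of_reachable ho (fun j hj h1 h2 => ?_) hzx hne⟩
    rw [← hov j h2, hvj j hj h1]
    exact Set.mem_ofPred_eq ▸ Iff.rfl
  obtain ⟨o, h1, h2⟩ := force _ _ hreach (hne i hi)
  obtain ⟨o', h1', h2'⟩ := force _ _ hreach.symm (hne i hi).symm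
  exact absurd (h1.2 (h1'.1 h2')) h2.not_gt

end Unbroken

/-- A consecutive descent `y, x` of the word means that `σ` has its dot in row `w⁻¹ x` and column
`y`; if the pair were not inverted in `w`, this cell would lie in the diagram. -/
theorem word_isChain_of_avoids {n : ℕ} {w σ : Perm (Fin n)} (h : ∀ i, (i, σ i) ∉ swDiagram w) :
    (word (σ * w⁻¹)).IsChain fun y x => ¬ (x < y ∧ w⁻¹ x < w⁻¹ y) := by
  refine (isChain_word _).imp fun y x hyx => ?_
  rintro ⟨h1, h2⟩
  refine h (w⁻¹ x) (mem_swDiagram.2 ?_)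
  rw [perm_apply_inv, ← Perm.mul_apply, hyx h1]
  exact ⟨h1, h2⟩

theorem idxOf_word_injective {n : ℕ} (τ : Perm (Fin n)) :
    Function.Injective fun x => (word τ).idxOf x :=
  fun x _ h => (List.idxOf_inj (mem_word τ x)).1 h

/-- Placements inject into sign vectors on the inversions, these are at most as many as the
order-shattered sets, and such sets are unbroken. Their products inject into the lower interval of
`w` and miss `u`. -/
theorem rookCount_lt_lowerCard {n : ℕ} {w u : Perm (Fin n)} {r : ℕ} {e : ℕ → Fin n × Fin n}
    (he : InversionSeq w r e) (hu : BruhatLE u w)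
    (hne : ∀ S, Unbroken e r S → subProd e S r 0 * w ≠ u) :
    rookCount (swDiagram w) < lowerCard w := by
  classical
  set sgn : Perm (Fin n) → Finset ℕ := fun σ => (Finset.range r).filter fun j =>
    (word (σ * w⁻¹)).idxOf (e j).1 < (word (σ * w⁻¹)).idxOf (e j).2 with hsgn
  have hmem : ∀ σ, ∀ j < r, (j ∈ sgn σ ↔
      (word (σ * w⁻¹)).idxOf (e j).1 < (word (σ * w⁻¹)).idxOf (e j).2) := fun σ j hj => by
    rw [hsgn, Finset.mem_filter, Finset.mem_range, and_iff_right hj]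
  set X := Finset.univ.filter fun σ : Perm (Fin n) => ∀ i, (i, σ i) ∉ swDiagram w with hX
  have hinj : Set.InjOn sgn X := by
    intro σ hσ σ' hσ' h
    rw [Finset.mem_coe, Finset.mem_filter] at hσ hσ'
    refine mul_right_cancel (word_injective (eq_of_isChain (B := fun x y => x < y ∧ w⁻¹ x < w⁻¹ y)
      (fun x y z h1 h2 => ⟨h1.1.trans h2.1, h1.2.trans h2.2⟩) (fun x hx => lt_irrefl _ hx.1)
      (nodup_word _) ((List.perm_ext_iff_of_nodup (nodup_word _) (nodup_word _)).2 fun x =>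
        iff_of_true (mem_word _ _) (mem_word _ _)) (word_isChain_of_avoids hσ.2)
      (word_isChain_of_avoids hσ'.2) fun x _ y _ hxy hyx => ?_))
    have key : ∀ x y, x < y → ¬ (x < y ∧ w⁻¹ x < w⁻¹ y) →
        ((word (σ * w⁻¹)).idxOf x < (word (σ * w⁻¹)).idxOf y ↔
          (word (σ' * w⁻¹)).idxOf x < (word (σ' * w⁻¹)).idxOf y) := by
      intro x y hlt hb
      obtain ⟨j, hj, hej⟩ := (he.exists_iff x y).2 ⟨hlt, lt_of_le_of_ne
        (not_lt.1 fun h => hb ⟨hlt, h⟩) fun h => hlt.ne' (w⁻¹.injective h)⟩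
      have h1 := hmem σ j hj
      rw [h, hmem σ' j hj, hej] at h1
      exact h1.symm
    rcases lt_trichotomy x y with hlt | rfl | hlt
    · exact key x y hlt hxy
    · simp
    · have h1 := key y x hlt hyx
      have h2 : (word (σ * w⁻¹)).idxOf x ≠ (word (σ * w⁻¹)).idxOf y :=
        fun h => hlt.ne' (idxOf_word_injective _ h)
      have h3 : (word (σ' * w⁻¹)).idxOf x ≠ (word (σ' * w⁻¹)).idxOf y :=
        fun h => hlt.ne' (idxOf_word_injective _ h)
      omega
  have hne' : ∀ j < r, (e j).1 ≠ (e j).2 := fun j hj =>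
    ((he.exists_iff _ _).1 ⟨j, hj, rfl⟩).1.ne
  have h1 := card_le_card_orderShatters r (X.image sgn) fun v hv => by
    obtain ⟨σ, -, rfl⟩ := Finset.mem_image.1 hv
    exact Finset.filter_subset _ _
  rw [Finset.card_image_of_injOn hinj] at h1
  have hunb : ∀ S, OrderShatters r (X.image sgn) S → Unbroken e r S := fun S =>
    OrderShatters.unbroken hne' fun v hv => by
      obtain ⟨σ, -, rfl⟩ := Finset.mem_image.1 hv
      exact ⟨_, idxOf_word_injective (σ * w⁻¹), hmem σ⟩
  refine h1.trans_lt ?_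
  rw [lowerCard]
  have hu' : u ∈ Finset.univ.filter fun u : Perm (Fin n) => BruhatLE u w := by simpa using hu
  refine lt_of_le_of_lt ?_ (Finset.card_erase_lt_of_mem hu')
  refine Finset.card_le_card_of_injOn (fun S => subProd e S r 0 * w) (fun S hS => ?_) ?_
  · rw [Finset.mem_coe, Finset.mem_filter] at hS
    rw [Finset.mem_coe, Finset.mem_erase]
    exact ⟨hne S (hunb S hS.2), by simpa using he.le S⟩
  · intro S hS S' hS' h
    rw [Finset.mem_coe, Finset.mem_filter, Finset.mem_powerset] at hS hS'
    have h2 := (hunb S hS.2).mem_iff_of_subProd_eq (hunb S' hS'.2) (zero_add r)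
      (mul_right_cancel h)
    ext j
    by_cases hj : j < r
    · exact h2 j (Nat.zero_le _) hj
    · exact iff_of_false (fun h => hj (Finset.mem_range.1 (hS.1 h)))
        fun h => hj (Finset.mem_range.1 (hS'.1 h))

/-- An element `c * w` that is not reached: some cycle of `c` splits into two parts without
inversions between them. -/
theorem subProd_mul_ne {n : ℕ} {w u : Perm (Fin n)} {r : ℕ} {e : ℕ → Fin n × Fin n}
    (he : InversionSeq w r e) {C A : Set (Fin n)} {z : Fin n}
    (hC : ∀ k, w k ∈ C → u k ∈ C) (hA : A ⊆ C) (hz : w z ∈ A) (huz : u z ∉ A)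
    (hinv : ∀ x ∈ A, ∀ y ∈ C, y ∉ A → ¬ IsInversion w x y ∧ ¬ IsInversion w y x)
    (S : Finset ℕ) (hS : Unbroken e r S) : subProd e S r 0 * w ≠ u := by
  rintro rfl
  set c := subProd e S r 0
  have hC' : ∀ x ∈ C, c x ∈ C := fun x hx => by
    have := hC (w⁻¹ x) (by rwa [perm_apply_inv])
    rwa [Perm.mul_apply, perm_apply_inv] at this
  have hcyc : ∀ a b, c.SameCycle a b → a ∈ C → b ∈ C := fun a b hab =>
    sameCycle_of_forall (R := fun a b => a ∈ C → b ∈ C) (fun a h => h)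
      (fun a b c h1 h2 h => h2 (h1 h)) hC' hab
  -- The path from `w z` to its image uses selected edges. Each joins points of one cycle, hence
  -- stays in `C`, and is an inversion, hence cannot leave `A`.
  have hreach := reachable_subProd e S (zero_add r) (le_refl 0) (w z)
  refine huz ?_
  rw [Perm.mul_apply]
  rw [SimpleGraph.reachable_iff_reflTransGen] at hreach
  change Relation.ReflTransGen _ _ (c (w z)) at hreach
  generalize c (w z) = y at hreach
  induction hreach with
  | refl => exact hz
  | @tail a b _ hab ih =>
    have hadj : c.SameCycle a b ∧ (IsInversion w a b ∨ IsInversion w b a) := by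
      obtain ⟨-, ⟨j, hj, h1, h2, h3⟩ | ⟨j, hj, h1, h2, h3⟩⟩ :=
        (SimpleGraph.fromRel_adj _ _ _).1 hab
      · have := hS.sameCycle (zero_add r) j hj h1 h2
        rw [h3] at this
        exact ⟨this, Or.inl ((he.exists_iff _ _).1 ⟨j, h2, h3⟩)⟩
      · have := hS.sameCycle (zero_add r) j hj h1 h2
        rw [h3] at this
        exact ⟨this.symm, Or.inr ((he.exists_iff _ _).1 ⟨j, h2, h3⟩)⟩
    by_contra hb
    have h1 := hinv a ih b (hcyc a b hadj.1 (hA ih)) hb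
    tauto

end BruhatMatrix

/-! ### From the four patterns to missed elements of the lower interval -/

namespace BruhatMatrix

open Equiv

section Pattern

variable {n k : ℕ}

/-- The product of the transpositions in a list. -/
def swapProd (L : List (Fin k × Fin k)) : Perm (Fin k) := (L.map fun c => swap c.1 c.2).prod

/-- Each transposition in the list, applied to positions, creates an ascent of `p ∘ σ`. -/
def IsDescending (p : Fin k → ℕ) : Perm (Fin k) → List (Fin k × Fin k) → Bool
  | _, [] => true
  | σ, c :: L => decide (c.1 < c.2) && decide (p (σ c.2) < p (σ c.1)) &&
      IsDescending p (σ * swap c.1 c.2) L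

theorem viaEmbedding_mul_swap (f : Fin k ↪ Fin n) (σ : Perm (Fin k)) (a b : Fin k) :
    (σ * swap a b).viaEmbedding f = σ.viaEmbedding f * swap (f a) (f b) := by
  refine Equiv.ext fun x => ?_
  by_cases hx : x ∈ Set.range f
  · obtain ⟨c, rfl⟩ := hx
    rw [Perm.viaEmbedding_apply, Perm.mul_apply, Perm.mul_apply, f.injective.swap_apply,
      Perm.viaEmbedding_apply]
  · have ha : x ≠ f a := fun h => hx ⟨a, h.symm⟩
    have hb : x ≠ f b := fun h => hx ⟨b, h.symm⟩
    rw [Perm.mul_apply, swap_apply_of_ne_of_ne ha hb, Perm.viaEmbedding_apply_of_notMem _ _ _ hx,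
      Perm.viaEmbedding_apply_of_notMem _ _ _ hx]

theorem bruhatLE_of_isDescending {w : Perm (Fin n)} {p : Fin k → ℕ} {f : Fin k ↪ Fin n}
    (hf : StrictMono f) (hp : ∀ a b, w (f a) < w (f b) ↔ p a < p b) {L : List (Fin k × Fin k)}
    {σ : Perm (Fin k)} (hL : IsDescending p σ L) :
    BruhatLE (w * (σ * swapProd L).viaEmbedding f) (w * σ.viaEmbedding f) := by
  induction L generalizing σ with
  | nil =>
    rw [swapProd, List.map_nil, List.prod_nil, mul_one]
    exact Relation.ReflTransGen.refl
  | cons c L ih =>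
    rw [IsDescending, Bool.and_eq_true, Bool.and_eq_true, decide_eq_true_eq,
      decide_eq_true_eq] at hL
    have h1 := ih hL.2
    rw [viaEmbedding_mul_swap, ← mul_assoc w] at h1
    have h2 : swapProd (c :: L) = swap c.1 c.2 * swapProd L := by
      rw [swapProd, List.map_cons, List.prod_cons]; rfl
    rw [h2, ← mul_assoc]
    refine h1.trans (bruhatLE_mul_swap _ (hf hL.1.1) ?_)
    rw [Perm.mul_apply, Perm.mul_apply, Perm.viaEmbedding_apply, Perm.viaEmbedding_apply, hp]
    exact hL.1.2

theorem isInversion_apply_iff {w : Perm (Fin n)} {i j : Fin n} :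
    IsInversion w (w i) (w j) ↔ w i < w j ∧ j < i := by
  rw [IsInversion, perm_inv_apply, perm_inv_apply]

/-- A criterion, checked on the pattern alone, for an element below `w` that is not reached. -/
theorem rookCount_lt_of_containsPattern {w : Perm (Fin n)} {p : Fin k → ℕ}
    (h : ContainsPattern w p) (L : List (Fin k × Fin k)) (C A : Finset (Fin k)) (z : Fin k)
    (hL : IsDescending p 1 L) (hC : ∀ a ∈ C, swapProd L a ∈ C) (hA : A ⊆ C) (hz : z ∈ A)
    (hLz : swapProd L z ∉ A)
    (hinv : ∀ a ∈ A, ∀ b ∈ C, b ∉ A → ¬ (p a < p b ∧ b < a) ∧ ¬ (p b < p a ∧ a < b)) :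
    rookCount (swDiagram w) < lowerCard w := by
  obtain ⟨f₀, hf, hp⟩ := h
  cases n with
  | zero => exact (f₀ z).elim0
  | succ n =>
    obtain ⟨f, rfl⟩ : ∃ f : Fin k ↪ Fin (n + 1), f₀ = f := ⟨⟨f₀, hf.injective⟩, rfl⟩
    obtain ⟨r, e, he⟩ := exists_inversionSeq w
    have hle := bruhatLE_of_isDescending hf hp hL
    have h1 : (1 : Perm (Fin k)).viaEmbedding f = 1 := map_one (Perm.viaEmbeddingHom f)
    rw [one_mul, h1, mul_one] at hle
    have hu : ∀ a, (w * (swapProd L).viaEmbedding f) (f a) = w (f (swapProd L a)) := fun a => by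
      rw [Perm.mul_apply, Perm.viaEmbedding_apply]
    have hwf : Function.Injective fun a => w (f a) := w.injective.comp f.injective
    have hmem : ∀ (T : Finset (Fin k)) a, w (f a) ∈ (fun a => w (f a)) '' (T : Set (Fin k)) ↔
        a ∈ T := fun T a => by
      rw [hwf.mem_set_image (a := a), Finset.mem_coe]
    refine rookCount_lt_lowerCard he hle (subProd_mul_ne he
      (C := (fun a => w (f a)) '' (C : Set (Fin k)))
      (A := (fun a => w (f a)) '' (A : Set (Fin k))) (z := f z) ?_
      (Set.image_mono (Finset.coe_subset.2 hA)) ((hmem A z).2 hz) ?_ ?_)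
    · rintro j ⟨a, ha, haj⟩
      have : f a = j := w.injective haj
      rw [← this, hu, hmem]
      exact hC a ha
    · rw [hu, hmem]
      exact hLz
    · rintro _ ⟨a, ha, rfl⟩ _ ⟨b, hb, rfl⟩ hbA
      rw [hmem] at hbA
      simp only [isInversion_apply_iff, hp, hf.lt_iff_lt]
      exact hinv a ha b hb hbA

end Pattern

theorem rookCount_lt_of_not_isGasharovReiner {n : ℕ} {w : Perm (Fin n)}
    (h : ¬ IsGasharovReiner w) : rookCount (swDiagram w) < lowerCard w := by
  by_contra hcon
  refine h ⟨fun hp => hcon ?_, fun hp => hcon ?_, fun hp => hcon ?_, fun hp => hcon ?_⟩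
  -- The product is `(0 3)(1 2)` and leads from 4231 to 1324; its cycle on the values 2, 3 joins a
  -- noninversion. In the other patterns `C` is likewise one cycle of the product: on the values 3,
  -- 1, 4, with 4 split off; on 2, 5, 3, with 2 split off; on 3, 1, 6, 4, split into 3, 1 and 6, 4.
  · exact rookCount_lt_of_containsPattern hp [(0, 1), (0, 3), (1, 2), (2, 3)] {1, 2} {1} 1
      (by decide) (by decide) (by decide) (by decide) (by decide) (by decide)
  · exact rookCount_lt_of_containsPattern hp [(0, 2), (1, 2), (1, 4), (2, 3), (3, 4)] {0, 2, 3} {3} 3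
      (by decide) (by decide) (by decide) (by decide) (by decide) (by decide)
  · exact rookCount_lt_of_containsPattern hp [(0, 1), (0, 3), (1, 4), (2, 3), (3, 4)] {1, 2, 4} {1} 1
      (by decide) (by decide) (by decide) (by decide) (by decide) (by decide)
  · exact rookCount_lt_of_containsPattern hp [(0, 2), (1, 2), (1, 4), (2, 5), (3, 4), (4, 5)]
      {0, 2, 3, 5} {0, 2} 2
      (by decide) (by decide) (by decide) (by decide) (by decide) (by decide)

end BruhatMatrix

/-- The finite field with `q` elements is an arbitrary finite field `F`, `q = Nat.card F`;
the equation is an identity between functions of the prime power `q`. The second part says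
that for other `w` the equation fails for every sufficiently large `q`. -/
theorem mainTheorem2 (n : ℕ) (w : Equiv.Perm (Fin n)) :
    ((∀ (F : Type) [Field F] [Finite F], BruhatMatrix.CountEqPoincare F w) ↔
      BruhatMatrix.IsGasharovReiner w) ∧
    (¬ BruhatMatrix.IsGasharovReiner w →
      ∃ N : ℕ, ∀ (F : Type) [Field F] [Finite F], N ≤ Nat.card F →
        ¬ BruhatMatrix.CountEqPoincare F w) := by
  have hfail : ¬ BruhatMatrix.IsGasharovReiner w →
      ∃ N : ℕ, ∀ (F : Type) [Field F] [Finite F], N ≤ Nat.card F →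
        ¬ BruhatMatrix.CountEqPoincare F w := fun h =>
    ⟨_, fun F _ _ hF => BruhatMatrix.not_countEqPoincare
      (BruhatMatrix.rookCount_lt_of_not_isGasharovReiner h) F hF⟩
  refine ⟨⟨fun h => ?_, fun h F _ _ => ?_⟩, hfail⟩
  · by_contra hw
    obtain ⟨N, hN⟩ := hfail hw
    obtain ⟨p, hp, hprime⟩ := Nat.exists_infinite_primes N
    have : Fact p.Prime := ⟨hprime⟩
    exact hN (ZMod p) (by rwa [Nat.card_zmod]) (h (ZMod p))
  · let := Fintype.ofFinite F
    exact (BruhatMatrix.countEqPoincare_iff F w).2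
      ((BruhatMatrix.avoiding_iff.2 h).matCount_eq F)
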